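/- **Setting.** Let $(M,\{\cdot,\cdot\})$ be a (second countable, Hausdorff) Poisson manifold of dimension $d$, and let $\star=\sum_{r\ge 0}\lambda^r C_r$ be a Hermitian star product on $C^\infty(M)[[\lambda]]$ (complex-valued functions): the $C_r$ are $\mathbb{C}$-bilinear bidifferential operators, $C_0(f,g)=fg$, $C_1(f,g)-C_1(g,f)=\mathrm{i}\{f,g\}$, $\star$ is associative, $1$ is its unit, and $\overline{f\star g}=\overline g\star\overline f$ (with $\overline\lambda=\lambda$). Since the $C_r$ are local, $\star$ restricts to every open subset. Matrices over $C^\infty(\mathcal U)[[\lambda]]$ are multiplied with $\star$, and $B^*$ is the conjugate transpose of $B$. Let $E\to M$ be a smooth complex vector bundle of rank $k$, $\{\mathcal U_\alpha\}_{\alpha=1}^m$ a finite open cover of $M$, and $e_\alpha=(e_{\alpha,1},\dots,e_{\alpha,k})$ a smooth frame of $E$ over $\mathcal U_\alpha$; define $\phi_{\alpha\beta}$ on $\mathcal U_\alpha\cap\mathcal U_\beta$ by $e_\beta=e_\alpha\phi_{\alpha\beta}$. Write $s=e_\alpha s_\alpha$ on $\mathcal U_\alpha$ for sections $s$ and $Ae_\alpha=e_\alpha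 A_\alpha$ for $A\in\Gamma^\infty(\mathrm{End}(E))$, extended coefficientwise to formal series. Suppose given deformed transition matrices $$\Phi_{\alpha\beta}=\phi_{\alpha\beta}+\sum_{r\ge 1}\lambda^r\phi^{(r)}_{\alpha\beta}\in M_k(C^\infty(\mathcal U_\alpha\cap\mathcal U_\beta))[[\lambda]]$$ satisfying the cocycle conditions $\Phi_{\alpha\beta}\star\Phi_{\beta\alpha}=1$ on $\mathcal U_\alpha\cap\mathcal U_\beta$ and $\Phi_{\alpha\beta}\star\Phi_{\beta\gamma}\star\Phi_{\gamma\alpha}=1$ on $\mathcal U_\alpha\cap\mathcal U_\beta\cap\mathcal U_\gamma$, and $\Phi_{\alpha\beta}^*=\Phi_{\beta\alpha}$. Let $\{\chi_\alpha\}$ be a smooth partition of unity subordinate to the cover, and for $s\in\Gamma^\infty(E)[[\lambda]]$ put $$\mathbf s_\alpha=\sum_\beta \Phi_{\alpha\beta}\star\chi_\beta\star s_\beta\in C^\infty(\mathcal U_\alpha)^k[[\lambda]]$$ (here and below, summands are extended by zero). Then the following hold. 1. There is a Hermitian fiber metric $h_0$ on $E$ for which all the frames $e_\alpha$ are orthonormal.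 2. $s\mapsto\{\mathbf s_\alpha\}$ is a $\mathbb{C}[[\lambda]]$-linear bijection from $\Gamma^\infty(E)[[\lambda]]$ onto the set of all collections $\{v_\alpha\in C^\infty(\mathcal U_\alpha)^k[[\lambda]]\}$ with $\Phi_{\alpha\beta}\star v_\beta=v_\alpha$ on $\mathcal U_\alpha\cap\mathcal U_\beta$; the zeroth order term of $\mathbf s_\alpha$ is that of $s_\alpha$. 3. There is a right $(C^\infty(M)[[\lambda]],\star)$-module structure $\bullet$ on $\Gamma^\infty(E)[[\lambda]]$ such that, writing $\mathbf{(s\bullet f)}_\alpha$ for the local expression of $s\bullet f$ as in 2, $\mathbf{(s\bullet f)}_\alpha=\mathbf s_\alpha\star f$. It is $\mathbb{C}[[\lambda]]$-bilinear, and in zeroth order it is the pointwise multiplication. 4. There is a map $h:\Gamma^\infty(E)[[\lambda]]\times\Gamma^\infty(E)[[\lambda]]\to C^\infty(M)[[\lambda]]$ with $h(s,t)|_{\mathcal U_\alpha}=\sum_{l=1}^k\overline{\mathbf s_\alpha^l}\star\mathbf t_\alpha^l$ for all $\alpha$. It is a Hermitian inner product: $\mathbb{C}[[\lambda]]$-linear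 in the second argument, $h(s,t)=\overline{h(t,s)}$, $h(s,t\bullet f)=h(s,t)\star f$, and $h(s,s)$ is a positive element of $(C^\infty(M)[[\lambda]],\star)$, i.e. it is Hermitian and $\omega(h(s,s))\ge0$ in the ordered ring $\mathbb{R}[[\lambda]]$ for every positive $\mathbb{C}[[\lambda]]$-linear functional $\omega$ (one with $\omega(\overline f\star f)\ge 0$ for all $f$). Its zeroth order is $h_0$. 5. $(\Gamma^\infty(E)[[\lambda]],\bullet)$ is a finitely generated projective right $(C^\infty(M)[[\lambda]],\star)$-module. 6. Explicitly, let $\{\rho_\alpha\}$ be any quadratic partition of unity subordinate to the cover ($\rho_\alpha\in C^\infty(M)$, $\operatorname{supp}\rho_\alpha\subseteq\mathcal U_\alpha$, $\sum_\alpha\overline{\rho_\alpha}\rho_\alpha=1$), and for $A\in\Gamma^\infty(\mathrm{End}(E))[[\lambda]]$ put $$\widetilde T_\alpha(A)=\sum_\gamma\Phi_{\alpha\gamma}\star\overline{\rho_\gamma}\star A_\gamma\star\rho_\gamma\star\Phi_{\gamma\alpha}.$$ (a) $\widetilde T$ is a bijection from $\Gamma^\infty(\mathrm{End}(E))[[\lambda]]$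 onto the collections $\{B_\alpha\in M_k(C^\infty(\mathcal U_\alpha))[[\lambda]]\}$ with $\Phi_{\alpha\beta}\star B_\beta\star\Phi_{\beta\alpha}=B_\alpha$, and the zeroth order term of $\widetilde T_\alpha(A)$ is that of $A_\alpha$. (b) The following data exist, where $A^*$ denotes the (coefficientwise) $h_0$-adjoint: a product $\widetilde\star$ on $\Gamma^\infty(\mathrm{End}(E))[[\lambda]]$ with $\widetilde T_\alpha(A\,\widetilde\star\,B)=\widetilde T_\alpha(A)\star\widetilde T_\alpha(B)$, and its unit; a $\widetilde\star$-invertible $U$ with $(U^{-1})^*\,\widetilde\star\,U^{-1}=\mathrm{id}_E$; a product $\star'$ with $S(A\,\widetilde\star\,B)=S(A)\star' S(B)$, where $S(A)=(U^{-1})^*\,\widetilde\star\,A\,\widetilde\star\,U^{-1}$; and a $\star'$-invertible $V$ with $\sum_\alpha\overline{\rho_\alpha}\star'\rho_\alpha=V^*\star' V$ (functions being viewed as endomorphism fields). (c) For every choice of data as in (b), put $T_\alpha(A)=\widetilde T_\alpha(U^*)\star\widetilde T_\alpha(A)\star\widetilde T_\alpha(U)$ and $\boldsymbol\chi_\alpha=\rho_\alpha\star'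 V^{-1}$. Then $T_\alpha(A\star' B)=T_\alpha(A)\star T_\alpha(B)$, $T_\alpha(A^*)=T_\alpha(A)^*$, $T_\alpha(\mathrm{id}_E)=1$, $\sum_\alpha\boldsymbol\chi_\alpha^*\star'\boldsymbol\chi_\alpha=\mathrm{id}_E$ and $\operatorname{supp}\boldsymbol\chi_\alpha\subseteq\mathcal U_\alpha$. Moreover, with $n=mk$, there are right module homomorphisms $\epsilon:\Gamma^\infty(E)[[\lambda]]\to C^\infty(M)^n[[\lambda]]$ and $\pi:C^\infty(M)^n[[\lambda]]\to\Gamma^\infty(E)[[\lambda]]$ with $$\epsilon(s)=\bigl(T_1(\boldsymbol\chi_1)\star\mathbf s_1,\dots,T_m(\boldsymbol\chi_m)\star\mathbf s_m\bigr),$$ (the $\alpha$-th entry is extended by zero outside $\mathcal U_\alpha$), and, for $t=(t_1,\dots,t_m)$ with $t_\gamma\in C^\infty(M)^k[[\lambda]]$, the section $\pi(t)$ has the local expressions (as in 2) $\sum_\gamma\Phi_{\alpha\gamma}\star T_\gamma(\boldsymbol\chi_\gamma^*)\star t_\gamma$ on $\mathcal U_\alpha$. They satisfy $\pi\circ\epsilon=\mathrm{id}$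 and $\epsilon(\pi(t))=P\star t$ for a matrix $P\in M_n(C^\infty(M))[[\lambda]]$ with $P\star P=P$; and $\epsilon$ is injective with image $P\star C^\infty(M)^n[[\lambda]]$. -/

import Mathlib

open scoped Manifold ContDiff Topology PowerSeries Matrix
open TopologicalSpace Bundle Finset.HasAntidiagonal

noncomputable section

namespace QuantumSerreSwan

/-! ## Formal power series -/

/-- The formal power series `V[[λ]]` with coefficients in `V`; `v.coeff n` is the coefficient of
`λ ^ n`. -/
@[ext] structure FormalSeries (V : Type*) where
  coeff : ℕ → V

namespace FormalSeries

variable {V W : Type*}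

/-- Apply a map to every coefficient. -/
def map (F : V → W) (v : FormalSeries V) : FormalSeries W := ⟨fun n => F (v.coeff n)⟩

section AddCommGroup

variable [AddCommGroup V]

/-- The constant series `v + 0 λ + 0 λ² + ⋯`. -/
def const (v : V) : FormalSeries V := ⟨fun n => if n = 0 then v else 0⟩

instance : Zero (FormalSeries V) := ⟨⟨0⟩⟩
instance : Add (FormalSeries V) := ⟨fun v w => ⟨v.coeff + w.coeff⟩⟩
instance : Neg (FormalSeries V) := ⟨fun v => ⟨-v.coeff⟩⟩

@[simp] theorem coeff_add (v w : FormalSeries V) (n : ℕ) :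
    (v + w).coeff n = v.coeff n + w.coeff n := rfl
@[simp] theorem coeff_neg (v : FormalSeries V) (n : ℕ) : (-v).coeff n = -v.coeff n := rfl
@[simp] theorem coeff_zero (n : ℕ) : (0 : FormalSeries V).coeff n = 0 := rfl

instance : AddCommGroup (FormalSeries V) where
  add_assoc u v w := by ext n; simp [add_assoc]
  zero_add v := by ext n; simp
  add_zero v := by ext n; simp
  add_comm v w := by ext n; simp [add_comm]
  neg_add_cancel v := by ext n; simp
  nsmul := nsmulRec
  zsmul := zsmulRec

variable [Module ℂ V]

/-- The `ℂ[[λ]]`-module structure of `V[[λ]]`, by the Cauchy product. -/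
instance : SMul ℂ⟦X⟧ (FormalSeries V) :=
  ⟨fun a v => ⟨fun n => ∑ p ∈ antidiagonal n, PowerSeries.coeff p.1 a • v.coeff p.2⟩⟩

theorem coeff_smul (a : ℂ⟦X⟧) (v : FormalSeries V) (n : ℕ) :
    (a • v).coeff n = ∑ p ∈ antidiagonal n, PowerSeries.coeff p.1 a • v.coeff p.2 := rfl

instance : Module ℂ⟦X⟧ (FormalSeries V) where
  one_smul v := by
    ext n
    rw [coeff_smul, Finset.Nat.sum_antidiagonal_eq_sum_range_succ_mk, Finset.sum_range_succ']
    simp [PowerSeries.coeff_one]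
  mul_smul a b v := by
    ext n
    simp only [coeff_smul, PowerSeries.coeff_mul, Finset.sum_smul, Finset.smul_sum, smul_smul]
    rw [Finset.sum_sigma', Finset.sum_sigma']
    refine Finset.sum_nbij' (fun x => ⟨(x.2.1, x.2.2 + x.1.2), (x.2.2, x.1.2)⟩)
      (fun x => ⟨(x.1.1 + x.2.1, x.2.2), (x.1.1, x.2.1)⟩) ?_ ?_ ?_ ?_ ?_
    · rintro ⟨⟨i, j⟩, ⟨k, l⟩⟩ h
      simp only [Finset.mem_sigma, mem_antidiagonal] at h ⊢
      grind
    · rintro ⟨⟨i, j⟩, ⟨k, l⟩⟩ h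
      simp only [Finset.mem_sigma, mem_antidiagonal] at h ⊢
      grind
    · rintro ⟨⟨i, j⟩, ⟨k, l⟩⟩ h
      simp only [Finset.mem_sigma, mem_antidiagonal] at h
      obtain ⟨h1, rfl⟩ := h
      rfl
    · rintro ⟨⟨i, j⟩, ⟨k, l⟩⟩ h
      simp only [Finset.mem_sigma, mem_antidiagonal] at h
      obtain ⟨h1, rfl⟩ := h
      rfl
    · rintro ⟨⟨i, j⟩, ⟨k, l⟩⟩ h
      rfl
  smul_zero a := by ext n; simp [coeff_smul]
  smul_add a v w := by ext n; simp [coeff_smul, Finset.sum_add_distrib]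
  add_smul a b v := by ext n; simp [coeff_smul, add_smul, Finset.sum_add_distrib]
  zero_smul v := by ext n; simp [coeff_smul]

end AddCommGroup

/-- The product `∑ₙ λⁿ ∑_{a+b+c=n} C_a(f_b, g_c)` of formal series defined by cochains `C_r`. -/
def cochainProd [AddCommGroup V] (C : ℕ → V → V → V) (f g : FormalSeries V) : FormalSeries V :=
  ⟨fun n => ∑ p ∈ antidiagonal n, ∑ q ∈ antidiagonal p.2, C p.1 (f.coeff q.1) (g.coeff q.2)⟩

end FormalSeries

/-! ## Hermitian formal deformations of commutative `*`-algebras -/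

/-- A Hermitian formal associative unital deformation
`f ⋆ g = f g + ∑_{r ≥ 1} λʳ C_r(f, g)` of the commutative `*`-algebra `A` over `ℂ`. -/
structure HermitianDeformation (A : Type*) [CommRing A] [StarRing A] [Algebra ℂ A] where
  C : ℕ → A →ₗ[ℂ] A →ₗ[ℂ] A
  C_zero : ∀ f g, C 0 f g = f * g
  assoc : ∀ f g h : FormalSeries A,
    FormalSeries.cochainProd (fun r a b => C r a b)
        (FormalSeries.cochainProd (fun r a b => C r a b) f g) h =
      FormalSeries.cochainProd (fun r a b => C r a b) f
        (FormalSeries.cochainProd (fun r a b => C r a b) g h)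
  one_left : ∀ r f, 0 < r → C r 1 f = 0
  one_right : ∀ r f, 0 < r → C r f 1 = 0
  hermitian : ∀ r f g, star (C r f g) = C r (star g) (star f)

namespace HermitianDeformation

variable {A : Type*} [CommRing A] [StarRing A] [Algebra ℂ A]

/-- The deformed algebra `(A[[λ]], ⋆)`. -/
@[ext] structure Alg (_D : HermitianDeformation A) extends FormalSeries A

variable {D : HermitianDeformation A}

namespace Alg

instance : Zero D.Alg := ⟨⟨0⟩⟩
instance : Add D.Alg := ⟨fun f g => ⟨f.toFormalSeries + g.toFormalSeries⟩⟩
instance : Neg D.Alg := ⟨fun f => ⟨-f.toFormalSeries⟩⟩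
instance : SMul ℂ⟦X⟧ D.Alg := ⟨fun a f => ⟨a • f.toFormalSeries⟩⟩
instance : Mul D.Alg := ⟨fun f g =>
  ⟨FormalSeries.cochainProd (fun r a b => D.C r a b) f.toFormalSeries g.toFormalSeries⟩⟩
instance : One D.Alg := ⟨⟨FormalSeries.const 1⟩⟩
/-- The `*`-involution acts coefficientwise, that is, the formal parameter `λ` is real. -/
instance : Star D.Alg := ⟨fun f => ⟨f.toFormalSeries.map star⟩⟩

/-- An element of `A`, seen as a constant series. -/
def const (a : A) : D.Alg := ⟨FormalSeries.const a⟩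

theorem ext_coeff {f g : D.Alg} (h : ∀ n, f.coeff n = g.coeff n) : f = g :=
  Alg.ext (funext h)

@[simp] theorem coeff_add (f g : D.Alg) (n : ℕ) : (f + g).coeff n = f.coeff n + g.coeff n := rfl
@[simp] theorem coeff_neg (f : D.Alg) (n : ℕ) : (-f).coeff n = -f.coeff n := rfl
@[simp] theorem coeff_zero (n : ℕ) : (0 : D.Alg).coeff n = 0 := rfl
@[simp] theorem coeff_star (f : D.Alg) (n : ℕ) : (star f).coeff n = star (f.coeff n) := rfl
theorem coeff_one (n : ℕ) : (1 : D.Alg).coeff n = if n = 0 then 1 else 0 := rfl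
theorem coeff_mul (f g : D.Alg) (n : ℕ) :
    (f * g).coeff n = ∑ p ∈ antidiagonal n, ∑ q ∈ antidiagonal p.2,
      D.C p.1 (f.coeff q.1) (g.coeff q.2) := rfl

instance : Ring D.Alg where
  add_assoc u v w := ext_coeff fun n => by simp [add_assoc]
  zero_add v := ext_coeff fun n => by simp
  add_zero v := ext_coeff fun n => by simp
  add_comm v w := ext_coeff fun n => by simp [add_comm]
  neg_add_cancel v := ext_coeff fun n => by simp
  nsmul := nsmulRec
  zsmul := zsmulRec
  left_distrib f g h := ext_coeff fun n => by simp [coeff_mul, Finset.sum_add_distrib]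
  right_distrib f g h := ext_coeff fun n => by simp [coeff_mul, Finset.sum_add_distrib]
  zero_mul f := ext_coeff fun n => by simp [coeff_mul]
  mul_zero f := ext_coeff fun n => by simp [coeff_mul]
  mul_assoc f g h := Alg.ext (congrArg FormalSeries.coeff
    (D.assoc f.toFormalSeries g.toFormalSeries h.toFormalSeries))
  one_mul f := ext_coeff fun n => by
    rw [coeff_mul, Finset.sum_eq_single (0, n), Finset.sum_eq_single (0, n)]
    · simp [coeff_one, D.C_zero]
    · rintro ⟨a, b⟩ hq hne
      have ha : a ≠ 0 := by rintro rfl; simp_all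
      simp [coeff_one, ha]
    · simp
    · rintro ⟨a, b⟩ hp hne
      have ha : 0 < a := by
        rcases Nat.eq_zero_or_pos a with rfl | h
        · simp_all
        · exact h
      refine Finset.sum_eq_zero fun q _ => ?_
      rw [coeff_one]
      split_ifs <;> simp [D.one_left _ _ ha]
    · simp
  mul_one f := ext_coeff fun n => by
    rw [coeff_mul, Finset.sum_eq_single (0, n), Finset.sum_eq_single (n, 0)]
    · simp [coeff_one, D.C_zero]
    · rintro ⟨a, b⟩ hq hne
      have ha : b ≠ 0 := by rintro rfl; simp_all
      simp [coeff_one, ha]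
    · simp
    · rintro ⟨a, b⟩ hp hne
      have ha : 0 < a := by
        rcases Nat.eq_zero_or_pos a with rfl | h
        · simp_all
        · exact h
      refine Finset.sum_eq_zero fun q _ => ?_
      rw [coeff_one]
      split_ifs <;> simp [D.one_right _ _ ha]
    · simp

instance : Module ℂ⟦X⟧ D.Alg where
  one_smul f := Alg.ext (congrArg FormalSeries.coeff (one_smul _ f.toFormalSeries))
  mul_smul a b f := Alg.ext (congrArg FormalSeries.coeff (mul_smul a b f.toFormalSeries))
  smul_zero a := Alg.ext (congrArg FormalSeries.coeff (smul_zero a))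
  smul_add a f g :=
    Alg.ext (congrArg FormalSeries.coeff (smul_add a f.toFormalSeries g.toFormalSeries))
  add_smul a b f := Alg.ext (congrArg FormalSeries.coeff (add_smul a b f.toFormalSeries))
  zero_smul f := Alg.ext (congrArg FormalSeries.coeff (zero_smul _ f.toFormalSeries))

instance : StarRing D.Alg where
  star_involutive f := ext_coeff fun n => by simp
  star_add f g := ext_coeff fun n => by simp
  star_mul f g := ext_coeff fun n => by
    simp only [coeff_star, coeff_mul, star_sum, D.hermitian]
    refine Finset.sum_congr rfl fun p _ => ?_
    rw [← Finset.Nat.sum_antidiagonal_swap]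
    rfl

end Alg

/-- The order of the ring `ℝ[[λ]]`, extended to `ℂ[[λ]]`: `0 ≤ a` means that `a` is real and is
zero or has a positive lowest-order coefficient. -/
def IsNonneg (a : ℂ⟦X⟧) : Prop :=
  (∀ n, (PowerSeries.coeff n a).im = 0) ∧
    (a = 0 ∨ ∃ r, (∀ j < r, PowerSeries.coeff j a = 0) ∧ 0 < (PowerSeries.coeff r a).re)

/-- Positive `ℂ[[λ]]`-linear functionals on the deformed algebra. -/
def IsPositiveFunctional (F : D.Alg →ₗ[ℂ⟦X⟧] ℂ⟦X⟧) : Prop :=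
  ∀ f : D.Alg, IsNonneg (F (star f * f))

/-- Positive elements of the deformed algebra: Hermitian elements on which all positive
functionals are nonnegative. -/
def IsPositive (a : D.Alg) : Prop :=
  star a = a ∧ ∀ F : D.Alg →ₗ[ℂ⟦X⟧] ℂ⟦X⟧, IsPositiveFunctional F → IsNonneg (F a)

/-- Algebra-valued, right linear Hermitian inner products on a right module `W[[λ]]` over the
deformed algebra. -/
structure IsHermitianInnerProduct {W : Type*} [AddCommGroup W] [Module ℂ W]
    [Module D.Algᵐᵒᵖ (FormalSeries W)]
    (h : FormalSeries W → FormalSeries W → D.Alg) : Prop where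
  add_right : ∀ s t u, h s (t + u) = h s t + h s u
  smul_right : ∀ (a : ℂ⟦X⟧) s t, h s (a • t) = a • h s t
  symm : ∀ s t, h s t = star (h t s)
  right_linear : ∀ s t (f : D.Alg), h s (MulOpposite.op f • t) = h s t * f
  positive : ∀ s, IsPositive (h s s)

end HermitianDeformation

/-! ## Smooth functions, restriction and star products -/

section Functions

instance : ContMDiffRing 𝓘(ℝ, ℂ) ∞ ℂ :=
  { instNormedSpaceLieAddGroup with
    contMDiff_mul := by
      rw [← modelWithCornersSelf_prod, chartedSpaceSelf_prod]
      exact contDiff_mul.contMDiff }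

variable (d : ℕ) (X : Type*) [TopologicalSpace X] [ChartedSpace (EuclideanSpace ℝ (Fin d)) X]

/-- The algebra `C^∞(X)` of smooth complex-valued functions. -/
abbrev CInf := C^∞⟮𝓡 d, X; 𝓘(ℝ, ℂ), ℂ⟯

variable {d X}

instance : Algebra ℂ (CInf d X) :=
  RingHom.toAlgebra
    { toFun := fun c => ⟨fun _ => c, contMDiff_const⟩
      map_one' := rfl
      map_mul' := fun _ _ => rfl
      map_zero' := rfl
      map_add' := fun _ _ => rfl }

@[simp] theorem CInf.smul_apply (c : ℂ) (f : CInf d X) (x : X) : (c • f) x = c * f x := rfl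

/-- The `*`-involution of `C^∞(X)` is complex conjugation. -/
instance : StarRing (CInf d X) where
  star f := ⟨fun x => star (f x), Complex.conjCLE.contDiff.contMDiff.comp f.contMDiff⟩
  star_involutive f := by ext x; exact star_star (f x)
  star_add f g := by ext x; exact star_add (f x) (g x)
  star_mul f g := by ext x; exact star_mul (f x) (g x)

@[simp] theorem CInf.star_apply (f : CInf d X) (x : X) : (star f) x = star (f x) := rfl

end Functions

variable {d : ℕ} {M : Type*} [TopologicalSpace M] [ChartedSpace (EuclideanSpace ℝ (Fin d)) M]

/-- Restriction of smooth functions from `M` to an open subset. -/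
def toOpen (U : Opens M) (f : CInf d M) : CInf d U :=
  ⟨fun x => f x, f.contMDiff.comp contMDiff_subtype_val⟩

/-- Restriction of smooth functions to a smaller open subset. -/
def restrict {U V : Opens M} (h : V ≤ U) (f : CInf d U) : CInf d V :=
  ⟨fun x => f (Set.inclusion h x), f.contMDiff.comp (contMDiff_inclusion h)⟩

/-- The partial derivative `∂_{I_1} ⋯ ∂_{I_m} f` at the point `x`, in the coordinates of the chart
at `p`. -/
def chartDeriv (p : M) {m : ℕ} (I : Fin m → Fin d) (f : CInf d M) (x : M) : ℂ :=
  iteratedFDeriv ℝ m (f ∘ (chartAt (EuclideanSpace ℝ (Fin d)) p).symm)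
    (chartAt (EuclideanSpace ℝ (Fin d)) p x) (fun a => EuclideanSpace.single (I a) 1)

/-- `B` is a bidifferential operator: locally
`B(f, g) = ∑_{|I|, |J| ≤ N} c^{IJ} (∂_I f) (∂_J g)` with smooth coefficients. -/
def IsBidifferential (B : CInf d M →ₗ[ℂ] CInf d M →ₗ[ℂ] CInf d M) : Prop :=
  ∀ p : M, ∃ W : Set M, IsOpen W ∧ p ∈ W ∧ W ⊆ (chartAt (EuclideanSpace ℝ (Fin d)) p).source ∧
    ∃ (N : ℕ) (c : ∀ m n : ℕ, (Fin m → Fin d) → (Fin n → Fin d) → M → ℂ),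
      (∀ m n I J, ContMDiffOn (𝓡 d) 𝓘(ℝ, ℂ) ∞ (c m n I J) W) ∧
      ∀ f g : CInf d M, ∀ x ∈ W, B f g x =
        ∑ m ∈ Finset.range (N + 1), ∑ n ∈ Finset.range (N + 1), ∑ I : Fin m → Fin d,
          ∑ J : Fin n → Fin d, c m n I J x * chartDeriv p I f x * chartDeriv p J g x

variable (d M) in
/-- A Poisson structure on `M`, as the complex bilinear extension to `C^∞(M)` of a (real)
Poisson bracket. -/
structure PoissonStructure where
  bracket : CInf d M →ₗ[ℂ] CInf d M →ₗ[ℂ] CInf d M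
  skew : ∀ f g, bracket f g = -bracket g f
  leibniz : ∀ f g h, bracket f (g * h) = bracket f g * h + g * bracket f h
  jacobi : ∀ f g h,
    bracket f (bracket g h) + bracket g (bracket h f) + bracket h (bracket f g) = 0
  real : ∀ f g, star (bracket f g) = bracket (star f) (star g)

/-- Hermitian star products on the Poisson manifold `(M, P)`. -/
structure StarProduct (P : PoissonStructure d M) extends HermitianDeformation (CInf d M) where
  bidifferential : ∀ r, IsBidifferential (C r)
  C_one : ∀ f g, C 1 f g - C 1 g f = Complex.I • P.bracket f g

theorem chartDeriv_congr (p : M) {m : ℕ} (I : Fin m → Fin d) {f g : CInf d M} {x : M}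
    (hx : x ∈ (chartAt (EuclideanSpace ℝ (Fin d)) p).source) (h : ⇑f =ᶠ[𝓝 x] g) :
    chartDeriv p I f x = chartDeriv p I g x := by
  unfold chartDeriv
  have h1 : (⇑f ∘ (chartAt (EuclideanSpace ℝ (Fin d)) p).symm) =ᶠ[𝓝
      (chartAt (EuclideanSpace ℝ (Fin d)) p x)]
      (⇑g ∘ (chartAt (EuclideanSpace ℝ (Fin d)) p).symm) := by
    have hc := (chartAt (EuclideanSpace ℝ (Fin d)) p).continuousAt_symm
      ((chartAt (EuclideanSpace ℝ (Fin d)) p).map_source hx)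
    rw [ContinuousAt, (chartAt (EuclideanSpace ℝ (Fin d)) p).left_inv hx] at hc
    exact hc.eventually h
  rw [(h1.iteratedFDeriv ℝ m).eq_of_nhds]

/-- Bidifferential operators are local. -/
theorem IsBidifferential.congr {B : CInf d M →ₗ[ℂ] CInf d M →ₗ[ℂ] CInf d M}
    (hB : IsBidifferential B) {f f' g g' : CInf d M} {x : M}
    (hf : ⇑f =ᶠ[𝓝 x] f') (hg : ⇑g =ᶠ[𝓝 x] g') : B f g x = B f' g' x := by
  obtain ⟨W, -, hx, hW, N, c, -, h⟩ := hB x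
  rw [h f g x hx, h f' g' x hx]
  refine Finset.sum_congr rfl fun m _ => Finset.sum_congr rfl fun n _ =>
    Finset.sum_congr rfl fun I _ => Finset.sum_congr rfl fun J _ => ?_
  rw [chartDeriv_congr x I (hW hx) hf, chartDeriv_congr x J (hW hx) hg]

section Restriction

theorem contMDiffAt_open_iff {U : Opens M} {G : M → ℂ} {x : U} :
    ContMDiffAt (𝓡 d) 𝓘(ℝ, ℂ) ∞ (fun y : U => G y) x ↔
      ContMDiffAt (𝓡 d) 𝓘(ℝ, ℂ) ∞ G (x : M) := contMDiffAt_subtype_iff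

variable [IsManifold (𝓡 d) ∞ M] [T2Space M]

/-- Near a given point of `U`, all smooth functions on `U` are restrictions of global ones, on a
neighbourhood that depends only on the point. -/
theorem exists_extension (U : Opens M) (x : U) :
    ∃ W : Set M, IsOpen W ∧ (x : M) ∈ W ∧ W ⊆ U ∧
      ∀ f : CInf d U, ∃ F : CInf d M, ∀ y (hy : y ∈ U), y ∈ W → F y = f ⟨y, hy⟩ := by
  classical
  obtain ⟨χ, -, hχ⟩ := (SmoothBumpFunction.nhds_basis_tsupport (I := 𝓡 d) (x : M)).mem_iff.1
    (U.isOpen.mem_nhds x.2)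
  obtain ⟨W, hW, hWo, hxW⟩ := eventually_nhds_iff.1 χ.eventuallyEq_one
  refine ⟨W ∩ U, hWo.inter U.isOpen, ⟨hxW, x.2⟩, Set.inter_subset_right, fun f => ?_⟩
  let G : M → ℂ := fun y => if hy : y ∈ U then f ⟨y, hy⟩ else 0
  have hG : ∀ y ∈ U, ContMDiffAt (𝓡 d) 𝓘(ℝ, ℂ) ∞ G y := by
    intro y hy
    have := contMDiffAt_open_iff (d := d) (U := U) (G := G) (x := ⟨y, hy⟩)
    refine this.1 ?_
    have h2 : (fun z : U => G z) = f := by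
      funext z; simp [G]
    rw [h2]
    exact f.contMDiff.contMDiffAt
  refine ⟨⟨fun y => χ y • G y, ?_⟩, ?_⟩
  · refine contMDiff_of_tsupport fun y hy => ?_
    have hyU : y ∈ U := hχ (tsupport_smul_subset_left _ _ hy)
    exact χ.contMDiffAt.smul (hG y hyU)
  · intro y hy hyW
    have h1 : χ y = 1 := hW y hyW.1
    simp [h1, G, hy]

/-- The neighbourhood of `exists_extension`. -/
def extNhd (d : ℕ) [ChartedSpace (EuclideanSpace ℝ (Fin d)) M] [IsManifold (𝓡 d) ∞ M]
    (U : Opens M) (x : U) : Set M := (exists_extension (d := d) U x).choose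

/-- A global smooth function that agrees with `f` near `x`. -/
def extend {U : Opens M} (x : U) (f : CInf d U) : CInf d M :=
  ((exists_extension (d := d) U x).choose_spec.2.2.2 f).choose

theorem extend_eq {U : Opens M} (x : U) (f : CInf d U) {y : U} (hy : (y : M) ∈ extNhd d U x) :
    extend x f (y : M) = f y :=
  ((exists_extension (d := d) U x).choose_spec.2.2.2 f).choose_spec y y.2 hy

theorem isOpen_extNhd (U : Opens M) (x : U) : IsOpen (extNhd d U x) :=
  (exists_extension (d := d) U x).choose_spec.1

theorem mem_extNhd (U : Opens M) (x : U) : (x : M) ∈ extNhd d U x :=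
  (exists_extension (d := d) U x).choose_spec.2.1

theorem extNhd_subset (U : Opens M) (x : U) : extNhd d U x ⊆ U :=
  (exists_extension (d := d) U x).choose_spec.2.2.1

theorem extend_eventuallyEq {U : Opens M} (x : U) (f : CInf d U) {F : CInf d M} {y : U}
    {W : Set M} (hW : IsOpen W) (hyW : (y : M) ∈ W) (hWF : ∀ z : U, (z : M) ∈ W → F z = f z)
    (hy : (y : M) ∈ extNhd d U x) :
    ⇑(extend x f) =ᶠ[𝓝 (y : M)] F := by
  filter_upwards [hW.mem_nhds hyW, (isOpen_extNhd U x).mem_nhds hy] with z hz hz'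
  rw [hWF ⟨z, extNhd_subset U x hz'⟩ hz]
  exact extend_eq (y := ⟨z, extNhd_subset U x hz'⟩) x f hz'

/-- If `F`, `G` are global functions that agree with `f`, `g` on the open set `W`, then
`B(F, G)` computes the restriction of the bidifferential operator at the points of `W`. -/
theorem IsBidifferential.extend_congr {B : CInf d M →ₗ[ℂ] CInf d M →ₗ[ℂ] CInf d M}
    (hB : IsBidifferential B) {U : Opens M} {f g : CInf d U} {F G : CInf d M} {W : Set M}
    (hW : IsOpen W) (hF : ∀ z : U, (z : M) ∈ W → F z = f z)
    (hG : ∀ z : U, (z : M) ∈ W → G z = g z) {y : U} (hy : (y : M) ∈ W) :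
    B (extend y f) (extend y g) (y : M) = B F G (y : M) :=
  hB.congr (extend_eventuallyEq y f hW hy hF (mem_extNhd U y))
    (extend_eventuallyEq y g hW hy hG (mem_extNhd U y))

/-- The restriction of a bidifferential operator to an open subset `U`: its value at `x` on
`f, g ∈ C^∞(U)` is the value at `x` of the given operator on any two global smooth functions that
agree with `f` and `g` near `x`. -/
def IsBidifferential.restrict {B : CInf d M →ₗ[ℂ] CInf d M →ₗ[ℂ] CInf d M}
    (hB : IsBidifferential B) (U : Opens M) (f g : CInf d U) : CInf d U :=
  ⟨fun x => B (extend x f) (extend x g) (x : M), fun x => by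
    have h : ContMDiffAt (𝓡 d) 𝓘(ℝ, ℂ) ∞ (fun y : U => B (extend x f) (extend x g) (y : M)) x :=
      (toOpen U (B (extend x f) (extend x g))).contMDiff.contMDiffAt
    refine h.congr_of_eventuallyEq ?_
    have h2 : (Subtype.val ⁻¹' (extNhd d U x) : Set U) ∈ 𝓝 x :=
      ((isOpen_extNhd U x).preimage continuous_subtype_val).mem_nhds (mem_extNhd U x)
    filter_upwards [h2] with y hy
    exact hB.extend_congr (isOpen_extNhd U x) (fun z hz => extend_eq x f hz)
      (fun z hz => extend_eq x g hz) hy⟩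

theorem IsBidifferential.restrict_apply {B : CInf d M →ₗ[ℂ] CInf d M →ₗ[ℂ] CInf d M}
    (hB : IsBidifferential B) {U : Opens M} {f g : CInf d U} {F G : CInf d M} {W : Set M}
    (hW : IsOpen W) (hF : ∀ z : U, (z : M) ∈ W → F z = f z)
    (hG : ∀ z : U, (z : M) ∈ W → G z = g z) {y : U} (hy : (y : M) ∈ W) :
    hB.restrict U f g y = B F G (y : M) :=
  hB.extend_congr hW hF hG hy

end Restriction

open Classical in
/-- Extension by zero of a smooth function from `V` to the larger open set `U`. (Its value is junk
when the extension by zero is not smooth.) -/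
def zeroExtend {V : Opens M} (U : Opens M) (f : CInf d V) : CInf d U :=
  if h : ContMDiff (𝓡 d) 𝓘(ℝ, ℂ) ∞ (fun x : U => if hx : (x : M) ∈ V then f ⟨x, hx⟩ else 0) then
    ⟨_, h⟩ else 0

open Classical in
/-- The extension by zero is smooth, hence given by the expected formula, when `f` vanishes outside
of a closed set `K` with `K ∩ U ⊆ V`. -/
theorem zeroExtend_apply {U V : Opens M} (f : CInf d V) {K : Set M}
    (hK : IsClosed K) (hKV : K ∩ U ⊆ V) (hf : ∀ x : V, (x : M) ∉ K → f x = 0) (x : U) :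
    zeroExtend U f x = if hx : (x : M) ∈ V then f ⟨x, hx⟩ else 0 := by
  have h : ContMDiff (𝓡 d) 𝓘(ℝ, ℂ) ∞
      (fun x : U => if hx : (x : M) ∈ V then f ⟨x, hx⟩ else 0) := by
    let G : M → ℂ := fun y => if hy : y ∈ V then f ⟨y, hy⟩ else 0
    intro y
    refine (contMDiffAt_open_iff (G := G)).2 ?_
    by_cases hy : (y : M) ∈ V
    · refine (contMDiffAt_open_iff (d := d) (U := V) (G := G) (x := ⟨y, hy⟩)).1 ?_
      have h2 : (fun z : V => G z) = f := by funext z; simp [G]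
      rw [h2]
      exact f.contMDiff.contMDiffAt
    · have hyK : (y : M) ∉ K := fun h' => hy (hKV ⟨h', y.2⟩)
      refine (contMDiffAt_const (c := (0 : ℂ))).congr_of_eventuallyEq ?_
      filter_upwards [hK.isOpen_compl.mem_nhds hyK] with z hz
      by_cases hz' : z ∈ V
      · simpa [G, hz'] using hf ⟨z, hz'⟩ hz
      · simp [G, hz']
  have h' : zeroExtend U f = (⟨_, h⟩ : CInf d U) := dif_pos h
  rw [h']
  rfl

namespace StarProduct

variable [IsManifold (𝓡 d) ∞ M] [T2Space M] {P : PoissonStructure d M} (S : StarProduct P)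

/-- The cochains `C_r`, restricted to an open subset. -/
def restrictC (U : Opens M) (r : ℕ) : CInf d U →ₗ[ℂ] CInf d U →ₗ[ℂ] CInf d U :=
  LinearMap.mk₂ ℂ (fun f g => (S.bidifferential r).restrict U f g)
    (fun f f' g => by
      ext y
      have h := (S.bidifferential r).restrict_apply (isOpen_extNhd U y)
        (f := f + f') (F := extend y f + extend y f') (G := extend y g)
        (fun z hz => by simp [extend_eq y _ hz]) (fun z hz => extend_eq y g hz) (mem_extNhd U y)
      exact h.trans (by simp only [map_add, LinearMap.add_apply]; rfl))
    (fun c f g => by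
      ext y
      have h := (S.bidifferential r).restrict_apply (isOpen_extNhd U y)
        (f := c • f) (F := c • extend y f) (G := extend y g)
        (fun z hz => by simp [extend_eq y _ hz]) (fun z hz => extend_eq y g hz) (mem_extNhd U y)
      exact h.trans (by simp only [map_smul, LinearMap.smul_apply]; rfl))
    (fun f g g' => by
      ext y
      have h := (S.bidifferential r).restrict_apply (isOpen_extNhd U y)
        (f := f) (g := g + g') (F := extend y f) (G := extend y g + extend y g')
        (fun z hz => extend_eq y f hz) (fun z hz => by simp [extend_eq y _ hz]) (mem_extNhd U y)
      exact h.trans (by simp only [map_add]; rfl))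
    (fun c f g => by
      ext y
      have h := (S.bidifferential r).restrict_apply (isOpen_extNhd U y)
        (f := f) (g := c • g) (F := extend y f) (G := c • extend y g)
        (fun z hz => extend_eq y f hz) (fun z hz => by simp [extend_eq y _ hz]) (mem_extNhd U y)
      exact h.trans (by simp only [map_smul]; rfl))

theorem restrictC_apply {U : Opens M} (r : ℕ) {f g : CInf d U} {F G : CInf d M} {W : Set M}
    (hW : IsOpen W) (hF : ∀ z : U, (z : M) ∈ W → F z = f z)
    (hG : ∀ z : U, (z : M) ∈ W → G z = g z) {y : U} (hy : (y : M) ∈ W) :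
    S.restrictC U r f g y = S.C r F G (y : M) :=
  (S.bidifferential r).restrict_apply hW hF hG hy

theorem sum_apply {X ι : Type*} [TopologicalSpace X] [ChartedSpace (EuclideanSpace ℝ (Fin d)) X]
    (s : Finset ι) (f : ι → CInf d X) (x : X) : (∑ i ∈ s, f i) x = ∑ i ∈ s, f i x :=
  map_sum (ContMDiffMap.evalRingHom x : CInf d X →+* ℂ) f s

theorem cochainProd_apply {U : Opens M} {f g : FormalSeries (CInf d U)}
    {F G : FormalSeries (CInf d M)} {W : Set M} (hW : IsOpen W)
    (hF : ∀ n, ∀ z : U, (z : M) ∈ W → F.coeff n z = f.coeff n z)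
    (hG : ∀ n, ∀ z : U, (z : M) ∈ W → G.coeff n z = g.coeff n z) (n : ℕ) (y : U)
    (hy : (y : M) ∈ W) :
    (FormalSeries.cochainProd (fun r a b => S.C r a b) F G).coeff n y =
      (FormalSeries.cochainProd (fun r a b => S.restrictC U r a b) f g).coeff n y := by
  simp only [FormalSeries.cochainProd, sum_apply]
  refine Finset.sum_congr rfl fun p _ => Finset.sum_congr rfl fun q _ => ?_
  exact (S.restrictC_apply p.1 hW (hF q.1) (hG q.2) hy).symm

/-- The restriction of a star product to an open subset. -/
def restrict (U : Opens M) : HermitianDeformation (CInf d U) where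
  C := S.restrictC U
  C_zero f g := by
    ext y
    rw [S.restrictC_apply 0 (isOpen_extNhd U y) (fun z hz => extend_eq y f hz)
      (fun z hz => extend_eq y g hz) (mem_extNhd U y), S.C_zero]
    simp [extend_eq y _ (mem_extNhd U y)]
  assoc f g h := by
    ext n y
    let F : FormalSeries (CInf d M) := f.map (extend y)
    let G : FormalSeries (CInf d M) := g.map (extend y)
    let H : FormalSeries (CInf d M) := h.map (extend y)
    have hF : ∀ n, ∀ z : U, (z : M) ∈ extNhd d U y → F.coeff n z = f.coeff n z :=
      fun n z hz => extend_eq y _ hz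
    have hG : ∀ n, ∀ z : U, (z : M) ∈ extNhd d U y → G.coeff n z = g.coeff n z :=
      fun n z hz => extend_eq y _ hz
    have hH : ∀ n, ∀ z : U, (z : M) ∈ extNhd d U y → H.coeff n z = h.coeff n z :=
      fun n z hz => extend_eq y _ hz
    have hW := isOpen_extNhd (d := d) U y
    rw [← S.cochainProd_apply hW (S.cochainProd_apply hW hF hG) hH n y (mem_extNhd U y),
      ← S.cochainProd_apply hW hF (S.cochainProd_apply hW hG hH) n y (mem_extNhd U y), S.assoc]
  one_left r f hr := by
    ext y
    rw [S.restrictC_apply r (F := 1) (isOpen_extNhd U y) (fun z hz => rfl)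
      (fun z hz => extend_eq y f hz) (mem_extNhd U y), S.one_left r _ hr]
    rfl
  one_right r f hr := by
    ext y
    rw [S.restrictC_apply r (G := 1) (isOpen_extNhd U y) (fun z hz => extend_eq y f hz)
      (fun z hz => rfl) (mem_extNhd U y), S.one_right r _ hr]
    rfl
  hermitian r f g := by
    ext y
    rw [CInf.star_apply, S.restrictC_apply r (isOpen_extNhd U y) (fun z hz => extend_eq y f hz)
      (fun z hz => extend_eq y g hz) (mem_extNhd U y), ← CInf.star_apply, S.hermitian,
      S.restrictC_apply r (F := star (extend y g)) (G := star (extend y f))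
        (isOpen_extNhd (d := d) U y)
      (fun z hz => by simp [extend_eq (d := d) y _ hz])
      (fun z hz => by simp [extend_eq (d := d) y _ hz]) (mem_extNhd (d := d) U y)]

/-- The deformed algebra `(C^∞(U)[[λ]], ⋆)` of an open subset. -/
abbrev Loc (U : Opens M) := (S.restrict U).Alg

variable {S}

/-- Restriction `(C^∞(M)[[λ]], ⋆) → (C^∞(U)[[λ]], ⋆)`. -/
def toLoc (U : Opens M) (f : S.Alg) : S.Loc U := ⟨f.toFormalSeries.map (toOpen U)⟩

/-- Restriction `(C^∞(U)[[λ]], ⋆) → (C^∞(V)[[λ]], ⋆)` for `V ⊆ U`. -/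
def res {U V : Opens M} (h : V ≤ U) (f : S.Loc U) : S.Loc V :=
  ⟨f.toFormalSeries.map (QuantumSerreSwan.restrict h)⟩

/-- Extension by zero of formal series of smooth functions. -/
def extZero {V : Opens M} (U : Opens M) (f : S.Loc V) : S.Loc U :=
  ⟨f.toFormalSeries.map (zeroExtend U)⟩

end StarProduct

/-! ## Vector bundles, frames and sections -/

section Bundles

variable {k : ℕ} (E : M → Type*) [∀ x, AddCommGroup (E x)] [∀ x, Module ℂ (E x)]
  [∀ x, TopologicalSpace (E x)] [TopologicalSpace (TotalSpace (Fin k → ℂ) E)]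
  [FiberBundle (Fin k → ℂ) E]

variable (d k) in
/-- The smooth sections `Γ^∞(E)`. -/
abbrev Sec := Cₛ^∞⟮𝓡 d; Fin k → ℂ, E⟯

variable {E}

variable (d k) in
/-- Smoothness of a section of `E` on a subset. -/
def SmoothOn (s : ∀ x, E x) (U : Set M) : Prop :=
  ContMDiffOn (𝓡 d) ((𝓡 d).prod 𝓘(ℝ, Fin k → ℂ)) ∞ (fun x => TotalSpace.mk' (Fin k → ℂ) x (s x)) U

theorem SmoothOn.smul [VectorBundle ℂ (Fin k → ℂ) E] {f : M → ℂ} {s : ∀ x, E x} {U : Set M}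
    (hf : ContMDiffOn (𝓡 d) 𝓘(ℝ, ℂ) ∞ f U) (hs : SmoothOn d k s U) :
    SmoothOn d k (fun x => f x • s x) U := by
  intro x hx
  have h := hs x hx
  rw [contMDiffWithinAt_section] at h ⊢
  have hsm : ContMDiffWithinAt (𝓡 d) 𝓘(ℝ, Fin k → ℂ) ∞
      (fun y => f y • (trivializationAt (Fin k → ℂ) E x ⟨y, s y⟩).2) U x := by
    have h1 : ContMDiff (𝓘(ℝ, ℂ).prod 𝓘(ℝ, Fin k → ℂ)) 𝓘(ℝ, Fin k → ℂ) ∞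
        (fun p : ℂ × (Fin k → ℂ) => p.1 • p.2) := by
      rw [← modelWithCornersSelf_prod, chartedSpaceSelf_prod]
      exact contDiff_smul.contMDiff
    exact h1.contMDiffAt.comp_contMDiffWithinAt x ((hf x hx).prodMk h)
  refine hsm.congr_of_eventuallyEq ?_ ?_
  · filter_upwards [mem_nhdsWithin_of_mem_nhds
      ((trivializationAt (Fin k → ℂ) E x).open_baseSet.mem_nhds
        (mem_baseSet_trivializationAt (Fin k → ℂ) E x))] with y hy
    exact ((trivializationAt (Fin k → ℂ) E x).linear ℂ hy).2 _ _
  · exact ((trivializationAt (Fin k → ℂ) E x).linear ℂ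
      (mem_baseSet_trivializationAt (Fin k → ℂ) E x)).2 _ _

section

variable [VectorBundle ℂ (Fin k → ℂ) E] [VectorBundle ℝ (Fin k → ℂ) E]

instance : Module ℂ (Sec d k E) where
  smul c s := ⟨fun x => c • s x,
    fun x => (SmoothOn.smul (contMDiffOn_const (c := c)) s.contMDiff.contMDiffOn).contMDiffAt
      Filter.univ_mem⟩
  one_smul s := by ext x; exact one_smul _ _
  mul_smul a b s := by ext x; exact mul_smul _ _ _
  smul_zero a := by ext x; exact smul_zero _
  smul_add a s t := by ext x; exact smul_add _ _ _
  add_smul a b s := by ext x; exact add_smul _ _ _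
  zero_smul s := by ext x; exact zero_smul _ _

@[simp] theorem Sec.smul_apply (c : ℂ) (s : Sec d k E) (x : M) : (c • s) x = c • s x := rfl

variable (d k E) in
/-- A smooth local frame of `E` over the open set `U`. (The values outside `U` are irrelevant.) -/
structure LocalFrame (U : Opens M) where
  vec : Fin k → ∀ x, E x
  smooth : ∀ i, SmoothOn d k (vec i) U
  linearIndependent : ∀ x ∈ U, LinearIndependent ℂ fun i => vec i x
  span : ∀ x ∈ U, Submodule.span ℂ (Set.range fun i => vec i x) = ⊤

namespace LocalFrame

variable {U : Opens M} (e : LocalFrame d k E U)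

/-- The basis of the fiber at `x` given by a frame. -/
def basis (x : U) : Module.Basis (Fin k) ℂ (E x) :=
  Module.Basis.mk (e.linearIndependent x x.2) (e.span x x.2).ge

set_option linter.unusedSectionVars false in
theorem sum_repr (s : ∀ x, E x) (x : U) :
    ∑ j, (e.basis x).repr (s x) j • e.vec j x = s x := by
  simpa [basis] using (e.basis x).sum_repr (s x)

/-- The coefficients of a smooth section in a smooth frame are smooth. -/
theorem contMDiff_repr [IsManifold (𝓡 d) ∞ M] {s : ∀ x, E x} (hs : SmoothOn d k s U) (i : Fin k) :
    ContMDiff (𝓡 d) 𝓘(ℝ, ℂ) ∞ (fun x : U => (e.basis x).repr (s x) i) := by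
  intro x₀
  let t := trivializationAt (Fin k → ℂ) E (x₀ : M)
  have ht : (x₀ : M) ∈ t.baseSet := mem_baseSet_trivializationAt (Fin k → ℂ) E (x₀ : M)
  -- the components of the sections in a trivialization, as functions on `U`
  have comp : ∀ v : (∀ x, E x), SmoothOn d k v U → ∀ a : Fin k,
      ContMDiffAt (𝓡 d) 𝓘(ℝ, ℂ) ∞ (fun x : U => (t ⟨x, v x⟩).2 a) x₀ := by
    intro v hv a
    have h := (hv x₀ x₀.2).contMDiffAt (U.isOpen.mem_nhds x₀.2)
    rw [contMDiffAt_section] at h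
    refine (contMDiffAt_open_iff (G := fun x : M => (t ⟨x, v x⟩).2 a)).2 ?_
    exact (contMDiffAt_pi_space.1 h a)
  let G : U → Matrix (Fin k) (Fin k) ℂ := fun x => Matrix.of fun a j => (t ⟨x, e.vec j x⟩).2 a
  let r : U → Fin k → ℂ := fun x => (t ⟨x, s x⟩).2
  have hdet : ∀ H : U → Matrix (Fin k) (Fin k) ℂ,
      (∀ a j, ContMDiffAt (𝓡 d) 𝓘(ℝ, ℂ) ∞ (fun x => H x a j) x₀) →
      ContMDiffAt (𝓡 d) 𝓘(ℝ, ℂ) ∞ (fun x => (H x).det) x₀ := by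
    intro H hH
    simp only [Matrix.det_apply']
    refine ContMDiffAt.sum fun σ _ => contMDiffAt_const.mul ?_
    exact ContMDiffAt.prod fun a _ => hH _ _
  have hG : ContMDiffAt (𝓡 d) 𝓘(ℝ, ℂ) ∞ (fun x => (G x).det) x₀ :=
    hdet G fun a j => comp _ (e.smooth j) a
  have hN : ContMDiffAt (𝓡 d) 𝓘(ℝ, ℂ) ∞ (fun x => ((G x).updateCol i (r x)).det) x₀ := by
    refine hdet _ fun a j => ?_
    by_cases hj : j = i
    · subst hj
      simpa using comp s hs a
    · simp only [Matrix.updateCol_ne hj]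
      exact comp _ (e.smooth j) a
  have key : ∀ x : U, (x : M) ∈ t.baseSet →
      G x *ᵥ (fun j => (e.basis x).repr (s x) j) = r x ∧ (G x).det ≠ 0 := by
    intro x hx
    let L : E (x : M) ≃ₗ[ℂ] (Fin k → ℂ) := t.linearEquivAt ℂ x hx
    have hL : ∀ v : E (x : M), L v = (t ⟨x, v⟩).2 := fun v => rfl
    constructor
    · have h1 := congrArg L (e.sum_repr s x)
      simp only [map_sum, map_smul] at h1
      funext a
      have h2 := congrFun h1 a
      simp only [hL, Finset.sum_apply, Pi.smul_apply, smul_eq_mul] at h2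
      refine Eq.trans ?_ h2
      simp only [Matrix.mulVec, dotProduct, G, Matrix.of_apply]
      exact Finset.sum_congr rfl fun j _ => mul_comm _ _
    · have h3 : LinearIndependent ℂ fun j => L (e.vec j x) :=
        (e.linearIndependent x x.2).map' L.toLinearMap L.ker
      have h4 : (G x).col = fun j => L (e.vec j x) := rfl
      rw [← h4, Matrix.linearIndependent_cols_iff_isUnit, Matrix.isUnit_iff_isUnit_det] at h3
      exact h3.ne_zero
  have hinv : ContMDiffAt (𝓡 d) 𝓘(ℝ, ℂ) ∞ (fun x => ((G x).det)⁻¹) x₀ := by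
    have h5 : ContDiffAt ℝ ∞ (fun z : ℂ => z⁻¹) (G x₀).det := contDiffAt_inv ℝ (key x₀ ht).2
    exact ContMDiffAt.comp x₀ h5.contMDiffAt hG
  refine (hinv.mul hN).congr_of_eventuallyEq ?_
  have hmem : (Subtype.val ⁻¹' t.baseSet : Set U) ∈ 𝓝 x₀ :=
    (t.open_baseSet.preimage continuous_subtype_val).mem_nhds ht
  filter_upwards [hmem] with x hx
  obtain ⟨h6, h7⟩ := key x hx
  have h8 : (G x).det • (fun j => (e.basis x).repr (s x) j) = (G x).cramer (r x) := by
    rw [← h6, Matrix.cramer_eq_adjugate_mulVec, Matrix.mulVec_mulVec, Matrix.adjugate_mul,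
      Matrix.smul_mulVec, Matrix.one_mulVec]
  have h9 := congrFun h8 i
  rw [Matrix.cramer_apply, Pi.smul_apply, smul_eq_mul] at h9
  change _ = ((G x).det)⁻¹ * ((G x).updateCol i (r x)).det
  rw [← h9]
  field_simp

/-- The coefficient functions `s ↦ (s^1, …, s^k)` of smooth sections, with `s = ∑ e_i s^i`. -/
def coeff [IsManifold (𝓡 d) ∞ M] (s : ∀ x, E x) (hs : SmoothOn d k s U) (i : Fin k) : CInf d U :=
  ⟨fun x => (e.basis x).repr (s x) i, e.contMDiff_repr hs i⟩

end LocalFrame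

variable (d k E) in
/-- The algebra `Γ^∞(End(E))` of smooth fields of endomorphisms of the fibers of `E`: those that
map smooth local sections to smooth local sections. -/
def EndSec : Subalgebra ℂ (∀ x, Module.End ℂ (E x)) where
  carrier := {A | ∀ (U : Opens M) (s : ∀ x, E x), SmoothOn d k s U →
    SmoothOn d k (fun x => A x (s x)) U}
  mul_mem' hA hB := fun U s hs => hA U _ (hB U s hs)
  add_mem' hA hB := fun U s hs => ContMDiffOn.add_section (hA U s hs) (hB U s hs)
  algebraMap_mem' c := fun _ _ hs => SmoothOn.smul (contMDiffOn_const (c := c)) hs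

/-- A smooth function, viewed as a field of endomorphisms. -/
def EndSec.scalar (f : CInf d M) : EndSec d k E :=
  ⟨fun x => f x • (1 : Module.End ℂ (E x)), fun _ _ hs => SmoothOn.smul f.contMDiff.contMDiffOn hs⟩

/-- Finite quadratic partitions of unity `∑ χ̄_α χ_α = 1` subordinate to the cover `U`. -/
structure QuadraticPartition (d : ℕ) [ChartedSpace (EuclideanSpace ℝ (Fin d)) M] {m : ℕ}
    (U : Fin m → Opens M) where
  toFun : Fin m → CInf d M
  subordinate : ∀ α, tsupport (toFun α) ⊆ U α
  sum_eq_one : ∑ α, star (toFun α) * toFun α = 1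

/-- A real-valued smooth function, viewed as a complex-valued one. -/
def complexify (f : C^∞⟮𝓡 d, M; 𝓘(ℝ), ℝ⟯) : CInf d M :=
  ⟨fun x => (f x : ℂ), Complex.ofRealCLM.contDiff.contMDiff.comp f.contMDiff⟩

variable (d k E) in
/-- Hermitian fiber metrics on `E`. -/
structure HermitianMetric where
  inner : ∀ x, E x →ₗ⋆[ℂ] E x →ₗ[ℂ] ℂ
  symm : ∀ x v w, inner x v w = star (inner x w v)
  pos : ∀ x v, v ≠ 0 → 0 < (inner x v v).re
  smooth : ∀ (U : Opens M) (s t : ∀ x, E x), SmoothOn d k s U → SmoothOn d k t U →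
    ContMDiffOn (𝓡 d) 𝓘(ℝ, ℂ) ∞ (fun x => inner x (s x) (t x)) U

/-! ## Deformed transition matrices and the quantum module -/

variable [IsManifold (𝓡 d) ∞ M] [T2Space M] {P : PoissonStructure d M} {S : StarProduct P}
  {m : ℕ} {U : Fin m → Opens M}

open StarProduct

/-- The coefficients `s_α` of a formal series of sections in the frame `e_α`. -/
def LocalFrame.coeffs {V : Opens M} (e : LocalFrame d k E V) (s : FormalSeries (Sec d k E))
    (i : Fin k) : S.Loc V :=
  ⟨s.map fun s : Sec d k E => e.coeff s s.contMDiff.contMDiffOn i⟩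

/-- The matrix `A_α` of a formal series of endomorphism fields in the frame `e_α`, that is,
`A e_j = ∑ e_i A_{ij}`. -/
def LocalFrame.matrix {V : Opens M} (e : LocalFrame d k E V) (A : FormalSeries (EndSec d k E)) :
    Matrix (Fin k) (Fin k) (S.Loc V) :=
  Matrix.of fun i j => ⟨A.map fun A =>
    e.coeff (fun x => A.1 x (e.vec j x)) (A.2 V (e.vec j) (e.smooth j)) i⟩

variable (S) in
/-- Deformations `Φ_{αβ} = φ_{αβ} + O(λ)` of the classical transition matrices of the local frames
`e_α` (given by `e_β = e_α φ_{αβ}`), which satisfy the deformed cocycle condition and are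
unitary. -/
structure DeformedTransition (e : ∀ α, LocalFrame d k E (U α)) where
  Φ : ∀ α β, Matrix (Fin k) (Fin k) (S.Loc (U α ⊓ U β))
  classical_limit : ∀ α β (x : M) (hx : x ∈ U α ⊓ U β) (j : Fin k),
    (e β).vec j x = ∑ i, ((Φ α β i j).coeff 0) ⟨x, hx⟩ • (e α).vec i x
  cocycle_two : ∀ α β, Φ α β * (Φ β α).map (res (le_inf inf_le_right inf_le_left)) = 1
  cocycle_three : ∀ α β γ,
    (Φ α β).map (res (V := U α ⊓ U β ⊓ U γ) inf_le_left) *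
      (Φ β γ).map (res (le_inf (inf_le_left.trans inf_le_right) inf_le_right)) *
      (Φ γ α).map (res (le_inf inf_le_right (inf_le_left.trans inf_le_left))) = 1
  unitary : ∀ α β, (Φ α β)ᴴ = (Φ β α).map (res (le_inf inf_le_right inf_le_left))

namespace DeformedTransition

variable {e : ∀ α, LocalFrame d k E (U α)} (Φ : DeformedTransition S e)

/-- The collection of local sections `v_α` satisfies `Φ_{αβ} ⋆ v_β = v_α`. -/
def IsCompatible (v : ∀ α, Fin k → S.Loc (U α)) : Prop :=
  ∀ α β, (Φ.Φ α β).mulVec (fun j => res inf_le_right (v β j)) = fun i => res inf_le_left (v α i)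

/-- The collection of local matrices `B_α` satisfies `Φ_{αβ} ⋆ B_β ⋆ Φ_{βα} = B_α`. -/
def IsCompatibleMatrix (B : ∀ α, Matrix (Fin k) (Fin k) (S.Loc (U α))) : Prop :=
  ∀ α β, Φ.Φ α β * (B β).map (res inf_le_right) *
    (Φ.Φ β α).map (res (le_inf inf_le_right inf_le_left)) = (B α).map (res inf_le_left)

/-- The local sections `𝐬_α = ∑_β Φ_{αβ} ⋆ χ_β ⋆ s_β` (each summand being extended by zero
from `U_α ∩ U_β` to `U_α`). -/
def lift (χ : SmoothPartitionOfUnity (Fin m) (𝓡 d) M) (s : FormalSeries (Sec d k E)) (α : Fin m) (i : Fin k) :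
    S.Loc (U α) :=
  ∑ β, extZero (U α) ((Φ.Φ α β).mulVec
    (fun j => toLoc (U α ⊓ U β) (HermitianDeformation.Alg.const (complexify (χ β))) *
      res inf_le_right ((e β).coeffs s j)) i)

/-- The matrices
`T̃_α(A) = ∑_γ Φ_{αγ} ⋆ χ̄_γ ⋆ A_γ ⋆ χ_γ ⋆ Φ_{γα}` (each summand being extended by zero
from `U_α ∩ U_γ` to `U_α`). -/
def Ttilde (χ : Fin m → CInf d M) (A : FormalSeries (EndSec d k E)) (α : Fin m) :
    Matrix (Fin k) (Fin k) (S.Loc (U α)) :=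
  ∑ γ, (Φ.Φ α γ * Matrix.scalar (Fin k) (toLoc (U α ⊓ U γ) (HermitianDeformation.Alg.const (star (χ γ)))) *
    ((e γ).matrix A).map (res inf_le_right) *
    Matrix.scalar (Fin k) (toLoc (U α ⊓ U γ) (HermitianDeformation.Alg.const (χ γ))) *
    (Φ.Φ γ α).map (res (le_inf inf_le_right inf_le_left))).map (extZero (U α))

/-- The choices made in the construction of a unital deformation `⋆'` of `Γ^∞(End(E))`, and of
deformed cut-off functions, from the quadratic partition of unity `χ`. The series with coefficients
in `Γ^∞(End(E))` are multiplied by `tilde` (`⋆̃`) and `prime` (`⋆'`). -/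
structure EndDeformation (h₀ : HermitianMetric d k E) (χ : Fin m → CInf d M) where
  /-- The adjoint with respect to `h₀`. -/
  adjoint : EndSec d k E → EndSec d k E
  adjoint_spec : ∀ A x v w, h₀.inner x (A.1 x v) w = h₀.inner x v ((adjoint A).1 x w)
  /-- The product `⋆̃`, for which `T̃` is multiplicative. -/
  tilde : FormalSeries (EndSec d k E) → FormalSeries (EndSec d k E) → FormalSeries (EndSec d k E)
  tilde_spec : ∀ A B α, Φ.Ttilde χ (tilde A B) α = Φ.Ttilde χ A α * Φ.Ttilde χ B α
  /-- The unit of `⋆̃`. -/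
  unit : FormalSeries (EndSec d k E)
  unit_spec : ∀ α, Φ.Ttilde χ unit α = 1
  /-- The element `U`, with `⋆̃`-inverse `Uinv`, such that `(U⁻¹)^* ⋆̃ U⁻¹ = 1`. -/
  U : FormalSeries (EndSec d k E)
  Uinv : FormalSeries (EndSec d k E)
  U_Uinv : tilde U Uinv = unit
  Uinv_U : tilde Uinv U = unit
  U_spec : tilde (Uinv.map adjoint) Uinv = FormalSeries.const 1
  /-- The product `⋆'` with `S(A ⋆̃ B) = S(A) ⋆' S(B)`, where
  `S(A) = (U⁻¹)^* ⋆̃ A ⋆̃ U⁻¹`. -/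
  prime : FormalSeries (EndSec d k E) → FormalSeries (EndSec d k E) → FormalSeries (EndSec d k E)
  prime_spec : ∀ A B, tilde (tilde (Uinv.map adjoint) (tilde A B)) Uinv =
    prime (tilde (tilde (Uinv.map adjoint) A) Uinv) (tilde (tilde (Uinv.map adjoint) B) Uinv)
  /-- The element `V`, with `⋆'`-inverse `Vinv`, such that `∑ χ̄_α ⋆' χ_α = V^* ⋆' V`. -/
  V : FormalSeries (EndSec d k E)
  Vinv : FormalSeries (EndSec d k E)
  V_Vinv : prime V Vinv = FormalSeries.const 1
  Vinv_V : prime Vinv V = FormalSeries.const 1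
  V_spec : ∑ α, prime (FormalSeries.const (EndSec.scalar (star (χ α))))
    (FormalSeries.const (EndSec.scalar (χ α))) = prime (V.map adjoint) V

namespace EndDeformation

variable {Φ} {h₀ : HermitianMetric d k E} {χ : Fin m → CInf d M} (D : Φ.EndDeformation h₀ χ)

/-- `T_α(A) = T̃_α(U^*) ⋆ T̃_α(A) ⋆ T̃_α(U)`. -/
def T (A : FormalSeries (EndSec d k E)) (α : Fin m) : Matrix (Fin k) (Fin k) (S.Loc (U α)) :=
  Φ.Ttilde χ (D.U.map D.adjoint) α * Φ.Ttilde χ A α * Φ.Ttilde χ D.U α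

/-- The deformed cut-off functions `𝛘_α = χ_α ⋆' V⁻¹`. -/
def chi (α : Fin m) : FormalSeries (EndSec d k E) :=
  D.prime (FormalSeries.const (EndSec.scalar (χ α))) D.Vinv

end EndDeformation

end DeformedTransition

end

end Bundles

end QuantumSerreSwan

end

open QuantumSerreSwan QuantumSerreSwan.StarProduct

set_option linter.unusedSectionVars false
set_option linter.unusedVariables false

noncomputable section

namespace QuantumSerreSwan

namespace FormalSeries

variable {V : Type*} [AddCommGroup V]

/-- The series `v₁ + λ v₂ + ⋯` obtained from `v₀ + λ v₁ + ⋯`. -/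
def shift (v : FormalSeries V) : FormalSeries V := ⟨fun n => v.coeff (n + 1)⟩

/-- A `λ`-adic contraction of `V[[λ]]` has a unique fixed point. -/
theorem existsUnique_fixedPoint (G : FormalSeries V → FormalSeries V)
    (hG : ∀ (n : ℕ) (u v : FormalSeries V), (∀ j < n, u.coeff j = v.coeff j) →
      ∀ j < n + 1, (G u).coeff j = (G v).coeff j) :
    ∃! w, G w = w := by
  have hst : ∀ n j, j < n → (G^[n] 0).coeff j = (G^[j + 1] 0).coeff j := by
    have h1 : ∀ n, ∀ j < n, (G^[n + 1] 0).coeff j = (G^[n] 0).coeff j := by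
      intro n
      induction n with
      | zero => simp
      | succ n ih =>
        simp only [Function.iterate_succ_apply'] at ih ⊢
        exact hG n _ _ ih
    intro n j hj
    induction n, hj using Nat.le_induction with
    | base => rfl
    | succ n hn ih => rw [h1 n j hn, ih]
  refine ⟨⟨fun n => (G^[n + 1] 0).coeff n⟩, ?_, ?_⟩
  · ext n
    rw [hG n _ (G^[n] 0) (fun j hj => (hst n j hj).symm) n (by omega),
      ← Function.iterate_succ_apply' G n]
  · intro v hv
    have h2 : ∀ n, ∀ j < n, v.coeff j = (G^[n] 0).coeff j := by
      intro n
      induction n with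
      | zero => simp
      | succ n ih =>
        rw [Function.iterate_succ_apply']
        conv in v.coeff _ => rw [← hv]
        exact hG n _ _ ih
    ext n
    exact h2 (n + 1) n (by omega)

variable [Module ℂ V]

@[simp] theorem coeff_zero_X_smul (v : FormalSeries V) :
    ((PowerSeries.X : ℂ⟦X⟧) • v).coeff 0 = 0 := by
  simp [coeff_smul]

@[simp] theorem coeff_succ_X_smul (v : FormalSeries V) (n : ℕ) :
    ((PowerSeries.X : ℂ⟦X⟧) • v).coeff (n + 1) = v.coeff n := by
  rw [coeff_smul, Finset.sum_eq_single (1, n)]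
  · simp
  · rintro ⟨a, b⟩ hab hne
    have : a ≠ 1 := by
      rintro rfl
      simp only [mem_antidiagonal] at hab
      exact hne (by ext <;> simp; omega)
    simp [PowerSeries.coeff_X, this]
  · intro h
    exact absurd (mem_antidiagonal.2 (by omega)) h

theorem eq_const_add_X_smul (v : FormalSeries V) :
    v = const (v.coeff 0) + (PowerSeries.X : ℂ⟦X⟧) • shift v := by
  ext n
  cases n <;> simp [const, shift]

theorem X_smul_eq_zero {v : FormalSeries V} (h : (PowerSeries.X : ℂ⟦X⟧) • v = 0) : v = 0 := by
  ext n
  simpa using congrArg (fun s => FormalSeries.coeff s (n + 1)) h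

theorem exists_eq_X_pow_smul_iff (v : FormalSeries V) (n : ℕ) :
    (∃ r : FormalSeries V, v = (PowerSeries.X : ℂ⟦X⟧) ^ n • r) ↔ ∀ j < n, v.coeff j = 0 := by
  induction n generalizing v with
  | zero => simp
  | succ n ih =>
    constructor
    · rintro ⟨r, rfl⟩ j hj
      rw [pow_succ', mul_smul]
      cases j with
      | zero => simp
      | succ j =>
        rw [coeff_succ_X_smul]
        exact (ih _).1 ⟨r, rfl⟩ j (by omega)
    · intro h
      obtain ⟨r, hr⟩ := (ih (shift v)).2 fun j hj => h (j + 1) (by omega)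
      refine ⟨r, ?_⟩
      rw [pow_succ', mul_smul, ← hr]
      conv_lhs => rw [eq_const_add_X_smul v, h 0 (by omega)]
      simp only [add_eq_right]
      ext n
      simp [const]

/-- A `ℂ[[λ]]`-linear map out of `V[[λ]]` into a `λ`-torsion free and `λ`-adically separated module
is bijective if its leading order is. -/
theorem bijective_of_leading {N : Type*} [AddCommGroup N] [Module ℂ⟦X⟧ N]
    (F : FormalSeries V →ₗ[ℂ⟦X⟧] N)
    (htf : ∀ w : N, (PowerSeries.X : ℂ⟦X⟧) • w = 0 → w = 0)
    (hsep : ∀ w : N, (∀ n : ℕ, ∃ w' : N, w = (PowerSeries.X : ℂ⟦X⟧) ^ n • w') → w = 0)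
    (hsurj : ∀ w : N, ∃ (v : V) (w' : N), w = F (const v) + (PowerSeries.X : ℂ⟦X⟧) • w')
    (hinj : ∀ (v : V) (w' : N), F (const v) = (PowerSeries.X : ℂ⟦X⟧) • w' → v = 0) :
    Function.Bijective F := by
  constructor
  · rw [injective_iff_map_eq_zero]
    have key : ∀ (n : ℕ) (s : FormalSeries V), F s = 0 → s.coeff n = 0 := by
      have h0 : ∀ s : FormalSeries V, F s = 0 → s.coeff 0 = 0 ∧ F (shift s) = 0 := by
        intro s hs
        have h1 := hs
        rw [eq_const_add_X_smul s, map_add, map_smul] at h1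
        have h2 : s.coeff 0 = 0 :=
          hinj _ (-F (shift s)) (by rw [smul_neg]; exact eq_neg_of_add_eq_zero_left h1)
        refine ⟨h2, htf _ ?_⟩
        have h3 : (const (s.coeff 0) : FormalSeries V) = 0 := by
          ext n; simp [h2, const]
        rwa [h3, map_zero, zero_add] at h1
      intro n
      induction n with
      | zero => exact fun s hs => (h0 s hs).1
      | succ n ih => exact fun s hs => ih (shift s) (h0 s hs).2
    exact fun s hs => by ext n; exact key n s hs
  · choose st nx h using hsurj
    intro w
    let s : N → FormalSeries V := fun w => ⟨fun n => st (nx^[n] w)⟩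
    have hs : ∀ w, s w = const (st w) + (PowerSeries.X : ℂ⟦X⟧) • s (nx w) := fun w =>
      eq_const_add_X_smul (s w)
    refine ⟨s w, (sub_eq_zero.1 (hsep _ fun n => ⟨nx^[n] w - F (s (nx^[n] w)), ?_⟩)).symm⟩
    induction n generalizing w with
    | zero => simp
    | succ n ih =>
      rw [Function.iterate_succ_apply, pow_succ', mul_smul, ← ih (nx w)]
      conv_lhs => rw [hs w]; enter [1]; rw [h w]
      rw [map_add, map_smul, smul_sub]
      abel

section Ring

variable {R : Type*} [Ring R] [Algebra ℂ⟦X⟧ R]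

theorem existsUnique_fixedPoint_of_equiv (φ : FormalSeries V ≃ₗ[ℂ⟦X⟧] R) (G : R → R)
    (hG : ∀ (n : ℕ) (u v r : R), u - v = (PowerSeries.X : ℂ⟦X⟧) ^ n • r →
      ∃ r', G u - G v = (PowerSeries.X : ℂ⟦X⟧) ^ (n + 1) • r') :
    ∃! w, G w = w := by
  obtain ⟨w, hw, hu⟩ := existsUnique_fixedPoint (fun s => φ.symm (G (φ s))) (by
    intro n u v huv j hj
    obtain ⟨r, hr⟩ := (exists_eq_X_pow_smul_iff (u + -v) n).2 fun j hj => by simp [huv j hj]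
    obtain ⟨r', hr'⟩ := hG n (φ u) (φ v) (φ r) (by
      rw [← map_smul, ← map_sub, ← hr, sub_eq_add_neg])
    have h1 := (exists_eq_X_pow_smul_iff (φ.symm (G (φ u)) + -φ.symm (G (φ v))) (n + 1)).1
      ⟨φ.symm r', by rw [← map_smul, ← hr', map_sub, sub_eq_add_neg]⟩ j hj
    rw [coeff_add, coeff_neg] at h1
    exact add_neg_eq_zero.1 h1)
  refine ⟨φ w, (φ.apply_symm_apply (G (φ w))).symm.trans (congrArg φ hw), fun v hv => ?_⟩
  rw [← hu (φ.symm v) (by simp [hv]), LinearEquiv.apply_symm_apply]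

theorem exists_inverse_one_add (φ : FormalSeries V ≃ₗ[ℂ⟦X⟧] R) (w : R) :
    ∃ z : R, (1 + (PowerSeries.X : ℂ⟦X⟧) • w) * (1 + (PowerSeries.X : ℂ⟦X⟧) • z) = 1 ∧
      (1 + (PowerSeries.X : ℂ⟦X⟧) • z) * (1 + (PowerSeries.X : ℂ⟦X⟧) • w) = 1 := by
  obtain ⟨z, hz, -⟩ := existsUnique_fixedPoint_of_equiv φ
    (fun z => -w - (PowerSeries.X : ℂ⟦X⟧) • (w * z)) (fun n u v r h => ⟨-(w * r), by
      rw [sub_sub_sub_cancel_left, ← smul_sub, ← mul_sub, ← neg_sub u v, h, pow_succ', mul_smul]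
      simp⟩)
  obtain ⟨z', hz', -⟩ := existsUnique_fixedPoint_of_equiv φ
    (fun z => -w - (PowerSeries.X : ℂ⟦X⟧) • (z * w)) (fun n u v r h => ⟨-(r * w), by
      rw [sub_sub_sub_cancel_left, ← smul_sub, ← sub_mul, ← neg_sub u v, h, pow_succ', mul_smul]
      simp⟩)
  have h1 : (1 + (PowerSeries.X : ℂ⟦X⟧) • w) * (1 + (PowerSeries.X : ℂ⟦X⟧) • z) = 1 := by
    have : (PowerSeries.X : ℂ⟦X⟧) • z =
      -((PowerSeries.X : ℂ⟦X⟧) • w) - (PowerSeries.X : ℂ⟦X⟧) • (PowerSeries.X : ℂ⟦X⟧) • (w * z) := by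
      conv_lhs => rw [← hz]
      simp [smul_sub]
    rw [add_mul, one_mul, mul_add, mul_one, smul_mul_smul_comm, ← smul_smul, this]
    abel
  have h2 : (1 + (PowerSeries.X : ℂ⟦X⟧) • z') * (1 + (PowerSeries.X : ℂ⟦X⟧) • w) = 1 := by
    have : (PowerSeries.X : ℂ⟦X⟧) • z' =
      -((PowerSeries.X : ℂ⟦X⟧) • w) -
        (PowerSeries.X : ℂ⟦X⟧) • (PowerSeries.X : ℂ⟦X⟧) • (z' * w) := by
      conv_lhs => rw [← hz']
      simp [smul_sub]
    rw [mul_add, mul_one, add_mul, one_mul, smul_mul_smul_comm, ← smul_smul, this]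
    abel
  refine ⟨z, h1, ?_⟩
  rw [← left_inv_eq_right_inv h2 h1, h2]

/-- Selfadjoint deformations of `1` have invertible selfadjoint square roots. -/
theorem exists_sqrt_one_add [StarRing R] (φ : FormalSeries V ≃ₗ[ℂ⟦X⟧] R)
    (hstar : ∀ r : R, star ((PowerSeries.X : ℂ⟦X⟧) • r) = (PowerSeries.X : ℂ⟦X⟧) • star r)
    (r : R) (hr : star (1 + (PowerSeries.X : ℂ⟦X⟧) • r) = 1 + (PowerSeries.X : ℂ⟦X⟧) • r) :
    ∃ w : R, star (1 + (PowerSeries.X : ℂ⟦X⟧) • w) = 1 + (PowerSeries.X : ℂ⟦X⟧) • w ∧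
      (1 + (PowerSeries.X : ℂ⟦X⟧) • w) * (1 + (PowerSeries.X : ℂ⟦X⟧) • w) =
        1 + (PowerSeries.X : ℂ⟦X⟧) • r := by
  have hr' : star r = r := by
    rw [star_add, star_one, hstar, add_right_inj, ← sub_eq_zero, ← smul_sub] at hr
    have := X_smul_eq_zero (v := φ.symm (star r - r)) (by rw [← map_smul, hr, map_zero])
    rwa [LinearEquiv.map_eq_zero_iff, sub_eq_zero] at this
  have h2 : ∀ a : R, (PowerSeries.C (2⁻¹ : ℂ)) • a + (PowerSeries.C (2⁻¹ : ℂ)) • a = a := by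
    intro a
    rw [← add_smul, ← map_add, ← two_mul, mul_inv_cancel₀ two_ne_zero, map_one, one_smul]
  have h2' : ∀ a b : R, a + a = b → (PowerSeries.C (2⁻¹ : ℂ)) • b = a := by
    rintro a b rfl
    rw [smul_add, h2]
  obtain ⟨w, hw, hu⟩ := existsUnique_fixedPoint_of_equiv φ
    (fun w => (PowerSeries.C (2⁻¹ : ℂ)) • (r - (PowerSeries.X : ℂ⟦X⟧) • (w * w)))
    (fun n u v t h => ⟨(PowerSeries.C (2⁻¹ : ℂ)) • (-(u * t + t * v)), by
      have h3 : v * v - u * u = -(u * (u - v) + (u - v) * v) := by noncomm_ring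
      rw [← smul_sub, sub_sub_sub_cancel_left, ← smul_sub, h3, h, pow_succ', mul_smul,
        smul_comm (PowerSeries.C (2⁻¹ : ℂ))]
      simp [smul_comm (PowerSeries.C (2⁻¹ : ℂ))]⟩)
  have hww : w + w = r - (PowerSeries.X : ℂ⟦X⟧) • (w * w) := by
    conv_lhs => rw [← hw]
    exact h2 _
  have hsw : star w = w := by
    refine hu (star w) (h2' _ _ ?_)
    rw [← star_add, hww, star_sub, hstar, star_mul, hr']
  refine ⟨w, by rw [star_add, star_one, hstar, hsw], ?_⟩
  have h4 : (1 + (PowerSeries.X : ℂ⟦X⟧) • w) * (1 + (PowerSeries.X : ℂ⟦X⟧) • w) =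
      1 + (PowerSeries.X : ℂ⟦X⟧) • (w + w) +
        (PowerSeries.X : ℂ⟦X⟧) • (PowerSeries.X : ℂ⟦X⟧) • (w * w) := by
    rw [add_mul, one_mul, mul_add, mul_one, smul_mul_smul_comm, ← smul_smul, smul_add]
    abel
  rw [h4, hww, smul_sub]
  abel

end Ring

end FormalSeries

namespace HermitianDeformation

variable {A : Type*} [CommRing A] [StarRing A] [Algebra ℂ A] {D : HermitianDeformation A}

namespace Alg

theorem coeff_smul (a : ℂ⟦X⟧) (f : D.Alg) (n : ℕ) :
    (a • f).coeff n = ∑ p ∈ antidiagonal n, PowerSeries.coeff p.1 a • f.coeff p.2 := rfl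

theorem one_smul_coeff (a : ℂ⟦X⟧) (n : ℕ) :
    (a • (1 : D.Alg)).coeff n = PowerSeries.coeff n a • 1 := by
  rw [coeff_smul, Finset.sum_eq_single (n, 0)]
  · simp [coeff_one]
  · rintro ⟨p, q⟩ h hne
    have : q ≠ 0 := by rintro rfl; simp_all
    simp [coeff_one, this]
  · simp

theorem smul_one_mul (a : ℂ⟦X⟧) (f : D.Alg) : a • (1 : D.Alg) * f = a • f := by
  refine ext_coeff fun n => ?_
  rw [coeff_mul, Finset.sum_eq_single (0, n), coeff_smul]
  · refine Finset.sum_congr rfl fun q _ => ?_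
    rw [one_smul_coeff, map_smul, LinearMap.smul_apply, D.C_zero, one_mul]
  · rintro ⟨p, q⟩ h hne
    have : 0 < p := by
      rcases Nat.eq_zero_or_pos p with rfl | h
      · simp_all
      · exact h
    refine Finset.sum_eq_zero fun q _ => ?_
    rw [one_smul_coeff, map_smul, LinearMap.smul_apply, D.one_left _ _ this, smul_zero]
  · simp

theorem mul_smul_one (a : ℂ⟦X⟧) (f : D.Alg) : f * a • (1 : D.Alg) = a • f := by
  refine ext_coeff fun n => ?_
  rw [coeff_mul, Finset.sum_eq_single (0, n), coeff_smul, ← Finset.Nat.sum_antidiagonal_swap]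
  · refine Finset.sum_congr rfl fun q _ => ?_
    rw [one_smul_coeff, map_smul, D.C_zero, mul_one]
    rfl
  · rintro ⟨p, q⟩ h hne
    have : 0 < p := by
      rcases Nat.eq_zero_or_pos p with rfl | h
      · simp_all
      · exact h
    refine Finset.sum_eq_zero fun q _ => ?_
    rw [one_smul_coeff, map_smul, D.one_right _ _ this, smul_zero]
  · simp

instance : Algebra ℂ⟦X⟧ D.Alg :=
  Algebra.ofModule
    (fun a f g => by rw [← smul_one_mul a f, mul_assoc, smul_one_mul])
    (fun a f g => by
      rw [← smul_one_mul a g, ← mul_assoc, mul_smul_one, ← smul_one_mul a f, mul_assoc,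
        smul_one_mul])

@[simp] theorem coeff_zero_X_smul (f : D.Alg) : ((PowerSeries.X : ℂ⟦X⟧) • f).coeff 0 = 0 :=
  FormalSeries.coeff_zero_X_smul f.toFormalSeries

@[simp] theorem coeff_succ_X_smul (f : D.Alg) (n : ℕ) :
    ((PowerSeries.X : ℂ⟦X⟧) • f).coeff (n + 1) = f.coeff n :=
  FormalSeries.coeff_succ_X_smul f.toFormalSeries n

theorem X_smul_eq_zero {f : D.Alg} (h : (PowerSeries.X : ℂ⟦X⟧) • f = 0) : f = 0 :=
  ext_coeff fun n => by simpa using congrArg (fun s : D.Alg => s.coeff (n + 1)) h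

theorem eq_zero_of_X_pow_dvd {f : D.Alg}
    (h : ∀ n : ℕ, ∃ g : D.Alg, f = (PowerSeries.X : ℂ⟦X⟧) ^ n • g) : f = 0 :=
  ext_coeff fun n => by
    obtain ⟨g, hg⟩ := h (n + 1)
    exact (FormalSeries.exists_eq_X_pow_smul_iff f.toFormalSeries (n + 1)).1
      ⟨g.toFormalSeries, congrArg toFormalSeries hg⟩ n (by omega)

theorem star_X_smul (f : D.Alg) :
    star ((PowerSeries.X : ℂ⟦X⟧) • f) = (PowerSeries.X : ℂ⟦X⟧) • star f :=
  ext_coeff fun n => by cases n <;> simp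

/-- The series `f₁ + λ f₂ + ⋯` obtained from `f₀ + λ f₁ + ⋯`. -/
def shift (f : D.Alg) : D.Alg := ⟨f.toFormalSeries.shift⟩

theorem X_smul_shift {f : D.Alg} (h : f.coeff 0 = 0) :
    (PowerSeries.X : ℂ⟦X⟧) • shift f = f :=
  ext_coeff fun n => by
    cases n with
    | zero => simp [h]
    | succ n => rw [coeff_succ_X_smul]; rfl

theorem coeff_mul_zero (f g : D.Alg) : (f * g).coeff 0 = f.coeff 0 * g.coeff 0 := by
  simp [coeff_mul, D.C_zero]

variable (D) in
/-- The classical limit. -/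
def coeffZero : D.Alg →+* A where
  toFun f := f.coeff 0
  map_one' := by simp [coeff_one]
  map_mul' := coeff_mul_zero
  map_zero' := rfl
  map_add' _ _ := rfl

end Alg

theorem IsNonneg.zero : IsNonneg 0 := ⟨fun n => by simp, Or.inl rfl⟩

theorem IsNonneg.add {a b : ℂ⟦X⟧} (ha : IsNonneg a) (hb : IsNonneg b) : IsNonneg (a + b) := by
  refine ⟨fun n => by simp [ha.1 n, hb.1 n], ?_⟩
  rcases ha.2 with rfl | ⟨r, hr, hr'⟩
  · simpa using hb.2
  rcases hb.2 with rfl | ⟨t, ht, ht'⟩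
  · simpa using Or.inr ⟨r, hr, hr'⟩
  right
  rcases lt_trichotomy r t with h | rfl | h
  · exact ⟨r, fun j hj => by simp [hr j hj, ht j (hj.trans h)], by simpa [ht r h] using hr'⟩
  · exact ⟨r, fun j hj => by simp [hr j hj, ht j hj], by simpa using add_pos hr' ht'⟩
  · exact ⟨t, fun j hj => by simp [hr j (hj.trans h), ht j hj], by simpa [hr t h] using ht'⟩

/-- Sums of squares are positive elements. -/
theorem isPositive_sum_star_mul {ι : Type*} [Fintype ι] (f : ι → D.Alg) :
    IsPositive (∑ i, star (f i) * f i) := by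
  refine ⟨by simp [star_sum], fun F hF => ?_⟩
  rw [map_sum]
  exact Finset.sum_induction _ IsNonneg (fun _ _ => IsNonneg.add) IsNonneg.zero
    fun i _ => hF (f i)

end HermitianDeformation

end QuantumSerreSwan

end

noncomputable section

namespace QuantumSerreSwan

variable {d : ℕ} {M : Type*} [TopologicalSpace M] [ChartedSpace (EuclideanSpace ℝ (Fin d)) M]

namespace StarProduct

variable {P : PoissonStructure d M} (S : StarProduct P)

theorem C_eventuallyEq (r : ℕ) {f f' g g' : CInf d M} {x : M} (hf : ⇑f =ᶠ[𝓝 x] f')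
    (hg : ⇑g =ᶠ[𝓝 x] g') : ⇑(S.C r f g) =ᶠ[𝓝 x] S.C r f' g' := by
  filter_upwards [hf.eventuallyEq_nhds, hg.eventuallyEq_nhds] with y hy hy'
  exact (S.bidifferential r).congr hy hy'

theorem coeff_mul_eventuallyEq {f f' g g' : S.Alg} {x : M}
    (hf : ∀ n, ⇑(f.coeff n) =ᶠ[𝓝 x] f'.coeff n) (hg : ∀ n, ⇑(g.coeff n) =ᶠ[𝓝 x] g'.coeff n)
    (n : ℕ) : ⇑((f * g).coeff n) =ᶠ[𝓝 x] (f' * g').coeff n := by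
  have h : ∀ p ∈ antidiagonal n, ∀ q ∈ antidiagonal p.2, ∀ᶠ y in 𝓝 x,
      S.C p.1 (f.coeff q.1) (g.coeff q.2) y = S.C p.1 (f'.coeff q.1) (g'.coeff q.2) y :=
    fun p _ q _ => S.C_eventuallyEq p.1 (hf q.1) (hg q.2)
  have h' := (Filter.eventually_all_finset _).2 fun p hp => (Filter.eventually_all_finset _).2 (h p hp)
  filter_upwards [h'] with y hy
  simp only [HermitianDeformation.Alg.coeff_mul, sum_apply]
  exact Finset.sum_congr rfl fun p hp => Finset.sum_congr rfl fun q hq => hy p hp q hq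

/-- The two-sided ideal of the series whose coefficients all vanish near `x`. -/
def vanishingIdeal (x : M) : Ideal S.Alg where
  carrier := {f | ∀ n, ⇑(f.coeff n) =ᶠ[𝓝 x] (0 : CInf d M)}
  add_mem' {f g} hf hg n := by
    filter_upwards [hf n, hg n] with y h1 h2
    rw [HermitianDeformation.Alg.coeff_add, ContMDiffMap.coe_add, Pi.add_apply, h1, h2]
    exact add_zero 0
  zero_mem' n := Filter.EventuallyEq.rfl
  smul_mem' f g hg n := by
    have := S.coeff_mul_eventuallyEq (f := f) (g := g) (g' := 0) (fun n => Filter.EventuallyEq.rfl) hg n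
    rwa [mul_zero] at this

instance (x : M) : (S.vanishingIdeal x).IsTwoSided where
  mul_mem_of_left {f} g hf n := by
    have := S.coeff_mul_eventuallyEq (f := f) (g := g) (f' := 0) hf (fun n => Filter.EventuallyEq.rfl) n
    rwa [zero_mul] at this

/-- The stalk at `x` of the sheaf of deformed algebras (with coefficientwise germs). -/
def Stalk (x : M) : Type _ := S.Alg ⧸ S.vanishingIdeal x

instance (x : M) : Ring (S.Stalk x) := inferInstanceAs (Ring (S.Alg ⧸ S.vanishingIdeal x))

instance (x : M) : Algebra ℂ⟦X⟧ (S.Stalk x) :=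
  inferInstanceAs (Algebra ℂ⟦X⟧ (S.Alg ⧸ S.vanishingIdeal x))

/-- The germ at `x` of a global series. -/
def toStalk (x : M) : S.Alg →+* S.Stalk x := Ideal.Quotient.mk (S.vanishingIdeal x)

variable {S}

theorem toStalk_eq_iff {x : M} {f g : S.Alg} :
    S.toStalk x f = S.toStalk x g ↔ ∀ n, ⇑(f.coeff n) =ᶠ[𝓝 x] g.coeff n := by
  refine Ideal.Quotient.eq.trans (forall_congr' fun n => ?_)
  rw [sub_eq_add_neg, HermitianDeformation.Alg.coeff_add, HermitianDeformation.Alg.coeff_neg]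
  constructor <;> intro h <;> filter_upwards [h] with y hy
  · exact sub_eq_zero.1 ((sub_eq_add_neg _ _).trans hy)
  · exact (sub_eq_add_neg _ _).symm.trans (sub_eq_zero.2 hy)

theorem toStalk_surjective (x : M) : Function.Surjective (S.toStalk x) :=
  Ideal.Quotient.mk_surjective

theorem toStalk_star_congr {x : M} {f g : S.Alg} (h : S.toStalk x f = S.toStalk x g) :
    S.toStalk x (star f) = S.toStalk x (star g) := by
  rw [toStalk_eq_iff] at h ⊢
  intro n
  filter_upwards [h n] with y hy
  simp [hy]

instance (x : M) : Star (S.Stalk x) :=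
  ⟨fun a => S.toStalk x (star (toStalk_surjective x a).choose)⟩

theorem toStalk_star (x : M) (f : S.Alg) : S.toStalk x (star f) = star (S.toStalk x f) :=
  toStalk_star_congr (toStalk_surjective x (S.toStalk x f)).choose_spec.symm

instance (x : M) : StarRing (S.Stalk x) where
  star_involutive a := by
    obtain ⟨f, rfl⟩ := toStalk_surjective x a
    rw [← toStalk_star, ← toStalk_star, star_star]
  star_mul a b := by
    obtain ⟨f, rfl⟩ := toStalk_surjective x a
    obtain ⟨g, rfl⟩ := toStalk_surjective x b
    rw [← map_mul, ← toStalk_star, star_mul, map_mul, toStalk_star, toStalk_star]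
  star_add a b := by
    obtain ⟨f, rfl⟩ := toStalk_surjective x a
    obtain ⟨g, rfl⟩ := toStalk_surjective x b
    rw [← map_add, ← toStalk_star, star_add, map_add, toStalk_star, toStalk_star]

namespace Stalk

/-- The value at `x` of the `n`-th coefficient of a germ. -/
def coeff {x : M} (a : S.Stalk x) (n : ℕ) : ℂ := (toStalk_surjective x a).choose.coeff n x

theorem coeff_toStalk (x : M) (f : S.Alg) (n : ℕ) :
    (S.toStalk x f).coeff n = f.coeff n x :=
  (toStalk_eq_iff.1 (toStalk_surjective x (S.toStalk x f)).choose_spec n).eq_of_nhds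

@[simp] theorem coeff_zero {x : M} (n : ℕ) : (0 : S.Stalk x).coeff n = 0 := by
  rw [← map_zero (S.toStalk x), coeff_toStalk]
  rfl

variable (S) in
/-- The classical value of a germ at `x`. -/
def eval (x : M) : S.Stalk x →+* ℂ where
  toFun a := a.coeff 0
  map_one' := by rw [← map_one (S.toStalk x), coeff_toStalk]; rfl
  map_mul' a b := by
    obtain ⟨f, rfl⟩ := toStalk_surjective x a
    obtain ⟨g, rfl⟩ := toStalk_surjective x b
    rw [← map_mul, coeff_toStalk, coeff_toStalk, coeff_toStalk,
      HermitianDeformation.Alg.coeff_mul_zero]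
    rfl
  map_zero' := coeff_zero 0
  map_add' a b := by
    obtain ⟨f, rfl⟩ := toStalk_surjective x a
    obtain ⟨g, rfl⟩ := toStalk_surjective x b
    rw [← map_add, coeff_toStalk, coeff_toStalk, coeff_toStalk]
    rfl

theorem eval_star {x : M} (a : S.Stalk x) : eval S x (star a) = star (eval S x a) := by
  obtain ⟨f, rfl⟩ := toStalk_surjective x a
  rw [← toStalk_star]
  exact (coeff_toStalk x _ 0).trans (congrArg star (coeff_toStalk x f 0).symm)

end Stalk

theorem eval_toStalk (x : M) (f : S.Alg) : Stalk.eval S x (S.toStalk x f) = f.coeff 0 x :=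
  Stalk.coeff_toStalk x f 0

theorem alg_ext_of_toStalk {f g : S.Alg} (h : ∀ x, S.toStalk x f = S.toStalk x g) : f = g :=
  HermitianDeformation.Alg.ext_coeff fun n => by
    ext x
    rw [← Stalk.coeff_toStalk, h, Stalk.coeff_toStalk]

variable [IsManifold (𝓡 d) ∞ M] [T2Space M]

open Classical in
/-- The germ at `x` of a series over `U`, which is zero if `x ∉ U`. -/
def germFun (U : Opens M) (x : M) (f : S.Loc U) : S.Stalk x :=
  if h : x ∈ U then S.toStalk x ⟨f.toFormalSeries.map (extend ⟨x, h⟩)⟩ else 0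

theorem germFun_eq_iff {U : Opens M} {x : M} (hx : x ∈ U) (f : S.Loc U) (F : S.Alg) :
    germFun U x f = S.toStalk x F ↔
      ∀ n, ∀ᶠ y in 𝓝 x, ∀ hy : y ∈ U, f.coeff n ⟨y, hy⟩ = F.coeff n y := by
  rw [germFun, dif_pos hx, toStalk_eq_iff]
  refine forall_congr' fun n => ?_
  constructor <;> intro h <;> filter_upwards [h, (isOpen_extNhd U ⟨x, hx⟩).mem_nhds
    (mem_extNhd (d := d) U ⟨x, hx⟩)] with y hy hy'
  · intro hyU
    rw [← hy]
    exact (extend_eq (d := d) ⟨x, hx⟩ (f.coeff n) (y := ⟨y, hyU⟩) hy').symm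
  · have hyU : y ∈ U := extNhd_subset U _ hy'
    rw [← hy hyU]
    exact extend_eq (d := d) ⟨x, hx⟩ (f.coeff n) (y := ⟨y, hyU⟩) hy'

theorem exists_germFun {U : Opens M} {x : M} (hx : x ∈ U) (f : S.Loc U) :
    ∃ F : S.Alg, germFun U x f = S.toStalk x F ∧ ∃ W : Set M, IsOpen W ∧ x ∈ W ∧
      ∀ n (z : U), (z : M) ∈ W → F.coeff n z = f.coeff n z :=
  ⟨_, dif_pos hx, _, isOpen_extNhd U ⟨x, hx⟩, mem_extNhd U ⟨x, hx⟩,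
    fun n _ hz => extend_eq (d := d) ⟨x, hx⟩ (f.coeff n) hz⟩

/-- The germ at `x` of a series over `U`, which is zero if `x ∉ U`. -/
def germ (U : Opens M) (x : M) : S.Loc U →ₙ+* S.Stalk x where
  toFun := germFun U x
  map_zero' := by
    by_cases hx : x ∈ U
    · rw [← map_zero (S.toStalk x), germFun_eq_iff hx]
      exact fun n => Filter.Eventually.of_forall fun y hy => rfl
    · exact dif_neg hx
  map_add' f g := by
    by_cases hx : x ∈ U
    · obtain ⟨F, hF, -⟩ := exists_germFun hx f
      obtain ⟨G, hG, -⟩ := exists_germFun hx g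
      rw [hF, hG, ← map_add, germFun_eq_iff hx]
      rw [germFun_eq_iff hx] at hF hG
      intro n
      filter_upwards [hF n, hG n] with y h1 h2 hy
      exact congrArg₂ (· + ·) (h1 hy) (h2 hy)
    · simp [germFun, hx]
  map_mul' f g := by
    by_cases hx : x ∈ U
    · have hW := isOpen_extNhd (d := d) U ⟨x, hx⟩
      have hF : ∀ (h : S.Loc U) n (z : U), (z : M) ∈ extNhd d U ⟨x, hx⟩ →
          (h.toFormalSeries.map (extend (d := d) ⟨x, hx⟩)).coeff n z = h.coeff n z :=
        fun h n z hz => extend_eq _ _ hz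
      have h1 : ∀ h : S.Loc U, germFun U x h =
        S.toStalk x ⟨h.toFormalSeries.map (extend ⟨x, hx⟩)⟩ := fun h => dif_pos hx
      rw [h1 f, h1 g, ← map_mul, germFun_eq_iff hx]
      intro n
      filter_upwards [hW.mem_nhds (mem_extNhd U ⟨x, hx⟩)] with y hyW hy
      exact (S.cochainProd_apply hW (hF f) (hF g) n ⟨y, hy⟩ hyW).symm
    · simp [germFun, hx]

theorem germ_of_notMem {U : Opens M} {x : M} (hx : x ∉ U) (f : S.Loc U) : germ U x f = 0 :=
  dif_neg hx

theorem germ_eq_toStalk_iff {U : Opens M} {x : M} (hx : x ∈ U) {f : S.Loc U} {F : S.Alg} :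
    germ U x f = S.toStalk x F ↔
      ∀ n, ∀ᶠ y in 𝓝 x, ∀ hy : y ∈ U, f.coeff n ⟨y, hy⟩ = F.coeff n y :=
  germFun_eq_iff hx f F

theorem germ_eq_germ_iff {U V : Opens M} {x : M} (hx : x ∈ U) (hx' : x ∈ V) {f : S.Loc U}
    {g : S.Loc V} : germ U x f = germ V x g ↔
      ∀ n, ∀ᶠ y in 𝓝 x, ∀ (hy : y ∈ U) (hy' : y ∈ V),
        f.coeff n ⟨y, hy⟩ = g.coeff n ⟨y, hy'⟩ := by
  obtain ⟨G, hG, -⟩ := exists_germFun hx' g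
  replace hG : germ V x g = S.toStalk x G := hG
  rw [hG, germ_eq_toStalk_iff hx]
  rw [germ_eq_toStalk_iff hx'] at hG
  refine forall_congr' fun n => ?_
  constructor <;> intro h <;> filter_upwards [h, hG n, V.isOpen.mem_nhds hx'] with y h1 h2 h3
  · intro hy hy'
    rw [h1 hy, h2 hy']
  · intro hy
    rw [h1 hy h3, h2 h3]

theorem germ_eq_zero_iff {U : Opens M} {x : M} (hx : x ∈ U) {f : S.Loc U} :
    germ U x f = 0 ↔ ∀ n, ∀ᶠ y in 𝓝 x, ∀ hy : y ∈ U, f.coeff n ⟨y, hy⟩ = 0 := by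
  rw [← map_zero (S.toStalk x), germ_eq_toStalk_iff hx]
  rfl

theorem coeff_germ {U : Opens M} {x : M} (hx : x ∈ U) (f : S.Loc U) (n : ℕ) :
    (germ U x f).coeff n = f.coeff n ⟨x, hx⟩ := by
  obtain ⟨F, hF, W, -, hxW, hW⟩ := exists_germFun hx f
  exact (congrArg (fun a => Stalk.coeff a n) hF).trans
    ((Stalk.coeff_toStalk x F n).trans (hW n ⟨x, hx⟩ hxW))

theorem eval_germ {U : Opens M} {x : M} (hx : x ∈ U) (f : S.Loc U) :
    Stalk.eval S x (germ U x f) = f.coeff 0 ⟨x, hx⟩ := coeff_germ hx f 0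

theorem loc_ext {U : Opens M} {f g : S.Loc U} (h : ∀ x ∈ U, germ U x f = germ U x g) : f = g :=
  HermitianDeformation.Alg.ext_coeff fun n => by
    ext x
    rw [← coeff_germ x.2, h x x.2, coeff_germ x.2]

theorem germ_one {U : Opens M} {x : M} (hx : x ∈ U) : germ U x (1 : S.Loc U) = 1 := by
  rw [← map_one (S.toStalk x), germ_eq_toStalk_iff hx]
  intro n
  refine Filter.Eventually.of_forall fun y hy => ?_
  rw [HermitianDeformation.Alg.coeff_one, HermitianDeformation.Alg.coeff_one]
  split_ifs <;> rfl

theorem germ_star (U : Opens M) (x : M) (f : S.Loc U) :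
    germ U x (star f) = star (germ U x f) := by
  by_cases hx : x ∈ U
  · obtain ⟨F, hF, -⟩ := exists_germFun hx f
    replace hF : germ U x f = S.toStalk x F := hF
    rw [hF, ← toStalk_star, germ_eq_toStalk_iff hx]
    rw [germ_eq_toStalk_iff hx] at hF
    intro n
    filter_upwards [hF n] with y h1 hy
    exact congrArg star (h1 hy)
  · rw [germ_of_notMem hx, germ_of_notMem hx, star_zero]

theorem germ_res {U V : Opens M} (h : V ≤ U) {x : M} (hx : x ∈ V) (f : S.Loc U) :
    germ V x (res h f) = germ U x f :=
  (germ_eq_germ_iff hx (h hx)).2 fun _ => Filter.Eventually.of_forall fun _ _ _ => rfl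

theorem germ_toLoc {U : Opens M} {x : M} (hx : x ∈ U) (f : S.Alg) :
    germ U x (toLoc U f) = S.toStalk x f :=
  (germ_eq_toStalk_iff hx).2 fun _ => Filter.Eventually.of_forall fun _ _ => rfl

theorem coeff_extZero {U V : Opens M} {f : S.Loc V} {K : Set M} (hK : IsClosed K)
    (hKV : K ∩ U ⊆ V) (hf : ∀ x ∉ K, germ V x f = 0) (n : ℕ) (x : U) :
    (extZero U f).coeff n x = (germ V x f).coeff n := by
  refine (zeroExtend_apply (f.coeff n) hK hKV (fun x hx => ?_) x).trans ?_
  · rw [← coeff_germ x.2, hf x hx, Stalk.coeff_zero]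
  · split_ifs with hx
    · rw [coeff_germ hx]
    · rw [germ_of_notMem hx, Stalk.coeff_zero]

theorem germ_extZero {U V : Opens M} (hVU : V ≤ U) {f : S.Loc V} {K : Set M} (hK : IsClosed K)
    (hKV : K ∩ U ⊆ V) (hf : ∀ x ∉ K, germ V x f = 0) (x : M) :
    germ U x (extZero U f) = germ V x f := by
  have hc := coeff_extZero hK hKV hf
  by_cases hV : x ∈ V
  · refine (germ_eq_germ_iff (hVU hV) hV).2 fun n => Filter.Eventually.of_forall fun y hy hy' => ?_
    rw [hc n ⟨y, hy⟩, coeff_germ hy']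
  rw [germ_of_notMem hV]
  by_cases hU : x ∈ U
  · rw [germ_eq_zero_iff hU]
    intro n
    filter_upwards [hK.isOpen_compl.mem_nhds fun hxK => hV (hKV ⟨hxK, hU⟩)] with y hyK hy
    rw [hc n ⟨y, hy⟩, hf y hyK, Stalk.coeff_zero]
  · exact germ_of_notMem hU _

/-- Families of germs that are locally given by series over open sets are given by global series. -/
theorem exists_toStalk_eq (g : ∀ x, S.Stalk x)
    (hg : ∀ x, ∃ (V : Opens M) (f : S.Loc V), x ∈ V ∧ ∀ y ∈ V, g y = germ V y f) :
    ∃ F : S.Alg, ∀ x, S.toStalk x F = g x := by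
  refine ⟨⟨⟨fun n => ⟨fun x => (g x).coeff n, fun x => ?_⟩⟩⟩, fun x => ?_⟩
  · obtain ⟨V, f, hx, hV⟩ := hg x
    refine (contMDiffAt_open_iff (U := V) (G := fun x => (g x).coeff n) (x := ⟨x, hx⟩)).1 ?_
    have h : (fun y : V => (g y).coeff n) = f.coeff n := by
      funext y
      rw [hV y y.2, coeff_germ y.2]
    rw [h]
    exact (f.coeff n).contMDiff.contMDiffAt
  · obtain ⟨V, f, hx, hV⟩ := hg x
    rw [hV x hx, eq_comm, germ_eq_toStalk_iff hx]
    intro n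
    refine Filter.Eventually.of_forall fun y hy => ?_
    change _ = (g y).coeff n
    rw [hV y hy, coeff_germ hy]

/-- Compatible series over the members of an open cover come from a global series. -/
theorem exists_toLoc_eq {ι : Type*} {U : ι → Opens M} (hU : ∀ x, ∃ α, x ∈ U α)
    (f : ∀ α, S.Loc (U α))
    (hf : ∀ α β x, x ∈ U α → x ∈ U β → germ (U α) x (f α) = germ (U β) x (f β)) :
    ∃ F : S.Alg, ∀ α, toLoc (U α) F = f α := by
  choose a ha using hU
  obtain ⟨F, hF⟩ := exists_toStalk_eq (fun x => germ (U (a x)) x (f (a x)))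
    fun x => ⟨U (a x), f (a x), ha x, fun y hy => hf _ _ y (ha y) hy⟩
  exact ⟨F, fun α => loc_ext fun x hx => by rw [germ_toLoc hx, hF, hf _ α x (ha x) hx]⟩

theorem toLoc_ext {ι : Type*} {U : ι → Opens M} (hU : ∀ x, ∃ α, x ∈ U α) {f g : S.Alg}
    (h : ∀ α, toLoc (U α) f = toLoc (U α) g) : f = g :=
  alg_ext_of_toStalk fun x => by
    obtain ⟨α, hα⟩ := hU x
    rw [← germ_toLoc hα, h, germ_toLoc hα]

/-- Extension by zero of a series over `U` with support in a closed subset of `M`. -/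
theorem exists_extension_by_zero {U : Opens M} (f : S.Loc U) {K : Set M} (hK : IsClosed K)
    (hKU : K ⊆ U) (hf : ∀ x ∉ K, germ U x f = 0) :
    ∃ F : S.Alg, ∀ x, S.toStalk x F = germ U x f := by
  refine exists_toStalk_eq _ fun x => ?_
  by_cases hx : x ∈ K
  · exact ⟨U, f, hKU hx, fun _ _ => rfl⟩
  · exact ⟨⟨Kᶜ, hK.isOpen_compl⟩, 0, hx, fun y hy => by rw [hf y hy, map_zero]⟩

end StarProduct

end QuantumSerreSwan

end

noncomputable section

namespace QuantumSerreSwan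

variable {d : ℕ} {M : Type*} [TopologicalSpace M] [ChartedSpace (EuclideanSpace ℝ (Fin d)) M]

namespace StarProduct

variable {P : PoissonStructure d M} {S : StarProduct P}

theorem toStalk_smul (x : M) (a : ℂ⟦X⟧) (f : S.Alg) :
    S.toStalk x (a • f) = a • S.toStalk x f := rfl

theorem stalk_X_smul_eq_zero {x : M} {a : S.Stalk x} (h : (PowerSeries.X : ℂ⟦X⟧) • a = 0) :
    a = 0 := by
  obtain ⟨f, rfl⟩ := toStalk_surjective x a
  rw [← toStalk_smul, ← map_zero (S.toStalk x), toStalk_eq_iff] at h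
  rw [← map_zero (S.toStalk x), toStalk_eq_iff]
  intro n
  simpa using h (n + 1)

theorem stalk_X_smul_injective {x : M} {a b : S.Stalk x}
    (h : (PowerSeries.X : ℂ⟦X⟧) • a = (PowerSeries.X : ℂ⟦X⟧) • b) : a = b := by
  rw [← sub_eq_zero, ← smul_sub] at h
  exact sub_eq_zero.1 (stalk_X_smul_eq_zero h)

theorem toStalk_const_eq_zero {f : CInf d M} {x : M} (hx : x ∉ tsupport f) :
    S.toStalk x (HermitianDeformation.Alg.const f) = 0 := by
  rw [← map_zero (S.toStalk x), toStalk_eq_iff]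
  intro n
  by_cases hn : n = 0
  · subst hn
    exact notMem_tsupport_iff_eventuallyEq.1 hx
  · have : (HermitianDeformation.Alg.const f : S.Alg).coeff n = 0 := if_neg hn
    rw [this]
    rfl

theorem eval_toStalk_const (x : M) (f : CInf d M) :
    Stalk.eval S x (S.toStalk x (HermitianDeformation.Alg.const f)) = f x := eval_toStalk x _

theorem star_alg_const (f : CInf d M) :
    star (HermitianDeformation.Alg.const f : S.Alg) = HermitianDeformation.Alg.const (star f) :=
  HermitianDeformation.Alg.ext_coeff fun n => by
    rw [HermitianDeformation.Alg.coeff_star]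
    by_cases hn : n = 0 <;> simp [HermitianDeformation.Alg.const, FormalSeries.const, hn]

variable [IsManifold (𝓡 d) ∞ M] [T2Space M]

theorem germ_smul (U : Opens M) (x : M) (a : ℂ⟦X⟧) (f : S.Loc U) :
    germ U x (a • f) = a • germ U x f := by
  by_cases hx : x ∈ U
  · have h : germ U x (a • (1 : S.Loc U)) = a • 1 := by
      rw [← map_one (S.toStalk x), ← toStalk_smul, germ_eq_toStalk_iff hx]
      intro n
      refine Filter.Eventually.of_forall fun y hy => ?_
      rw [HermitianDeformation.Alg.one_smul_coeff, HermitianDeformation.Alg.one_smul_coeff]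
      rfl
    rw [← one_mul f, ← smul_mul_assoc, map_mul, h, smul_mul_assoc, one_mul, one_mul]
  · rw [germ_of_notMem hx, germ_of_notMem hx, smul_zero]

variable {ι κ : Type*}

theorem germ_mulVec [Fintype κ] (U : Opens M) (x : M) (A : Matrix ι κ (S.Loc U))
    (v : κ → S.Loc U) (i : ι) :
    germ U x ((A *ᵥ v) i) = (A.map (germ U x) *ᵥ fun j => germ U x (v j)) i := by
  simp [Matrix.mulVec, dotProduct, map_sum]

theorem map_germ_res {U V : Opens M} (h : V ≤ U) {x : M} (hx : x ∈ V)
    (A : Matrix ι κ (S.Loc U)) : (A.map (res h)).map (germ V x) = A.map (germ U x) := by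
  ext i j
  exact germ_res h hx _

theorem map_germ_of_notMem {U : Opens M} {x : M} (hx : x ∉ U) (A : Matrix ι κ (S.Loc U)) :
    A.map (germ U x) = 0 := by
  ext i j
  exact germ_of_notMem hx _

theorem map_germ_one [DecidableEq ι] {U : Opens M} {x : M} (hx : x ∈ U) :
    (1 : Matrix ι ι (S.Loc U)).map (germ U x) = 1 :=
  Matrix.map_one _ (map_zero _) (germ_one hx)

theorem map_germ_star (U : Opens M) (x : M) (A : Matrix ι κ (S.Loc U)) :
    (Aᴴ).map (germ U x) = (A.map (germ U x))ᴴ :=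
  Matrix.conjTranspose_map _ fun f => germ_star U x f

theorem map_germ_smul (U : Opens M) (x : M) (a : ℂ⟦X⟧) (A : Matrix ι κ (S.Loc U)) :
    (a • A).map (germ U x) = a • A.map (germ U x) := by
  ext i j
  exact germ_smul U x a _

theorem map_germ_sum {σ : Type*} (s : Finset σ) (U : Opens M) (x : M)
    (A : σ → Matrix ι κ (S.Loc U)) :
    (∑ c ∈ s, A c).map (germ U x) = ∑ c ∈ s, (A c).map (germ U x) := by
  ext i j
  simp [Matrix.sum_apply, map_sum]

theorem matrix_loc_ext {U : Opens M} {A B : Matrix ι κ (S.Loc U)}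
    (h : ∀ x ∈ U, A.map (germ U x) = B.map (germ U x)) : A = B := by
  ext1 i j
  exact loc_ext fun x hx => congrFun (congrFun (h x hx) i) j

theorem map_germ_extZero {U V : Opens M} (hVU : V ≤ U) {A : Matrix ι κ (S.Loc V)} {K : Set M}
    (hK : IsClosed K) (hKV : K ∩ U ⊆ V) (hf : ∀ x ∉ K, A.map (germ V x) = 0) (x : M) :
    (A.map (extZero U)).map (germ U x) = A.map (germ V x) := by
  ext i j
  exact germ_extZero hVU hK hKV (fun x hx => congrFun (congrFun (hf x hx) i) j) x

end StarProduct

open StarProduct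

variable {k : ℕ} {E : M → Type*} [∀ x, AddCommGroup (E x)] [∀ x, Module ℂ (E x)]
  [∀ x, TopologicalSpace (E x)] [TopologicalSpace (TotalSpace (Fin k → ℂ) E)]
  [FiberBundle (Fin k → ℂ) E] [VectorBundle ℂ (Fin k → ℂ) E] [VectorBundle ℝ (Fin k → ℂ) E]
  [IsManifold (𝓡 d) ∞ M] [T2Space M] {P : PoissonStructure d M} {S : StarProduct P}
  {m : ℕ} {U : Fin m → Opens M}

namespace DeformedTransition

variable {e : ∀ α, LocalFrame d k E (U α)} (Φ : DeformedTransition S e)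

/-- The germs at `x` of the deformed transition matrices. -/
def phi (x : M) (α β : Fin m) : Matrix (Fin k) (Fin k) (S.Stalk x) :=
  (Φ.Φ α β).map (germ (U α ⊓ U β) x)

theorem phi_of_notMem_left {x : M} {α : Fin m} (β : Fin m) (hx : x ∉ U α) : Φ.phi x α β = 0 :=
  map_germ_of_notMem (fun h : x ∈ U α ⊓ U β => hx h.1) _

theorem phi_of_notMem_right {x : M} (α : Fin m) {β : Fin m} (hx : x ∉ U β) : Φ.phi x α β = 0 :=
  map_germ_of_notMem (fun h : x ∈ U α ⊓ U β => hx h.2) _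

theorem phi_mul_phi_symm {x : M} {α β : Fin m} (hα : x ∈ U α) (hβ : x ∈ U β) :
    Φ.phi x α β * Φ.phi x β α = 1 := by
  have h := congrArg (fun A => A.map (germ (U α ⊓ U β) x)) (Φ.cocycle_two α β)
  have hx : x ∈ U α ⊓ U β := ⟨hα, hβ⟩
  simp only [Matrix.map_mul] at h
  rwa [map_germ_res _ hx, map_germ_one hx] at h

theorem phi_mul_phi {x : M} (α γ : Fin m) {β : Fin m} (hβ : x ∈ U β) :
    Φ.phi x α β * Φ.phi x β γ = Φ.phi x α γ := by
  by_cases hα : x ∈ U α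
  · by_cases hγ : x ∈ U γ
    · have hx : x ∈ U α ⊓ U β ⊓ U γ := ⟨⟨hα, hβ⟩, hγ⟩
      have h := congrArg (fun A => A.map (germ (U α ⊓ U β ⊓ U γ) x)) (Φ.cocycle_three α β γ)
      simp only [Matrix.map_mul] at h
      rw [map_germ_res _ hx, map_germ_res _ hx, map_germ_res _ hx, map_germ_one hx] at h
      change Φ.phi x α β * Φ.phi x β γ * Φ.phi x γ α = 1 at h
      rw [← mul_one (Φ.phi x α β * Φ.phi x β γ), ← Φ.phi_mul_phi_symm hγ hα, ← mul_assoc, h,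
        one_mul]
    · rw [Φ.phi_of_notMem_right β hγ, Φ.phi_of_notMem_right α hγ, mul_zero]
  · rw [Φ.phi_of_notMem_left β hα, Φ.phi_of_notMem_left γ hα, zero_mul]

theorem phi_self {x : M} {α : Fin m} (hα : x ∈ U α) : Φ.phi x α α = 1 := by
  rw [← Φ.phi_mul_phi α α hα, Φ.phi_mul_phi_symm hα hα]

theorem phi_conjTranspose (x : M) (α β : Fin m) : (Φ.phi x α β)ᴴ = Φ.phi x β α := by
  by_cases hx : x ∈ U α ⊓ U β
  · rw [phi, ← map_germ_star, Φ.unitary, map_germ_res _ hx]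
    rfl
  · rw [phi, map_germ_of_notMem hx, phi, map_germ_of_notMem fun h : x ∈ U β ⊓ U α => hx ⟨h.2, h.1⟩,
      Matrix.conjTranspose_zero]

theorem isCompatible_iff (v : ∀ α, Fin k → S.Loc (U α)) :
    Φ.IsCompatible v ↔ ∀ x α β, x ∈ U α → x ∈ U β →
      (Φ.phi x α β *ᵥ fun j => germ (U β) x (v β j)) = fun i => germ (U α) x (v α i) := by
  constructor
  · intro h x α β hα hβ
    funext i
    have hx : x ∈ U α ⊓ U β := ⟨hα, hβ⟩
    have h1 := congrArg (germ (U α ⊓ U β) x) (congrFun (h α β) i)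
    rw [germ_mulVec, germ_res _ hx] at h1
    simpa only [germ_res _ hx, phi] using h1
  · intro h α β
    funext i
    refine loc_ext fun x hx => ?_
    rw [germ_mulVec, germ_res _ hx]
    simpa only [germ_res _ hx, phi] using congrFun (h x α β hx.1 hx.2) i

theorem isCompatibleMatrix_iff (B : ∀ α, Matrix (Fin k) (Fin k) (S.Loc (U α))) :
    Φ.IsCompatibleMatrix B ↔ ∀ x α β, x ∈ U α → x ∈ U β →
      Φ.phi x α β * (B β).map (germ (U β) x) * Φ.phi x β α = (B α).map (germ (U α) x) := by
  constructor
  · intro h x α β hα hβ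
    have hx : x ∈ U α ⊓ U β := ⟨hα, hβ⟩
    have h1 := congrArg (fun A => A.map (germ (U α ⊓ U β) x)) (h α β)
    simp only [Matrix.map_mul] at h1
    rwa [map_germ_res _ hx, map_germ_res _ hx, map_germ_res _ hx] at h1
  · intro h α β
    refine matrix_loc_ext fun x hx => ?_
    simp only [Matrix.map_mul]
    rw [map_germ_res _ hx, map_germ_res _ hx, map_germ_res _ hx]
    exact h x α β hx.1 hx.2

/-- The module of compatible collections of local sections. -/
def compatible : Submodule ℂ⟦X⟧ (∀ α, Fin k → S.Loc (U α)) where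
  carrier := {v | Φ.IsCompatible v}
  add_mem' {v w} hv hw := by
    rw [Set.mem_ofPred, isCompatible_iff] at hv hw ⊢
    intro x α β hα hβ
    have h : (fun j => germ (U β) x ((v + w) β j)) =
        (fun j => germ (U β) x (v β j)) + fun j => germ (U β) x (w β j) :=
      funext fun j => map_add _ _ _
    rw [h, Matrix.mulVec_add, hv x α β hα hβ, hw x α β hα hβ]
    exact funext fun j => (map_add _ _ _).symm
  zero_mem' := by
    rw [Set.mem_ofPred, isCompatible_iff]
    intro x α β hα hβ
    have h : ∀ α, (fun j => germ (U α) x ((0 : ∀ α, Fin k → S.Loc (U α)) α j)) = 0 :=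
      fun α => funext fun j => map_zero _
    rw [h, h, Matrix.mulVec_zero]
  smul_mem' a v hv := by
    rw [Set.mem_ofPred, isCompatible_iff] at hv ⊢
    intro x α β hα hβ
    have h : ∀ α, (fun j => germ (U α) x ((a • v) α j)) = a • fun j => germ (U α) x (v α j) :=
      fun α => funext fun j => germ_smul _ _ _ _
    rw [h, h, Matrix.mulVec_smul, hv x α β hα hβ]

theorem mem_compatible {v : ∀ α, Fin k → S.Loc (U α)} :
    v ∈ Φ.compatible ↔ Φ.IsCompatible v := Iff.rfl

/-- The algebra of compatible collections of local matrices. -/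
def compatibleMatrix : Subalgebra ℂ⟦X⟧ (∀ α, Matrix (Fin k) (Fin k) (S.Loc (U α))) where
  carrier := {B | Φ.IsCompatibleMatrix B}
  add_mem' {A B} hA hB := by
    rw [Set.mem_ofPred, isCompatibleMatrix_iff] at hA hB ⊢
    intro x α β hα hβ
    rw [Pi.add_apply, Pi.add_apply, Matrix.map_add _ (map_add _), Matrix.map_add _ (map_add _),
      mul_add, add_mul, hA x α β hα hβ, hB x α β hα hβ]
  mul_mem' {A B} hA hB := by
    rw [Set.mem_ofPred, isCompatibleMatrix_iff] at hA hB ⊢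
    intro x α β hα hβ
    rw [Pi.mul_apply, Pi.mul_apply, Matrix.map_mul, Matrix.map_mul, ← hA x α β hα hβ,
      ← hB x α β hα hβ]
    simp only [mul_assoc]
    rw [← mul_assoc (Φ.phi x β α) (Φ.phi x α β), Φ.phi_mul_phi_symm hβ hα, one_mul]
  algebraMap_mem' a := by
    rw [Algebra.algebraMap_eq_smul_one, Set.mem_ofPred, isCompatibleMatrix_iff]
    intro x α β hα hβ
    rw [Pi.smul_apply, Pi.smul_apply, Pi.one_apply, Pi.one_apply, map_germ_smul, map_germ_smul,
      map_germ_one hα, map_germ_one hβ, mul_smul_comm, smul_mul_assoc, mul_one,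
      Φ.phi_mul_phi_symm hα hβ]

theorem mem_compatibleMatrix {B : ∀ α, Matrix (Fin k) (Fin k) (S.Loc (U α))} :
    B ∈ Φ.compatibleMatrix ↔ Φ.IsCompatibleMatrix B := Iff.rfl

theorem IsCompatibleMatrix.conjTranspose {B : ∀ α, Matrix (Fin k) (Fin k) (S.Loc (U α))}
    (hB : Φ.IsCompatibleMatrix B) : Φ.IsCompatibleMatrix fun α => (B α)ᴴ := by
  rw [isCompatibleMatrix_iff] at hB ⊢
  intro x α β hα hβ
  rw [map_germ_star, map_germ_star, ← hB x α β hα hβ, Matrix.conjTranspose_mul,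
    Matrix.conjTranspose_mul, Φ.phi_conjTranspose, Φ.phi_conjTranspose, mul_assoc]

instance : StarRing Φ.compatibleMatrix where
  star B := ⟨fun α => (B.1 α)ᴴ, IsCompatibleMatrix.conjTranspose Φ B.2⟩
  star_involutive B := Subtype.ext (funext fun α => Matrix.conjTranspose_conjTranspose _)
  star_mul A B := Subtype.ext (funext fun α => Matrix.conjTranspose_mul _ _)
  star_add A B := Subtype.ext (funext fun α => Matrix.conjTranspose_add _ _)

theorem star_X_smul (B : Φ.compatibleMatrix) :
    star ((PowerSeries.X : ℂ⟦X⟧) • B) = (PowerSeries.X : ℂ⟦X⟧) • star B :=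
  Subtype.ext (funext fun α => Matrix.ext fun i j => HermitianDeformation.Alg.star_X_smul _)

/-- Compatible collections without zeroth order term are divisible by `λ`. -/
theorem exists_eq_X_smul_of_coeff_zero (v : Φ.compatible) (hv : ∀ α i, (v.1 α i).coeff 0 = 0) :
    ∃ w : Φ.compatible, v = (PowerSeries.X : ℂ⟦X⟧) • w := by
  have h : v.1 = (PowerSeries.X : ℂ⟦X⟧) • fun α i => (v.1 α i).shift :=
    funext fun α => funext fun i => (HermitianDeformation.Alg.X_smul_shift (hv α i)).symm
  refine ⟨⟨fun α i => (v.1 α i).shift, ?_⟩, Subtype.ext h⟩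
  have h2 : Φ.IsCompatible v.1 := v.2
  rw [mem_compatible, isCompatible_iff]
  rw [h, isCompatible_iff] at h2
  intro x α β hα hβ
  funext i
  refine stalk_X_smul_injective ?_
  have h3 : ∀ α, (fun j => germ (U α) x (((PowerSeries.X : ℂ⟦X⟧) •
      fun α i => (v.1 α i).shift : ∀ α, Fin k → S.Loc (U α)) α j)) =
      (PowerSeries.X : ℂ⟦X⟧) • fun j => germ (U α) x (v.1 α j).shift :=
    fun α => funext fun j => germ_smul _ _ _ _
  have h4 := h2 x α β hα hβ
  rw [h3, h3, Matrix.mulVec_smul] at h4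
  exact congrFun h4 i

theorem exists_eq_X_smul_of_matrix_coeff_zero (B : Φ.compatibleMatrix)
    (hB : ∀ α i j, (B.1 α i j).coeff 0 = 0) :
    ∃ A : Φ.compatibleMatrix, B = (PowerSeries.X : ℂ⟦X⟧) • A := by
  have h : B.1 = (PowerSeries.X : ℂ⟦X⟧) • fun α => Matrix.of fun i j => (B.1 α i j).shift :=
    funext fun α => Matrix.ext fun i j => (HermitianDeformation.Alg.X_smul_shift (hB α i j)).symm
  refine ⟨⟨fun α => Matrix.of fun i j => (B.1 α i j).shift, ?_⟩, Subtype.ext h⟩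
  have h2 : Φ.IsCompatibleMatrix B.1 := B.2
  rw [mem_compatibleMatrix, isCompatibleMatrix_iff]
  rw [h, isCompatibleMatrix_iff] at h2
  intro x α β hα hβ
  ext i j
  refine stalk_X_smul_injective ?_
  have h4 := h2 x α β hα hβ
  rw [Pi.smul_apply, Pi.smul_apply, map_germ_smul, map_germ_smul, mul_smul_comm,
    smul_mul_assoc] at h4
  exact congrFun (congrFun h4 i) j

theorem compatible_X_smul_eq_zero {v : Φ.compatible} (h : (PowerSeries.X : ℂ⟦X⟧) • v = 0) :
    v = 0 :=
  Subtype.ext (funext fun α => funext fun i => HermitianDeformation.Alg.X_smul_eq_zero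
    (congrFun (congrFun (congrArg Subtype.val h) α) i))

theorem compatible_eq_zero_of_X_pow_dvd {v : Φ.compatible}
    (h : ∀ n : ℕ, ∃ w : Φ.compatible, v = (PowerSeries.X : ℂ⟦X⟧) ^ n • w) : v = 0 :=
  Subtype.ext (funext fun α => funext fun i => HermitianDeformation.Alg.eq_zero_of_X_pow_dvd
    fun n => let ⟨w, hw⟩ := h n
    ⟨w.1 α i, congrFun (congrFun (congrArg Subtype.val hw) α) i⟩)

theorem compatibleMatrix_X_smul_eq_zero {B : Φ.compatibleMatrix}
    (h : (PowerSeries.X : ℂ⟦X⟧) • B = 0) : B = 0 :=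
  Subtype.ext (funext fun α => Matrix.ext fun i j => HermitianDeformation.Alg.X_smul_eq_zero
    (congrFun (congrFun (congrFun (congrArg Subtype.val h) α) i) j))

theorem compatibleMatrix_eq_zero_of_X_pow_dvd {B : Φ.compatibleMatrix}
    (h : ∀ n : ℕ, ∃ A : Φ.compatibleMatrix, B = (PowerSeries.X : ℂ⟦X⟧) ^ n • A) : B = 0 :=
  Subtype.ext (funext fun α => Matrix.ext fun i j =>
    HermitianDeformation.Alg.eq_zero_of_X_pow_dvd fun n => let ⟨A, hA⟩ := h n
    ⟨A.1 α i j, congrFun (congrFun (congrFun (congrArg Subtype.val hA) α) i) j⟩)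

end DeformedTransition

end QuantumSerreSwan

end

noncomputable section

namespace QuantumSerreSwan

theorem FormalSeries.map_add {V W : Type*} [AddCommGroup V] [Module ℂ V] [AddCommGroup W]
    [Module ℂ W] (F : V →ₗ[ℂ] W) (v w : FormalSeries V) : (v + w).map F = v.map F + w.map F := by
  ext n
  simp [FormalSeries.map]

theorem FormalSeries.map_smul {V W : Type*} [AddCommGroup V] [Module ℂ V] [AddCommGroup W]
    [Module ℂ W] (F : V →ₗ[ℂ] W) (a : ℂ⟦X⟧) (v : FormalSeries V) :
    (a • v).map F = a • v.map F := by
  ext n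
  simp [FormalSeries.map, FormalSeries.coeff_smul]

variable {d : ℕ} {M : Type*} [TopologicalSpace M] [ChartedSpace (EuclideanSpace ℝ (Fin d)) M]

open StarProduct

variable {k : ℕ} {E : M → Type*} [∀ x, AddCommGroup (E x)] [∀ x, Module ℂ (E x)]
  [∀ x, TopologicalSpace (E x)] [TopologicalSpace (TotalSpace (Fin k → ℂ) E)]
  [FiberBundle (Fin k → ℂ) E] [VectorBundle ℂ (Fin k → ℂ) E] [VectorBundle ℝ (Fin k → ℂ) E]

theorem SmoothOn.of_locally {s : ∀ x, E x} {W : Set M}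
    (h : ∀ x ∈ W, ∃ V : Set M, IsOpen V ∧ x ∈ V ∧ SmoothOn d k s (W ∩ V)) : SmoothOn d k s W :=
  contMDiffOn_of_locally_contMDiffOn h

namespace LocalFrame

/-- The restriction of a local frame. -/
def mono {V W : Opens M} (h : W ≤ V) (e : LocalFrame d k E V) : LocalFrame d k E W where
  vec := e.vec
  smooth i := ContMDiffOn.mono (e.smooth i) h
  linearIndependent x hx := e.linearIndependent x (h hx)
  span x hx := e.span x (h hx)

variable {V : Opens M} (e : LocalFrame d k E V)

/-- The coordinates of the vectors of a fiber in a local frame. -/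
def coord {x : M} (hx : x ∈ V) : E x ≃ₗ[ℂ] (Fin k → ℂ) := (e.basis ⟨x, hx⟩).equivFun

theorem sum_coord {x : M} (hx : x ∈ V) (v : E x) : ∑ i, e.coord hx v i • e.vec i x = v := by
  refine (Finset.sum_congr rfl fun i _ => ?_).trans ((e.basis ⟨x, hx⟩).sum_equivFun v)
  rw [basis, Module.Basis.mk_apply]
  rfl

theorem coord_sum {x : M} (hx : x ∈ V) (c : Fin k → ℂ) :
    e.coord hx (∑ i, c i • e.vec i x) = c := by
  rw [← (e.coord hx).apply_symm_apply c]
  congr 1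
  conv_rhs => rw [← e.sum_coord hx ((e.coord hx).symm c)]

theorem coord_vec {x : M} (hx : x ∈ V) (i : Fin k) :
    e.coord hx (e.vec i x) = Pi.single i 1 := by
  rw [← e.coord_sum hx (Pi.single i 1)]
  simp [Pi.single_apply]

theorem coord_mono {W : Opens M} (h : W ≤ V) {x : M} (hx : x ∈ W) (v : E x) :
    (e.mono h).coord hx v = e.coord (h hx) v := by
  rw [← (e.mono h).coord_sum hx (e.coord (h hx) v)]
  exact congrArg _ (e.sum_coord (h hx) v).symm

variable [IsManifold (𝓡 d) ∞ M] [T2Space M]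

/-- Sections with smooth coefficients in a smooth frame are smooth. -/
theorem smoothOn_of_coord {s : ∀ x, E x} (f : Fin k → CInf d V)
    (h : ∀ x (hx : x ∈ V) i, e.coord hx (s x) i = f i ⟨x, hx⟩) : SmoothOn d k s V := by
  classical
  let G : Fin k → M → ℂ := fun i x => if hx : x ∈ V then f i ⟨x, hx⟩ else 0
  have hG : ∀ i, ContMDiffOn (𝓡 d) 𝓘(ℝ, ℂ) ∞ (G i) V := by
    intro i x hx
    refine ContMDiffAt.contMDiffWithinAt ((contMDiffAt_open_iff (x := ⟨x, hx⟩)).1 ?_)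
    have h2 : (fun z : V => G i z) = f i := by funext z; simp [G]
    rw [h2]
    exact (f i).contMDiff.contMDiffAt
  have hsum : SmoothOn d k (fun x => ∑ i, G i x • e.vec i x) V :=
    ContMDiffOn.sum_section fun i _ => SmoothOn.smul (hG i) (e.smooth i)
  refine ContMDiffOn.congr hsum fun x hx => ?_
  rw [← e.sum_coord hx (s x)]
  simp only [h, G, dif_pos (show x ∈ V from hx)]

/-- The coefficients of a section in a smooth frame, as linear maps. -/
def coeffLinear (i : Fin k) : Sec d k E →ₗ[ℂ] CInf d V where
  toFun s := e.coeff s s.contMDiff.contMDiffOn i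
  map_add' s t := by
    ext x
    exact congrFun (map_add (e.coord x.2) (s x) (t x)) i
  map_smul' c s := by
    ext x
    exact congrFun (map_smul (e.coord x.2) c (s x)) i

/-- The coefficients of an endomorphism field in a smooth frame, as linear maps. -/
def matrixLinear (i j : Fin k) : EndSec d k E →ₗ[ℂ] CInf d V where
  toFun A := e.coeff (fun x => A.1 x (e.vec j x)) (A.2 V (e.vec j) (e.smooth j)) i
  map_add' A B := by
    ext x
    exact congrFun (map_add (e.coord x.2) (A.1 x (e.vec j x)) (B.1 x (e.vec j x))) i
  map_smul' c A := by
    ext x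
    exact congrFun (map_smul (e.coord x.2) c (A.1 x (e.vec j x))) i

/-- The matrix of an endomorphism field at a point. -/
def matrixAt (A : EndSec d k E) {x : M} (hx : x ∈ V) : Matrix (Fin k) (Fin k) ℂ :=
  Matrix.of fun i j => e.coord hx (A.1 x (e.vec j x)) i

theorem coord_end (A : EndSec d k E) {x : M} (hx : x ∈ V) (v : E x) :
    e.coord hx (A.1 x v) = e.matrixAt A hx *ᵥ e.coord hx v := by
  conv_lhs => rw [← e.sum_coord hx v]
  funext i
  simp [Matrix.mulVec, dotProduct, matrixAt, mul_comm]

variable {P : PoissonStructure d M} {S : StarProduct P}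

theorem coeffs_add (s t : FormalSeries (Sec d k E)) (i : Fin k) :
    (e.coeffs (s + t) i : S.Loc V) = e.coeffs s i + e.coeffs t i :=
  HermitianDeformation.Alg.ext
    (congrArg FormalSeries.coeff (FormalSeries.map_add (e.coeffLinear i) s t))

theorem coeffs_smul (a : ℂ⟦X⟧) (s : FormalSeries (Sec d k E)) (i : Fin k) :
    (e.coeffs (a • s) i : S.Loc V) = a • e.coeffs s i :=
  HermitianDeformation.Alg.ext
    (congrArg FormalSeries.coeff (FormalSeries.map_smul (e.coeffLinear i) a s))

theorem matrix_add (A B : FormalSeries (EndSec d k E)) :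
    (e.matrix (A + B) : Matrix _ _ (S.Loc V)) = e.matrix A + e.matrix B :=
  Matrix.ext fun i j => HermitianDeformation.Alg.ext
    (congrArg FormalSeries.coeff (FormalSeries.map_add (e.matrixLinear i j) A B))

theorem matrix_smul (a : ℂ⟦X⟧) (A : FormalSeries (EndSec d k E)) :
    (e.matrix (a • A) : Matrix _ _ (S.Loc V)) = a • e.matrix A :=
  Matrix.ext fun i j => HermitianDeformation.Alg.ext
    (congrArg FormalSeries.coeff (FormalSeries.map_smul (e.matrixLinear i j) a A))

theorem coeffs_coeff (s : FormalSeries (Sec d k E)) (i : Fin k) (n : ℕ) {x : M} (hx : x ∈ V) :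
    (e.coeffs s i : S.Loc V).coeff n ⟨x, hx⟩ = e.coord hx (s.coeff n x) i := rfl

theorem matrix_coeff (A : FormalSeries (EndSec d k E)) (i j : Fin k) (n : ℕ) {x : M}
    (hx : x ∈ V) :
    (e.matrix A i j : S.Loc V).coeff n ⟨x, hx⟩ = e.matrixAt (A.coeff n) hx i j := rfl

end LocalFrame

theorem tsupport_complexify (f : C^∞⟮𝓡 d, M; 𝓘(ℝ), ℝ⟯) :
    tsupport (complexify f) = tsupport f :=
  congrArg closure (Set.ext fun x => not_congr Complex.ofReal_eq_zero)

variable [IsManifold (𝓡 d) ∞ M] [T2Space M] {P : PoissonStructure d M} {S : StarProduct P}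
  {m : ℕ} {U : Fin m → Opens M}

namespace DeformedTransition

variable {e : ∀ α, LocalFrame d k E (U α)} (Φ : DeformedTransition S e)

/-- The classical transition matrices. -/
def phiZero (x : M) (α β : Fin m) : Matrix (Fin k) (Fin k) ℂ :=
  (Φ.phi x α β).map (Stalk.eval S x)

theorem phiZero_mul (x : M) (α γ : Fin m) {β : Fin m} (hβ : x ∈ U β) :
    Φ.phiZero x α β * Φ.phiZero x β γ = Φ.phiZero x α γ := by
  rw [phiZero, phiZero, ← Matrix.map_mul, Φ.phi_mul_phi α γ hβ]
  rfl

theorem phiZero_self {x : M} {α : Fin m} (hα : x ∈ U α) : Φ.phiZero x α α = 1 := by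
  rw [phiZero, Φ.phi_self hα, Matrix.map_one _ (map_zero _) (map_one _)]

theorem phiZero_conjTranspose (x : M) (α β : Fin m) : (Φ.phiZero x α β)ᴴ = Φ.phiZero x β α := by
  rw [phiZero, phiZero, ← Φ.phi_conjTranspose x α β]
  exact (Matrix.conjTranspose_map _ fun a => Stalk.eval_star a).symm

theorem coord_eq {x : M} {α β : Fin m} (hα : x ∈ U α) (hβ : x ∈ U β) (v : E x) :
    (e α).coord hα v = Φ.phiZero x α β *ᵥ (e β).coord hβ v := by
  conv_lhs => rw [← (e β).sum_coord hβ v]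
  have h : ∀ j, (e α).coord hα ((e β).vec j x) = fun i => Φ.phiZero x α β i j := by
    intro j
    rw [Φ.classical_limit α β x ⟨hα, hβ⟩ j, LocalFrame.coord_sum]
    funext i
    exact (eval_germ (S := S) (U := U α ⊓ U β) ⟨hα, hβ⟩ _).symm
  funext i
  simp [Matrix.mulVec, dotProduct, h, mul_comm]

/-- The change of frame for endomorphisms. -/
theorem matrixAt_eq (A : EndSec d k E) {x : M} {α β : Fin m} (hα : x ∈ U α) (hβ : x ∈ U β) :
    (e α).matrixAt A hα = Φ.phiZero x α β * (e β).matrixAt A hβ * Φ.phiZero x β α := by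
  ext i j
  have h := (e α).coord_end A hα ((e α).vec j x)
  rw [Φ.coord_eq hα hβ, (e β).coord_end, Φ.coord_eq hβ hα, (e α).coord_vec,
    Matrix.mulVec_mulVec, Matrix.mulVec_mulVec] at h
  simpa using (congrFun h i).symm

/-- Smooth sections are glued from compatible local coefficient functions. -/
theorem exists_sec (hU : ∀ x, ∃ α, x ∈ U α) (f : ∀ α, Fin k → CInf d (U α))
    (hf : ∀ x α β (hα : x ∈ U α) (hβ : x ∈ U β),
      (Φ.phiZero x α β *ᵥ fun j => f β j ⟨x, hβ⟩) = fun i => f α i ⟨x, hα⟩) :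
    ∃ s : Sec d k E, ∀ α x (hx : x ∈ U α) i, (e α).coord hx (s x) i = f α i ⟨x, hx⟩ := by
  choose a ha using hU
  let s : ∀ x, E x := fun x => ((e (a x)).coord (ha x)).symm fun i => f (a x) i ⟨x, ha x⟩
  have hs : ∀ α x (hx : x ∈ U α) i, (e α).coord hx (s x) i = f α i ⟨x, hx⟩ := by
    intro α x hx i
    rw [Φ.coord_eq hx (ha x), LinearEquiv.apply_symm_apply, hf x α (a x) hx (ha x)]
  have hsm : SmoothOn d k s Set.univ := SmoothOn.of_locally fun x _ =>
    ⟨U (a x), (U (a x)).isOpen, ha x, ContMDiffOn.mono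
      ((e (a x)).smoothOn_of_coord (f (a x)) (hs (a x))) Set.inter_subset_right⟩
  exact ⟨⟨s, contMDiffOn_univ.1 hsm⟩, hs⟩

/-- Smooth endomorphism fields are glued from compatible local matrices. -/
theorem exists_endSec (hU : ∀ x, ∃ α, x ∈ U α) (f : ∀ α, Matrix (Fin k) (Fin k) (CInf d (U α)))
    (hf : ∀ x α β (hα : x ∈ U α) (hβ : x ∈ U β),
      Φ.phiZero x α β * (f β).map (fun g => g ⟨x, hβ⟩) * Φ.phiZero x β α =
        (f α).map fun g => g ⟨x, hα⟩) :
    ∃ A : EndSec d k E, ∀ α x (hx : x ∈ U α),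
      (e α).matrixAt A hx = (f α).map fun g => g ⟨x, hx⟩ := by
  choose a ha using hU
  let A : ∀ x, Module.End ℂ (E x) := fun x =>
    ((e (a x)).coord (ha x)).symm.toLinearMap ∘ₗ
      ((f (a x)).map fun g => g ⟨x, ha x⟩).mulVecLin ∘ₗ ((e (a x)).coord (ha x)).toLinearMap
  have hA : ∀ α x (hx : x ∈ U α) (v : E x),
      (e α).coord hx (A x v) = ((f α).map fun g => g ⟨x, hx⟩) *ᵥ (e α).coord hx v := by
    intro α x hx v
    rw [Φ.coord_eq hx (ha x)]
    have : (e (a x)).coord (ha x) (A x v) =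
        ((f (a x)).map fun g => g ⟨x, ha x⟩) *ᵥ (e (a x)).coord (ha x) v :=
      LinearEquiv.apply_symm_apply _ _
    rw [this, Φ.coord_eq (ha x) hx, Matrix.mulVec_mulVec, Matrix.mulVec_mulVec,
      ← hf x α (a x) hx (ha x)]
  refine ⟨⟨A, fun W s hs => SmoothOn.of_locally fun x hx =>
    ⟨U (a x), (U (a x)).isOpen, ha x, ?_⟩⟩, fun α x hx => ?_⟩
  · let V : Opens M := W ⊓ U (a x)
    have hV : V ≤ U (a x) := inf_le_right
    have hsV : SmoothOn d k s V := ContMDiffOn.mono hs Set.inter_subset_left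
    let e' := (e (a x)).mono hV
    refine e'.smoothOn_of_coord (V := V)
      (fun i => ∑ j, QuantumSerreSwan.restrict hV (f (a x) i j) * e'.coeff s hsV j) ?_
    intro y hy i
    rw [LocalFrame.coord_mono, hA, StarProduct.sum_apply, Matrix.mulVec, dotProduct]
    refine Finset.sum_congr rfl fun j _ => ?_
    rw [← (e (a x)).coord_mono hV hy]
    rfl
  · ext i j
    have := congrFun (hA α x hx ((e α).vec j x)) i
    rw [(e α).coord_vec] at this
    exact this.trans (by simp)

/-- The Hermitian fiber metric for which the frames are orthonormal. -/
theorem exists_metric (Φ : DeformedTransition S e) (hU : ∀ x, ∃ α, x ∈ U α) :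
    ∃ h₀ : HermitianMetric d k E, ∀ α x (hx : x ∈ U α) (v w : E x),
      h₀.inner x v w = star ((e α).coord hx v) ⬝ᵥ (e α).coord hx w := by
  choose a ha using hU
  let h : ∀ x, E x →ₗ⋆[ℂ] E x →ₗ[ℂ] ℂ := fun x =>
    LinearMap.mk₂'ₛₗ (starRingEnd ℂ) (RingHom.id ℂ)
      (fun v w => star ((e (a x)).coord (ha x) v) ⬝ᵥ (e (a x)).coord (ha x) w)
      (fun v v' w => by simp [add_dotProduct])
      (fun c v w => by simp [smul_dotProduct])
      (fun v w w' => by simp [dotProduct_add])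
      (fun c v w => by simp [dotProduct_smul])
  have key : ∀ α x (hx : x ∈ U α) (v w : E x),
      h x v w = star ((e α).coord hx v) ⬝ᵥ (e α).coord hx w := by
    intro α x hx v w
    change star ((e (a x)).coord (ha x) v) ⬝ᵥ (e (a x)).coord (ha x) w = _
    rw [Φ.coord_eq hx (ha x) v, Φ.coord_eq hx (ha x) w, Matrix.star_mulVec,
      ← Matrix.dotProduct_mulVec, Matrix.mulVec_mulVec, Φ.phiZero_conjTranspose,
      Φ.phiZero_mul x _ _ hx, Φ.phiZero_self (ha x), Matrix.one_mulVec]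
  refine ⟨⟨h, fun x v w => ?_, fun x v hv => ?_, fun W s t hs ht x hx => ?_⟩, key⟩
  · rw [key (a x) x (ha x), key (a x) x (ha x), ← Matrix.star_dotProduct_star, star_star]
  · rw [key (a x) x (ha x)]
    have hv' : (e (a x)).coord (ha x) v ≠ 0 := by simpa using hv
    simp only [dotProduct, Pi.star_apply, Complex.re_sum]
    obtain ⟨i, hi⟩ := Function.ne_iff.1 hv'
    have h1 : ∀ z : ℂ, (star z * z).re = Complex.normSq z := fun z => by
      rw [Complex.star_def, ← Complex.normSq_eq_conj_mul_self, Complex.ofReal_re]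
    simp only [h1]
    exact Finset.sum_pos' (fun i _ => Complex.normSq_nonneg _)
      ⟨i, Finset.mem_univ i, Complex.normSq_pos.2 hi⟩
  · let V : Opens M := W ⊓ U (a x)
    have hV : V ≤ U (a x) := inf_le_right
    have hsV : SmoothOn d k s V := ContMDiffOn.mono hs Set.inter_subset_left
    have htV : SmoothOn d k t V := ContMDiffOn.mono ht Set.inter_subset_left
    let e' := (e (a x)).mono hV
    refine ContMDiffAt.contMDiffWithinAt
      ((contMDiffAt_open_iff (U := V) (x := ⟨x, hx, ha x⟩)).1 ?_)
    have h2 : (fun y : V => h y (s y) (t y)) =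
        (∑ i, star (e'.coeff s hsV i) * e'.coeff t htV i : CInf d V) := by
      funext y
      rw [key (a x) y (hV y.2), StarProduct.sum_apply]
      refine Finset.sum_congr rfl fun i _ => ?_
      rw [← (e (a x)).coord_mono hV y.2, ← (e (a x)).coord_mono hV y.2]
      rfl
    rw [h2]
    exact (ContMDiffMap.contMDiff _).contMDiffAt

/-- The adjoint of an endomorphism field. -/
theorem exists_adjoint (Φ : DeformedTransition S e) (hU : ∀ x, ∃ α, x ∈ U α) (A : EndSec d k E) :
    ∃ B : EndSec d k E, ∀ α x (hx : x ∈ U α),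
      (e α).matrixAt B hx = ((e α).matrixAt A hx)ᴴ := by
  refine Φ.exists_endSec hU (fun α => Matrix.of fun i j => star ((e α).matrixLinear j i A)) ?_
  intro x α β hα hβ
  have h := congrArg Matrix.conjTranspose (Φ.matrixAt_eq A hα hβ)
  rw [Matrix.conjTranspose_mul, Matrix.conjTranspose_mul, Φ.phiZero_conjTranspose,
    Φ.phiZero_conjTranspose, ← mul_assoc] at h
  exact h.symm

/-! ### The quantum module -/

section Lift

variable {χ : SmoothPartitionOfUnity (Fin m) (𝓡 d) M}

theorem germ_lift (hχ : χ.IsSubordinate fun α => (U α : Set M)) (s : FormalSeries (Sec d k E))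
    (α : Fin m) (x : M) :
    (fun i => germ (U α) x (Φ.lift χ s α i)) = ∑ β, Φ.phi x α β *ᵥ fun j =>
      S.toStalk x (HermitianDeformation.Alg.const (complexify (χ β))) *
        germ (U β) x ((e β).coeffs s j) := by
  funext i
  rw [lift, map_sum, Finset.sum_apply]
  refine Finset.sum_congr rfl fun β _ => ?_
  have h : ∀ x, germ (U α ⊓ U β) x ((Φ.Φ α β).mulVec (fun j => toLoc (U α ⊓ U β)
      (HermitianDeformation.Alg.const (complexify (χ β))) *
      res inf_le_right ((e β).coeffs s j)) i) = (Φ.phi x α β *ᵥ fun j =>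
      S.toStalk x (HermitianDeformation.Alg.const (complexify (χ β))) *
        germ (U β) x ((e β).coeffs s j)) i := by
    intro x
    by_cases hx : x ∈ U α ⊓ U β
    · rw [germ_mulVec]
      simp only [map_mul, germ_toLoc hx, germ_res _ hx]
      rfl
    · rw [germ_of_notMem hx, phi, map_germ_of_notMem hx, Matrix.zero_mulVec]
      rfl
  rw [germ_extZero inf_le_left (isClosed_tsupport (complexify (χ β))) _ _ x, h]
  · rw [tsupport_complexify]
    exact fun y hy => ⟨hy.2, hχ β hy.1⟩
  · intro y hy
    rw [h, toStalk_const_eq_zero hy]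
    simp [Matrix.mulVec, dotProduct]

theorem isCompatible_lift (hχ : χ.IsSubordinate fun α => (U α : Set M))
    (s : FormalSeries (Sec d k E)) : Φ.IsCompatible (Φ.lift χ s) := by
  rw [isCompatible_iff]
  intro x α β hα hβ
  rw [Φ.germ_lift hχ, Φ.germ_lift hχ, Matrix.mulVec_sum]
  simp only [Matrix.mulVec_mulVec, Φ.phi_mul_phi α _ hβ]

theorem lift_ext {v w : ∀ α, Fin k → S.Loc (U α)}
    (h : ∀ α x, (fun i => germ (U α) x (v α i)) = fun i => germ (U α) x (w α i)) : v = w :=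
  funext fun α => funext fun i => loc_ext fun x _ => congrFun (h α x) i

theorem lift_add (hχ : χ.IsSubordinate fun α => (U α : Set M)) (s t : FormalSeries (Sec d k E)) :
    Φ.lift χ (s + t) = Φ.lift χ s + Φ.lift χ t := by
  refine lift_ext fun α x => ?_
  have h : (fun i => germ (U α) x ((Φ.lift χ s + Φ.lift χ t) α i)) =
      (fun i => germ (U α) x (Φ.lift χ s α i)) + fun i => germ (U α) x (Φ.lift χ t α i) :=
    funext fun i => map_add _ _ _
  rw [h, Φ.germ_lift hχ, Φ.germ_lift hχ, Φ.germ_lift hχ, ← Finset.sum_add_distrib]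
  refine Finset.sum_congr rfl fun β _ => ?_
  rw [← Matrix.mulVec_add]
  congr 1
  funext j
  rw [Pi.add_apply, LocalFrame.coeffs_add, map_add, mul_add]

theorem lift_smul (hχ : χ.IsSubordinate fun α => (U α : Set M)) (a : ℂ⟦X⟧)
    (s : FormalSeries (Sec d k E)) : Φ.lift χ (a • s) = a • Φ.lift χ s := by
  refine lift_ext fun α x => ?_
  have h : (fun i => germ (U α) x ((a • Φ.lift χ s) α i)) =
      a • (fun i => germ (U α) x (Φ.lift χ s α i)) :=
    funext fun i => germ_smul _ _ _ _
  rw [h, Φ.germ_lift hχ, Φ.germ_lift hχ, Finset.smul_sum]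
  refine Finset.sum_congr rfl fun β _ => ?_
  rw [← Matrix.mulVec_smul]
  congr 1
  funext j
  rw [Pi.smul_apply, LocalFrame.coeffs_smul, germ_smul, mul_smul_comm]

theorem sum_complexify (χ : SmoothPartitionOfUnity (Fin m) (𝓡 d) M) (x : M) :
    ∑ β, complexify (χ β) x = 1 := by
  have h := χ.sum_eq_one (Set.mem_univ x)
  rw [finsum_eq_sum_of_fintype] at h
  have h2 := congrArg (fun r : ℝ => (r : ℂ)) h
  push_cast at h2
  exact h2

theorem lift_coeff_zero (hχ : χ.IsSubordinate fun α => (U α : Set M))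
    (s : FormalSeries (Sec d k E)) (α : Fin m) (i : Fin k) :
    (Φ.lift χ s α i).coeff 0 = ((e α).coeffs s i : S.Loc (U α)).coeff 0 := by
  ext ⟨x, hx⟩
  rw [← eval_germ hx, ← eval_germ hx]
  have h := congrArg (Stalk.eval S x) (congrFun (Φ.germ_lift hχ s α x) i)
  refine h.trans ?_
  rw [Finset.sum_apply, map_sum, eval_germ hx, LocalFrame.coeffs_coeff,
    ← one_mul ((e α).coord hx _ i), ← sum_complexify χ x, Finset.sum_mul]
  refine Finset.sum_congr rfl fun β _ => ?_
  rw [RingHom.map_mulVec]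
  have h2 : (⇑(Stalk.eval S x) ∘ fun j =>
      S.toStalk x (HermitianDeformation.Alg.const (complexify (χ β))) *
        germ (U β) x ((e β).coeffs s j)) = complexify (χ β) x •
        fun j => Stalk.eval S x (germ (U β) x ((e β).coeffs s j)) :=
    funext fun j => by
      rw [Function.comp_apply, map_mul, eval_toStalk_const]
      rfl
  rw [h2, Matrix.mulVec_smul, Pi.smul_apply, smul_eq_mul]
  by_cases hβ : x ∈ U β
  · rw [Φ.coord_eq hx hβ]
    congr 2
    funext j
    rw [eval_germ hβ]
    rfl
  · have h3 : x ∉ tsupport (complexify (χ β)) := fun h' =>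
      hβ (hχ β (by rwa [← tsupport_complexify]))
    rw [image_eq_zero_of_notMem_tsupport h3, zero_mul, zero_mul]

/-- The map `s ↦ (𝐬_α)`. -/
def liftLinear (hχ : χ.IsSubordinate fun α => (U α : Set M)) :
    FormalSeries (Sec d k E) →ₗ[ℂ⟦X⟧] Φ.compatible where
  toFun s := ⟨Φ.lift χ s, Φ.isCompatible_lift hχ s⟩
  map_add' s t := Subtype.ext (Φ.lift_add hχ s t)
  map_smul' a s := Subtype.ext (Φ.lift_smul hχ a s)

theorem phiZero_mulVec_of_isCompatible {v : ∀ α, Fin k → S.Loc (U α)} (hv : Φ.IsCompatible v)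
    {x : M} {α β : Fin m} (hα : x ∈ U α) (hβ : x ∈ U β) :
    (Φ.phiZero x α β *ᵥ fun j => (v β j).coeff 0 ⟨x, hβ⟩) =
      fun i => (v α i).coeff 0 ⟨x, hα⟩ := by
  rw [isCompatible_iff] at hv
  funext i
  have h := congrArg (Stalk.eval S x) (congrFun (hv x α β hα hβ) i)
  rw [RingHom.map_mulVec, eval_germ hα] at h
  rw [← h]
  congr 1
  exact funext fun j => (eval_germ hβ _).symm

theorem bijective_liftLinear (hU : ∀ x, ∃ α, x ∈ U α)
    (hχ : χ.IsSubordinate fun α => (U α : Set M)) : Function.Bijective (Φ.liftLinear hχ) := by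
  refine FormalSeries.bijective_of_leading _ (fun w => Φ.compatible_X_smul_eq_zero)
    (fun w => Φ.compatible_eq_zero_of_X_pow_dvd) (fun w => ?_) (fun v w' h => ?_)
  · obtain ⟨s, hs⟩ := Φ.exists_sec hU (fun α i => (w.1 α i).coeff 0)
      fun x α β hα hβ => Φ.phiZero_mulVec_of_isCompatible w.2 hα hβ
    obtain ⟨w', hw'⟩ := Φ.exists_eq_X_smul_of_coeff_zero
      (w - Φ.liftLinear hχ (FormalSeries.const s)) fun α i => by
        change (w.1 α i - Φ.lift χ (FormalSeries.const s) α i).coeff 0 = 0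
        rw [sub_eq_add_neg, HermitianDeformation.Alg.coeff_add,
          HermitianDeformation.Alg.coeff_neg, Φ.lift_coeff_zero hχ, ← sub_eq_add_neg, sub_eq_zero]
        ext ⟨x, hx⟩
        rw [LocalFrame.coeffs_coeff]
        exact (hs α x hx i).symm
    exact ⟨s, w', by rw [← hw']; abel⟩
  · ext x
    obtain ⟨α, hα⟩ := hU x
    refine ((e α).coord hα).injective ?_
    rw [ContMDiffSection.coe_zero, Pi.zero_apply, map_zero]
    funext i
    have h1 : Φ.lift χ (FormalSeries.const v) α i = (PowerSeries.X : ℂ⟦X⟧) • w'.1 α i :=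
      congrFun (congrFun (congrArg Subtype.val h) α) i
    have h2 := Φ.lift_coeff_zero hχ (FormalSeries.const v) α i
    rw [h1, HermitianDeformation.Alg.coeff_zero_X_smul] at h2
    exact congrArg (fun f : CInf d (U α) => f ⟨x, hα⟩) h2.symm

/-- The bijection `s ↦ (𝐬_α)` between formal sections and compatible collections. -/
def liftEquiv (hU : ∀ x, ∃ α, x ∈ U α) (hχ : χ.IsSubordinate fun α => (U α : Set M)) :
    FormalSeries (Sec d k E) ≃ₗ[ℂ⟦X⟧] Φ.compatible :=
  LinearEquiv.ofBijective (Φ.liftLinear hχ) (Φ.bijective_liftLinear hU hχ)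

end Lift

end DeformedTransition

end QuantumSerreSwan

end

noncomputable section

namespace QuantumSerreSwan

variable {d : ℕ} {M : Type*} [TopologicalSpace M] [ChartedSpace (EuclideanSpace ℝ (Fin d)) M]

open StarProduct

variable {k : ℕ} {E : M → Type*} [∀ x, AddCommGroup (E x)] [∀ x, Module ℂ (E x)]
  [∀ x, TopologicalSpace (E x)] [TopologicalSpace (TotalSpace (Fin k → ℂ) E)]
  [FiberBundle (Fin k → ℂ) E] [VectorBundle ℂ (Fin k → ℂ) E] [VectorBundle ℝ (Fin k → ℂ) E]
  [IsManifold (𝓡 d) ∞ M] [T2Space M] {P : PoissonStructure d M} {S : StarProduct P}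
  {m : ℕ} {U : Fin m → Opens M}

theorem LocalFrame.map_germ_matrix_eq_zero {V : Opens M} (e : LocalFrame d k E V)
    {A : FormalSeries (EndSec d k E)} {x : M} (hA : ∀ n, ∀ᶠ y in 𝓝 x, (A.coeff n).1 y = 0) :
    (e.matrix A : Matrix _ _ (S.Loc V)).map (germ V x) = 0 := by
  by_cases hx : x ∈ V
  · ext i j
    refine (germ_eq_zero_iff hx).2 fun n => ?_
    filter_upwards [hA n] with y h1 hy
    rw [LocalFrame.matrix_coeff]
    change e.coord hy ((A.coeff n).1 y (e.vec j y)) i = 0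
    rw [h1, LinearMap.zero_apply, map_zero]
    rfl
  · exact map_germ_of_notMem hx _

theorem LocalFrame.matrixAt_one {V : Opens M} (e : LocalFrame d k E V) {x : M} (hx : x ∈ V) :
    e.matrixAt (1 : EndSec d k E) hx = 1 := by
  ext i j
  change e.coord hx (e.vec j x) i = _
  rw [e.coord_vec, Matrix.one_eq_pi_single, Pi.single_comm]

theorem LocalFrame.matrixAt_scalar {V : Opens M} (e : LocalFrame d k E V) (f : CInf d M) {x : M}
    (hx : x ∈ V) : e.matrixAt (EndSec.scalar f : EndSec d k E) hx = f x • 1 := by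
  ext i j
  change e.coord hx (f x • e.vec j x) i = _
  rw [map_smul, e.coord_vec, Matrix.smul_apply, Matrix.one_eq_pi_single, Pi.single_comm]
  rfl

theorem LocalFrame.matrixAt_zero {V : Opens M} (e : LocalFrame d k E V) {x : M} (hx : x ∈ V) :
    e.matrixAt (0 : EndSec d k E) hx = 0 := by
  ext i j
  exact congrFun (map_zero (e.coord hx)) i

namespace DeformedTransition

variable {e : ∀ α, LocalFrame d k E (U α)} (Φ : DeformedTransition S e)

theorem endSec_ext (e : ∀ α, LocalFrame d k E (U α)) (hU : ∀ x, ∃ α, x ∈ U α) {A B : EndSec d k E}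
    (h : ∀ α x (hx : x ∈ U α), (e α).matrixAt A hx = (e α).matrixAt B hx) : A = B := by
  refine Subtype.ext (funext fun x => LinearMap.ext fun v => ?_)
  obtain ⟨α, hα⟩ := hU x
  refine ((e α).coord hα).injective ?_
  rw [LocalFrame.coord_end, LocalFrame.coord_end, h]

section Ttilde

variable (ρ : QuadraticPartition d U)

theorem map_germ_Ttilde (A : FormalSeries (EndSec d k E)) (α : Fin m) (x : M) :
    (Φ.Ttilde ρ.toFun A α).map (germ (U α) x) = ∑ γ, Φ.phi x α γ *
      Matrix.scalar (Fin k) (star (S.toStalk x (HermitianDeformation.Alg.const (ρ.toFun γ)))) *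
      ((e γ).matrix A).map (germ (U γ) x) *
      Matrix.scalar (Fin k) (S.toStalk x (HermitianDeformation.Alg.const (ρ.toFun γ))) *
      Φ.phi x γ α := by
  rw [Ttilde, map_germ_sum]
  refine Finset.sum_congr rfl fun γ _ => ?_
  have h : ∀ x, (Φ.Φ α γ * Matrix.scalar (Fin k) (toLoc (U α ⊓ U γ)
      (HermitianDeformation.Alg.const (star (ρ.toFun γ)))) *
      ((e γ).matrix A).map (res inf_le_right) *
      Matrix.scalar (Fin k) (toLoc (U α ⊓ U γ) (HermitianDeformation.Alg.const (ρ.toFun γ))) *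
      (Φ.Φ γ α).map (res (le_inf inf_le_right inf_le_left))).map (germ (U α ⊓ U γ) x) =
      Φ.phi x α γ *
      Matrix.scalar (Fin k) (star (S.toStalk x (HermitianDeformation.Alg.const (ρ.toFun γ)))) *
      ((e γ).matrix A).map (germ (U γ) x) *
      Matrix.scalar (Fin k) (S.toStalk x (HermitianDeformation.Alg.const (ρ.toFun γ))) *
      Φ.phi x γ α := by
    intro x
    by_cases hx : x ∈ U α ⊓ U γ
    · simp only [Matrix.map_mul]
      rw [map_germ_res _ hx, map_germ_res _ hx, Matrix.scalar_apply, Matrix.scalar_apply,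
        Matrix.diagonal_map (map_zero _), Matrix.diagonal_map (map_zero _), Matrix.scalar_apply,
        Matrix.scalar_apply, ← toStalk_star, star_alg_const]
      simp only [germ_toLoc hx]
      rfl
    · rw [map_germ_of_notMem hx, phi, map_germ_of_notMem hx]
      simp only [zero_mul]
  rw [map_germ_extZero inf_le_left (isClosed_tsupport (ρ.toFun γ)) _ _ x, h]
  · exact fun y hy => ⟨hy.2, ρ.subordinate γ hy.1⟩
  · intro y hy
    rw [h, toStalk_const_eq_zero hy]
    simp

theorem isCompatibleMatrix_Ttilde (A : FormalSeries (EndSec d k E)) :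
    Φ.IsCompatibleMatrix (Φ.Ttilde ρ.toFun A) := by
  rw [isCompatibleMatrix_iff]
  intro x α β hα hβ
  rw [Φ.map_germ_Ttilde, Φ.map_germ_Ttilde, Finset.mul_sum, Finset.sum_mul]
  refine Finset.sum_congr rfl fun γ _ => ?_
  rw [← Φ.phi_mul_phi α γ hβ, ← Φ.phi_mul_phi γ α hβ]
  simp only [mul_assoc]

theorem Ttilde_add (A B : FormalSeries (EndSec d k E)) :
    Φ.Ttilde ρ.toFun (A + B) = Φ.Ttilde ρ.toFun A + Φ.Ttilde ρ.toFun B := by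
  funext α
  refine matrix_loc_ext fun x _ => ?_
  rw [Pi.add_apply, Matrix.map_add _ (map_add _), Φ.map_germ_Ttilde, Φ.map_germ_Ttilde,
    Φ.map_germ_Ttilde, ← Finset.sum_add_distrib]
  refine Finset.sum_congr rfl fun γ _ => ?_
  rw [LocalFrame.matrix_add, Matrix.map_add _ (map_add _)]
  simp only [mul_add, add_mul]

theorem Ttilde_smul (a : ℂ⟦X⟧) (A : FormalSeries (EndSec d k E)) :
    Φ.Ttilde ρ.toFun (a • A) = a • Φ.Ttilde ρ.toFun A := by
  funext α
  refine matrix_loc_ext fun x _ => ?_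
  rw [Pi.smul_apply, map_germ_smul, Φ.map_germ_Ttilde, Φ.map_germ_Ttilde, Finset.smul_sum]
  refine Finset.sum_congr rfl fun γ _ => ?_
  rw [LocalFrame.matrix_smul, map_germ_smul]
  simp only [mul_smul_comm, smul_mul_assoc]

theorem map_eval_germ {V : Opens M} {x : M} (hx : x ∈ V) (A : Matrix (Fin k) (Fin k) (S.Loc V))
    (i j : Fin k) : (A.map (germ V x)).map (Stalk.eval S x) i j = (A i j).coeff 0 ⟨x, hx⟩ :=
  eval_germ hx _

theorem Ttilde_coeff_zero (A : FormalSeries (EndSec d k E)) (α : Fin m) (i j : Fin k) :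
    (Φ.Ttilde ρ.toFun A α i j).coeff 0 = ((e α).matrix A i j : S.Loc (U α)).coeff 0 := by
  ext ⟨x, hx⟩
  rw [← map_eval_germ hx, Φ.map_germ_Ttilde, LocalFrame.matrix_coeff]
  have hone : ∑ γ, star (ρ.toFun γ x) * ρ.toFun γ x = 1 := by
    have := congrArg (fun f : CInf d M => f x) ρ.sum_eq_one
    rw [StarProduct.sum_apply] at this
    exact this
  have key : ∀ γ, (Φ.phi x α γ *
      Matrix.scalar (Fin k) (star (S.toStalk x (HermitianDeformation.Alg.const (ρ.toFun γ)))) *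
      ((e γ).matrix A).map (germ (U γ) x) *
      Matrix.scalar (Fin k) (S.toStalk x (HermitianDeformation.Alg.const (ρ.toFun γ))) *
      Φ.phi x γ α).map (Stalk.eval S x) =
      (star (ρ.toFun γ x) * ρ.toFun γ x) • (e α).matrixAt (A.coeff 0) hx := by
    intro γ
    by_cases hγ : x ∈ U γ
    · have h1 : ((((e γ).matrix A).map (germ (U γ) x)).map (Stalk.eval S x) :
          Matrix (Fin k) (Fin k) ℂ) = (e γ).matrixAt (A.coeff 0) hγ := by
        ext i j
        rw [map_eval_germ hγ, LocalFrame.matrix_coeff]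
      have h2 : ∀ c : S.Stalk x, (Matrix.scalar (Fin k) c).map (Stalk.eval S x) =
          Stalk.eval S x c • (1 : Matrix (Fin k) (Fin k) ℂ) := by
        intro c
        rw [Matrix.scalar_apply, Matrix.diagonal_map (map_zero _), Matrix.smul_one_eq_diagonal]
      simp only [Matrix.map_mul, h1, h2, Stalk.eval_star, eval_toStalk_const]
      rw [Φ.matrixAt_eq (A.coeff 0) hx hγ]
      simp only [mul_smul_comm, smul_mul_assoc, mul_one, smul_smul]
      rw [mul_comm (ρ.toFun γ x)]
      rfl
    · have h3 : x ∉ tsupport (ρ.toFun γ) := fun h => hγ (ρ.subordinate γ h)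
      rw [Φ.phi_of_notMem_right α hγ, image_eq_zero_of_notMem_tsupport h3]
      simp only [zero_mul, mul_zero, zero_smul]
      exact Matrix.map_zero _ (map_zero _)
  have hsum : (∑ γ, Φ.phi x α γ *
      Matrix.scalar (Fin k) (star (S.toStalk x (HermitianDeformation.Alg.const (ρ.toFun γ)))) *
      ((e γ).matrix A).map (germ (U γ) x) *
      Matrix.scalar (Fin k) (S.toStalk x (HermitianDeformation.Alg.const (ρ.toFun γ))) *
      Φ.phi x γ α).map (Stalk.eval S x) = (e α).matrixAt (A.coeff 0) hx := by
    have h4 := map_sum (Stalk.eval S x).mapMatrix (fun γ => Φ.phi x α γ *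
      Matrix.scalar (Fin k) (star (S.toStalk x (HermitianDeformation.Alg.const (ρ.toFun γ)))) *
      ((e γ).matrix A).map (germ (U γ) x) *
      Matrix.scalar (Fin k) (S.toStalk x (HermitianDeformation.Alg.const (ρ.toFun γ))) *
      Φ.phi x γ α) Finset.univ
    simp only [RingHom.mapMatrix_apply, key] at h4
    rw [h4, ← Finset.sum_smul, hone, one_smul]
  rw [hsum]

/-- The map `A ↦ (T̃_α(A))`. -/
def tauLinear : FormalSeries (EndSec d k E) →ₗ[ℂ⟦X⟧] Φ.compatibleMatrix where
  toFun A := ⟨Φ.Ttilde ρ.toFun A, Φ.isCompatibleMatrix_Ttilde ρ A⟩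
  map_add' A B := Subtype.ext (Φ.Ttilde_add ρ A B)
  map_smul' a A := Subtype.ext (Φ.Ttilde_smul ρ a A)

theorem phiZero_mul_of_isCompatibleMatrix {B : ∀ α, Matrix (Fin k) (Fin k) (S.Loc (U α))}
    (hB : Φ.IsCompatibleMatrix B) {x : M} {α β : Fin m} (hα : x ∈ U α) (hβ : x ∈ U β) :
    Φ.phiZero x α β * (Matrix.of fun i j => (B β i j).coeff 0 ⟨x, hβ⟩) * Φ.phiZero x β α =
      Matrix.of fun i j => (B α i j).coeff 0 ⟨x, hα⟩ := by
  rw [isCompatibleMatrix_iff] at hB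
  have h := congrArg (fun A => A.map (Stalk.eval S x)) (hB x α β hα hβ)
  simp only [Matrix.map_mul] at h
  have h1 : ∀ γ (hγ : x ∈ U γ), ((B γ).map (germ (U γ) x)).map (Stalk.eval S x) =
      Matrix.of fun i j => (B γ i j).coeff 0 ⟨x, hγ⟩ :=
    fun γ hγ => Matrix.ext fun i j => map_eval_germ hγ _ i j
  rwa [h1 α hα, h1 β hβ] at h

theorem bijective_tauLinear (hU : ∀ x, ∃ α, x ∈ U α) : Function.Bijective (Φ.tauLinear ρ) := by
  refine FormalSeries.bijective_of_leading _ (fun w => Φ.compatibleMatrix_X_smul_eq_zero)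
    (fun w => Φ.compatibleMatrix_eq_zero_of_X_pow_dvd) (fun w => ?_) (fun A w' h => ?_)
  · obtain ⟨A, hA⟩ := Φ.exists_endSec hU (fun α => Matrix.of fun i j => (w.1 α i j).coeff 0)
      fun x α β hα hβ => Φ.phiZero_mul_of_isCompatibleMatrix w.2 hα hβ
    obtain ⟨w', hw'⟩ := Φ.exists_eq_X_smul_of_matrix_coeff_zero
      (w - Φ.tauLinear ρ (FormalSeries.const A)) fun α i j => by
        change (w.1 α i j - Φ.Ttilde ρ.toFun (FormalSeries.const A) α i j).coeff 0 = 0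
        rw [sub_eq_add_neg, HermitianDeformation.Alg.coeff_add,
          HermitianDeformation.Alg.coeff_neg, Φ.Ttilde_coeff_zero, ← sub_eq_add_neg, sub_eq_zero]
        ext ⟨x, hx⟩
        rw [LocalFrame.matrix_coeff]
        exact (congrFun (congrFun (hA α x hx) i) j).symm
    exact ⟨A, w', by rw [← hw']; abel⟩
  · refine endSec_ext e hU fun α x hα => ?_
    rw [LocalFrame.matrixAt_zero]
    ext i j
    have h1 : Φ.Ttilde ρ.toFun (FormalSeries.const A) α i j =
        (PowerSeries.X : ℂ⟦X⟧) • w'.1 α i j :=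
      congrFun (congrFun (congrFun (congrArg Subtype.val h) α) i) j
    have h2 := Φ.Ttilde_coeff_zero ρ (FormalSeries.const A) α i j
    rw [h1, HermitianDeformation.Alg.coeff_zero_X_smul] at h2
    exact congrArg (fun f : CInf d (U α) => f ⟨x, hα⟩) h2.symm

/-- The bijection `A ↦ (T̃_α(A))` between formal endomorphism fields and compatible collections of
matrices. -/
def tau (hU : ∀ x, ∃ α, x ∈ U α) :
    FormalSeries (EndSec d k E) ≃ₗ[ℂ⟦X⟧] Φ.compatibleMatrix :=
  LinearEquiv.ofBijective (Φ.tauLinear ρ) (Φ.bijective_tauLinear ρ hU)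

theorem tau_apply (hU : ∀ x, ∃ α, x ∈ U α) (A : FormalSeries (EndSec d k E)) (α : Fin m) :
    (Φ.tau ρ hU A).1 α = Φ.Ttilde ρ.toFun A α := rfl

theorem tau_map_adjoint (hU : ∀ x, ∃ α, x ∈ U α) (adj : EndSec d k E → EndSec d k E)
    (hadj : ∀ A α x (hx : x ∈ U α), (e α).matrixAt (adj A) hx = ((e α).matrixAt A hx)ᴴ)
    (A : FormalSeries (EndSec d k E)) : Φ.tau ρ hU (A.map adj) = star (Φ.tau ρ hU A) := by
  refine Subtype.ext (funext fun α => ?_)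
  change Φ.Ttilde ρ.toFun (A.map adj) α = (Φ.Ttilde ρ.toFun A α)ᴴ
  refine matrix_loc_ext fun x _ => ?_
  have hmat : ∀ γ, ((e γ).matrix (A.map adj) : Matrix _ _ (S.Loc (U γ))) = ((e γ).matrix A)ᴴ := by
    intro γ
    ext1 i j
    refine HermitianDeformation.Alg.ext_coeff fun n => ?_
    ext ⟨y, hy⟩
    exact congrFun (congrFun (hadj (A.coeff n) γ y hy) i) j
  have hscal : ∀ c : S.Stalk x, (Matrix.scalar (Fin k) c)ᴴ = Matrix.scalar (Fin k) (star c) := by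
    intro c
    rw [Matrix.scalar_apply, Matrix.scalar_apply, Matrix.diagonal_conjTranspose]
    rfl
  rw [map_germ_star, Φ.map_germ_Ttilde, Φ.map_germ_Ttilde, Matrix.conjTranspose_sum]
  refine Finset.sum_congr rfl fun γ _ => ?_
  rw [hmat, map_germ_star]
  simp only [Matrix.conjTranspose_mul, Φ.phi_conjTranspose, hscal, star_star, mul_assoc]

theorem map_germ_Ttilde_eq_zero {A : FormalSeries (EndSec d k E)} {x : M}
    (hA : ∀ n, ∀ᶠ y in 𝓝 x, (A.coeff n).1 y = 0) (α : Fin m) :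
    (Φ.Ttilde ρ.toFun A α).map (germ (U α) x) = 0 := by
  rw [Φ.map_germ_Ttilde]
  refine Finset.sum_eq_zero fun γ _ => ?_
  rw [LocalFrame.map_germ_matrix_eq_zero _ hA]
  simp

/-- The inverse of `T̃` is local. -/
theorem eq_zero_of_map_germ_Ttilde_eq_zero (hU : ∀ x, ∃ α, x ∈ U α) {O : Set M} (hO : IsOpen O)
    (A : FormalSeries (EndSec d k E))
    (hA : ∀ x ∈ O, ∀ α, (Φ.Ttilde ρ.toFun A α).map (germ (U α) x) = 0) (n : ℕ) :
    ∀ x ∈ O, (A.coeff n).1 x = 0 := by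
  have h0 : ∀ A : FormalSeries (EndSec d k E),
      (∀ x ∈ O, ∀ α, (Φ.Ttilde ρ.toFun A α).map (germ (U α) x) = 0) →
      ∀ x ∈ O, (A.coeff 0).1 x = 0 := by
    intro A hA x hx
    obtain ⟨α, hα⟩ := hU x
    refine LinearMap.ext fun v => ((e α).coord hα).injective ?_
    have h1 : (e α).matrixAt (A.coeff 0) hα = 0 := by
      ext i j
      rw [← LocalFrame.matrix_coeff (S := S), ← Φ.Ttilde_coeff_zero ρ, ← map_eval_germ hα,
        hA x hx α]
      exact map_zero (Stalk.eval S x)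
    rw [LocalFrame.coord_end, h1, Matrix.zero_mulVec, LinearMap.zero_apply, map_zero]
  induction n generalizing A with
  | zero => exact h0 A hA
  | succ n ih =>
    refine ih A.shift fun x hx α => ?_
    have h1 := hA x hx α
    rw [FormalSeries.eq_const_add_X_smul A, Φ.Ttilde_add, Φ.Ttilde_smul, Pi.add_apply,
      Pi.smul_apply, Matrix.map_add _ (map_add _), map_germ_smul,
      Φ.map_germ_Ttilde_eq_zero ρ (A := FormalSeries.const (A.coeff 0)), zero_add] at h1
    · ext i j
      exact stalk_X_smul_eq_zero (congrFun (congrFun h1 i) j)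
    · intro r
      filter_upwards [hO.mem_nhds hx] with y hy
      by_cases hr : r = 0
      · subst hr
        exact h0 A hA y hy
      · simp [FormalSeries.const, hr]

/-- The classical limit of compatible collections of matrices. -/
def compatibleMatrixZero (α : Fin m) :
    Φ.compatibleMatrix →+* Matrix (Fin k) (Fin k) (CInf d (U α)) :=
  (HermitianDeformation.Alg.coeffZero (S.restrict (U α))).mapMatrix.comp
    ((Pi.evalRingHom _ α).comp Φ.compatibleMatrix.val.toRingHom)

theorem compatibleMatrixZero_X_smul (α : Fin m) (B : Φ.compatibleMatrix) :
    Φ.compatibleMatrixZero α ((PowerSeries.X : ℂ⟦X⟧) • B) = 0 :=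
  Matrix.ext fun i j => HermitianDeformation.Alg.coeff_zero_X_smul (B.1 α i j)

theorem exists_eq_one_add_X_smul (B : Φ.compatibleMatrix)
    (hB : ∀ α, Φ.compatibleMatrixZero α B = 1) :
    ∃ r, B = 1 + (PowerSeries.X : ℂ⟦X⟧) • r := by
  obtain ⟨r, hr⟩ := Φ.exists_eq_X_smul_of_matrix_coeff_zero (B - 1) fun α i j => by
    have : Φ.compatibleMatrixZero α (B - 1) = 0 := by rw [map_sub, hB, map_one, sub_self]
    exact congrFun (congrFun this i) j
  exact ⟨r, by rw [← hr]; abel⟩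

theorem compatibleMatrixZero_tau (hU : ∀ x, ∃ α, x ∈ U α) (A : FormalSeries (EndSec d k E))
    (α : Fin m) (f : CInf d M)
    (hA : ∀ x (hx : x ∈ U α), (e α).matrixAt (A.coeff 0) hx = f x • 1) :
    Φ.compatibleMatrixZero α (Φ.tau ρ hU A) = Matrix.scalar (Fin k) (toOpen (U α) f) := by
  ext1 i j
  refine (Φ.Ttilde_coeff_zero ρ A α i j).trans ?_
  ext ⟨x, hx⟩
  rw [LocalFrame.matrix_coeff, hA, Matrix.scalar_apply, Matrix.smul_apply]
  by_cases hij : i = j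
  · subst hij
    rw [Matrix.one_apply_eq, Matrix.diagonal_apply_eq, smul_eq_mul, mul_one]
    rfl
  · simp [hij]

end Ttilde

section Existence

set_option maxHeartbeats 2000000 in
theorem exists_endDeformation (ρ : QuadraticPartition d U) (hU : ∀ x, ∃ α, x ∈ U α)
    (h₀ : HermitianMetric d k E)
    (hh₀ : ∀ α x (hx : x ∈ U α) (v w : E x),
      h₀.inner x v w = star ((e α).coord hx v) ⬝ᵥ (e α).coord hx w) :
    Nonempty (Φ.EndDeformation h₀ ρ.toFun) := by
  choose adj hadj using Φ.exists_adjoint hU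
  let τ := Φ.tau ρ hU
  have hτadj : ∀ A, τ (A.map adj) = star (τ A) := Φ.tau_map_adjoint ρ hU adj hadj
  have hadj_one : adj 1 = 1 := endSec_ext e hU fun α x hx => by
    rw [hadj, LocalFrame.matrixAt_one, Matrix.conjTranspose_one]
  have hadj_zero : adj 0 = 0 := endSec_ext e hU fun α x hx => by
    rw [hadj, LocalFrame.matrixAt_zero, Matrix.conjTranspose_zero]
  have hconst : ∀ A, (FormalSeries.const A).map adj = FormalSeries.const (adj A) := by
    intro A
    ext1
    funext n
    by_cases hn : n = 0 <;> simp [FormalSeries.map, FormalSeries.const, hn, hadj_zero]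
  have hadj_scalar : ∀ f : CInf d M,
      adj (EndSec.scalar f) = EndSec.scalar (star f) := fun f => endSec_ext e hU fun α x hx => by
    rw [hadj, LocalFrame.matrixAt_scalar, LocalFrame.matrixAt_scalar,
      Matrix.conjTranspose_smul, Matrix.conjTranspose_one]
    rfl
  have hτstar : ∀ B, star B = B → (τ.symm B).map adj = τ.symm B := fun B hB =>
    τ.injective (by rw [hτadj, LinearEquiv.apply_symm_apply, hB])
  -- the square root of the image of the identity
  obtain ⟨r, hr⟩ := Φ.exists_eq_one_add_X_smul (τ (FormalSeries.const 1)) fun α => by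
    refine (Φ.compatibleMatrixZero_tau ρ hU _ α 1 fun x hx => ?_).trans (map_one _)
    exact ((e α).matrixAt_one hx).trans (one_smul _ _).symm
  have hone : star (τ (FormalSeries.const 1)) = τ (FormalSeries.const 1) := by
    rw [← hτadj, hconst, hadj_one]
  obtain ⟨w, hw, hww⟩ := FormalSeries.exists_sqrt_one_add τ Φ.star_X_smul r (by rw [← hr, hone])
  obtain ⟨z, hwz, hzw⟩ := FormalSeries.exists_inverse_one_add τ w
  rw [← hr] at hww
  set W := 1 + (PowerSeries.X : ℂ⟦X⟧) • w
  set Z := 1 + (PowerSeries.X : ℂ⟦X⟧) • z with hZ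
  have hZs : star Z = Z := by
    refine left_inv_eq_right_inv (a := W) ?_ hwz
    calc star Z * W = star Z * star W := by rw [hw]
      _ = 1 := by rw [← star_mul, hwz, star_one]
  have hZ0 : ∀ α, Φ.compatibleMatrixZero α Z = 1 := fun α => by
    rw [hZ, map_add, map_one, Φ.compatibleMatrixZero_X_smul, add_zero]
  let τ' : FormalSeries (EndSec d k E) → Φ.compatibleMatrix := fun A => Z * τ A * Z
  let prime : FormalSeries (EndSec d k E) → FormalSeries (EndSec d k E) →
    FormalSeries (EndSec d k E) := fun A B => τ.symm (W * (τ' A * τ' B) * W)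
  have hτ' : ∀ B, τ' (τ.symm (W * B * W)) = B := fun B => by
    change Z * τ (τ.symm (W * B * W)) * Z = B
    rw [LinearEquiv.apply_symm_apply,
      show Z * (W * B * W) * Z = (Z * W) * B * (W * Z) by simp only [mul_assoc], hzw, hwz,
      one_mul, mul_one]
  have hW1 : τ.symm (W * 1 * W) = FormalSeries.const 1 := by
    rw [mul_one, hww, LinearEquiv.symm_apply_apply]
  -- the square root of the sum of squares
  let H : Φ.compatibleMatrix := ∑ α, τ' (FormalSeries.const (EndSec.scalar (star (ρ.toFun α)))) *
    τ' (FormalSeries.const (EndSec.scalar (ρ.toFun α)))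
  have hH0 : ∀ β, Φ.compatibleMatrixZero β H = 1 := by
    intro β
    have h1 : ∀ f : CInf d M, Φ.compatibleMatrixZero β
        (τ' (FormalSeries.const (EndSec.scalar f))) =
          Matrix.scalar (Fin k) (toOpen (U β) f) := by
      intro f
      rw [map_mul, map_mul, hZ0, one_mul, mul_one]
      exact Φ.compatibleMatrixZero_tau ρ hU _ β f fun x hx => (e β).matrixAt_scalar f hx
    rw [map_sum]
    simp only [map_mul, h1]
    simp only [← map_mul, ← map_sum]
    rw [← map_one (Matrix.scalar (Fin k))]
    congr 1
    ext x
    rw [StarProduct.sum_apply]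
    have := congrArg (fun f : CInf d M => f x) ρ.sum_eq_one
    rw [StarProduct.sum_apply] at this
    exact this
  have hHs : star H = H := by
    rw [star_sum]
    refine Finset.sum_congr rfl fun α _ => ?_
    have h1 : ∀ f : CInf d M, star (τ' (FormalSeries.const (EndSec.scalar f))) =
        τ' (FormalSeries.const (EndSec.scalar (star f))) := by
      intro f
      rw [star_mul, star_mul, hZs, ← hτadj, hconst, hadj_scalar, ← mul_assoc]
    rw [star_mul, h1, h1, star_star]
  obtain ⟨q, hq⟩ := Φ.exists_eq_one_add_X_smul H hH0
  obtain ⟨y, hy, hyy⟩ := FormalSeries.exists_sqrt_one_add τ Φ.star_X_smul q (by rw [← hq, hHs])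
  obtain ⟨y', hyy', hy'y⟩ := FormalSeries.exists_inverse_one_add τ y
  rw [← hq] at hyy
  set Y := 1 + (PowerSeries.X : ℂ⟦X⟧) • y
  set Y' := 1 + (PowerSeries.X : ℂ⟦X⟧) • y'
  exact ⟨{
    adjoint := adj
    adjoint_spec := fun A x v w => by
      obtain ⟨α, hα⟩ := hU x
      rw [hh₀ α x hα, hh₀ α x hα, LocalFrame.coord_end, LocalFrame.coord_end, hadj,
        Matrix.star_mulVec, ← Matrix.dotProduct_mulVec]
    tilde := fun A B => τ.symm (τ A * τ B)
    tilde_spec := fun A B α =>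
      congrFun (congrArg Subtype.val (τ.apply_symm_apply (τ A * τ B))) α
    unit := τ.symm 1
    unit_spec := fun α => congrFun (congrArg Subtype.val (τ.apply_symm_apply 1)) α
    U := τ.symm Z
    Uinv := τ.symm W
    U_Uinv := by simp only [LinearEquiv.apply_symm_apply, hzw]
    Uinv_U := by simp only [LinearEquiv.apply_symm_apply, hwz]
    U_spec := by
      rw [hτstar W hw, LinearEquiv.apply_symm_apply, hww, LinearEquiv.symm_apply_apply]
    prime := prime
    prime_spec := fun A B => by
      simp only [hτstar W hw, LinearEquiv.apply_symm_apply, prime, hτ']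
    V := τ.symm (W * Y * W)
    Vinv := τ.symm (W * Y' * W)
    V_Vinv := by simp only [prime, hτ', hyy', hW1]
    Vinv_V := by simp only [prime, hτ', hy'y, hW1]
    V_spec := by
      rw [hτstar (W * Y * W) (by rw [star_mul, star_mul, hw, hy, mul_assoc])]
      simp only [prime, hτ', hyy, ← map_sum, H, Finset.mul_sum, Finset.sum_mul] }⟩

end Existence

namespace EndDeformation

variable {Φ} {h₀ : HermitianMetric d k E} {ρ : QuadraticPartition d U}
  (D : Φ.EndDeformation h₀ ρ.toFun)

theorem matrixAt_adjoint
    (hh₀ : ∀ α x (hx : x ∈ U α) (v w : E x),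
      h₀.inner x v w = star ((e α).coord hx v) ⬝ᵥ (e α).coord hx w)
    (A : EndSec d k E) (α : Fin m) (x : M) (hx : x ∈ U α) :
    (e α).matrixAt (D.adjoint A) hx = ((e α).matrixAt A hx)ᴴ := by
  ext i j
  have h := D.adjoint_spec A x ((e α).vec i x) ((e α).vec j x)
  rw [hh₀ α x hx, hh₀ α x hx, LocalFrame.coord_end, LocalFrame.coord_end, LocalFrame.coord_vec,
    LocalFrame.coord_vec] at h
  simpa [← Pi.single_star] using h.symm

variable (hU : ∀ x, ∃ α, x ∈ U α)

theorem tau_tilde (A B : FormalSeries (EndSec d k E)) :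
    Φ.tau ρ hU (D.tilde A B) = Φ.tau ρ hU A * Φ.tau ρ hU B :=
  Subtype.ext (funext fun α => D.tilde_spec A B α)

theorem tau_unit : Φ.tau ρ hU D.unit = 1 := Subtype.ext (funext fun α => D.unit_spec α)

theorem tau_U_mul_Uinv : Φ.tau ρ hU D.U * Φ.tau ρ hU D.Uinv = 1 := by
  rw [← D.tau_tilde, D.U_Uinv, D.tau_unit]

theorem tau_Uinv_mul_U : Φ.tau ρ hU D.Uinv * Φ.tau ρ hU D.U = 1 := by
  rw [← D.tau_tilde, D.Uinv_U, D.tau_unit]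

/-- The collection `(T_α(A))`. -/
def Tmat (A : FormalSeries (EndSec d k E)) : Φ.compatibleMatrix :=
  Φ.tau ρ hU (D.U.map D.adjoint) * Φ.tau ρ hU A * Φ.tau ρ hU D.U

theorem Tmat_apply (A : FormalSeries (EndSec d k E)) (α : Fin m) :
    (D.Tmat hU A).1 α = D.T A α := rfl

theorem Tmat_sum {ι : Type*} (s : Finset ι) (A : ι → FormalSeries (EndSec d k E)) :
    D.Tmat hU (∑ i ∈ s, A i) = ∑ i ∈ s, D.Tmat hU (A i) := by
  simp only [Tmat, map_sum, Finset.mul_sum, Finset.sum_mul]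

theorem tau_adjoint
    (hh₀ : ∀ α x (hx : x ∈ U α) (v w : E x),
      h₀.inner x v w = star ((e α).coord hx v) ⬝ᵥ (e α).coord hx w)
    (A : FormalSeries (EndSec d k E)) :
    Φ.tau ρ hU (A.map D.adjoint) = star (Φ.tau ρ hU A) :=
  Φ.tau_map_adjoint ρ hU D.adjoint (D.matrixAt_adjoint hh₀) A

theorem tau_eq
    (hh₀ : ∀ α x (hx : x ∈ U α) (v w : E x),
      h₀.inner x v w = star ((e α).coord hx v) ⬝ᵥ (e α).coord hx w)
    (A : FormalSeries (EndSec d k E)) : Φ.tau ρ hU A =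
      star (Φ.tau ρ hU D.Uinv) * D.Tmat hU A * Φ.tau ρ hU D.Uinv := by
  rw [Tmat, D.tau_adjoint hU hh₀]
  simp only [mul_assoc, D.tau_U_mul_Uinv hU, mul_one]
  rw [← mul_assoc, ← star_mul, D.tau_U_mul_Uinv hU, star_one, one_mul]

theorem Tmat_adjoint
    (hh₀ : ∀ α x (hx : x ∈ U α) (v w : E x),
      h₀.inner x v w = star ((e α).coord hx v) ⬝ᵥ (e α).coord hx w)
    (A : FormalSeries (EndSec d k E)) :
    D.Tmat hU (A.map D.adjoint) = star (D.Tmat hU A) := by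
  simp only [Tmat, D.tau_adjoint hU hh₀, star_mul, star_star, mul_assoc]

theorem Tmat_one
    (hh₀ : ∀ α x (hx : x ∈ U α) (v w : E x),
      h₀.inner x v w = star ((e α).coord hx v) ⬝ᵥ (e α).coord hx w) :
    D.Tmat hU (FormalSeries.const 1) = 1 := by
  rw [← D.U_spec, Tmat, D.tau_tilde, D.tau_adjoint hU hh₀, D.tau_adjoint hU hh₀]
  simp only [mul_assoc, D.tau_Uinv_mul_U hU, mul_one]
  rw [← star_mul, D.tau_Uinv_mul_U hU, star_one]

theorem Tmat_injective
    (hh₀ : ∀ α x (hx : x ∈ U α) (v w : E x),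
      h₀.inner x v w = star ((e α).coord hx v) ⬝ᵥ (e α).coord hx w) :
    Function.Injective (D.Tmat hU) := fun A B h =>
  (Φ.tau ρ hU).injective (by rw [D.tau_eq hU hh₀ A, D.tau_eq hU hh₀ B, h])

theorem Tmat_prime
    (hh₀ : ∀ α x (hx : x ∈ U α) (v w : E x),
      h₀.inner x v w = star ((e α).coord hx v) ⬝ᵥ (e α).coord hx w)
    (A B : FormalSeries (EndSec d k E)) :
    D.Tmat hU (D.prime A B) = D.Tmat hU A * D.Tmat hU B := by
  let τ := Φ.tau ρ hU
  have h1 : ∀ C, D.tilde (D.tilde (D.Uinv.map D.adjoint) C) D.Uinv =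
      τ.symm (star (τ D.Uinv) * τ C * τ D.Uinv) := fun C => by
    rw [LinearEquiv.eq_symm_apply, D.tau_tilde, D.tau_tilde, D.tau_adjoint hU hh₀]
  have h2 : ∀ C, D.tilde (D.tilde (D.Uinv.map D.adjoint) (τ.symm (D.Tmat hU C))) D.Uinv = C :=
    fun C => by
      rw [h1, LinearEquiv.symm_apply_eq, LinearEquiv.apply_symm_apply]
      exact (D.tau_eq hU hh₀ C).symm
  have h3 := D.prime_spec (τ.symm (D.Tmat hU A)) (τ.symm (D.Tmat hU B))
  rw [h2, h2, h1] at h3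
  rw [← h3, Tmat, D.tau_adjoint hU hh₀]
  change star (τ D.U) * τ (τ.symm (star (τ D.Uinv) * τ (D.tilde _ _) * τ D.Uinv)) * τ D.U = _
  rw [LinearEquiv.apply_symm_apply]
  change _ * (_ * Φ.tau ρ hU (D.tilde _ _) * _) * _ = _
  rw [D.tau_tilde]
  change _ * (_ * (τ (τ.symm _) * τ (τ.symm _)) * _) * _ = _
  rw [LinearEquiv.apply_symm_apply, LinearEquiv.apply_symm_apply]
  have h4 : τ D.Uinv * τ D.U = 1 := D.tau_Uinv_mul_U hU
  have h5 : star (τ D.U) * star (τ D.Uinv) = 1 := by rw [← star_mul, h4, star_one]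
  rw [show ∀ a b c d f : Φ.compatibleMatrix, a * (b * c * d) * f = (a * b) * c * (d * f) from
    fun a b c d f => by simp only [mul_assoc], h4, h5, one_mul, mul_one]

theorem Tmat_chi
    (hh₀ : ∀ α x (hx : x ∈ U α) (v w : E x),
      h₀.inner x v w = star ((e α).coord hx v) ⬝ᵥ (e α).coord hx w) (α : Fin m) :
    D.Tmat hU (D.chi α) = D.Tmat hU (FormalSeries.const (EndSec.scalar (ρ.toFun α))) *
      D.Tmat hU D.Vinv := D.Tmat_prime hU hh₀ _ _

theorem sum_star_Tmat_chi_mul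
    (hh₀ : ∀ α x (hx : x ∈ U α) (v w : E x),
      h₀.inner x v w = star ((e α).coord hx v) ⬝ᵥ (e α).coord hx w) :
    ∑ α, star (D.Tmat hU (D.chi α)) * D.Tmat hU (D.chi α) = 1 := by
  have hadj : ∀ f : CInf d M, (FormalSeries.const (EndSec.scalar f)).map D.adjoint =
      FormalSeries.const (EndSec.scalar (star f)) := by
    intro f
    have h0 : D.adjoint 0 = 0 := endSec_ext e hU fun α x hx => by
      rw [D.matrixAt_adjoint hh₀, LocalFrame.matrixAt_zero, Matrix.conjTranspose_zero]
    have h1 : D.adjoint (EndSec.scalar f) = EndSec.scalar (star f) :=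
      endSec_ext e hU fun α x hx => by
        rw [D.matrixAt_adjoint hh₀, LocalFrame.matrixAt_scalar, LocalFrame.matrixAt_scalar,
          Matrix.conjTranspose_smul, Matrix.conjTranspose_one]
        rfl
    ext1
    funext n
    by_cases hn : n = 0 <;> simp [FormalSeries.map, FormalSeries.const, hn, h0, h1]
  have hV : ∑ α, star (D.Tmat hU (FormalSeries.const (EndSec.scalar (ρ.toFun α)))) *
      D.Tmat hU (FormalSeries.const (EndSec.scalar (ρ.toFun α))) =
      star (D.Tmat hU D.V) * D.Tmat hU D.V := by
    rw [← D.Tmat_adjoint hU hh₀, ← D.Tmat_prime hU hh₀, ← D.V_spec, D.Tmat_sum]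
    refine Finset.sum_congr rfl fun α _ => ?_
    rw [D.Tmat_prime hU hh₀, ← D.Tmat_adjoint hU hh₀, hadj]
  have hVV : D.Tmat hU D.V * D.Tmat hU D.Vinv = 1 := by
    rw [← D.Tmat_prime hU hh₀, D.V_Vinv, D.Tmat_one hU hh₀]
  have h2 : ∀ α, star (D.Tmat hU (D.chi α)) * D.Tmat hU (D.chi α) =
      star (D.Tmat hU D.Vinv) *
      (star (D.Tmat hU (FormalSeries.const (EndSec.scalar (ρ.toFun α)))) *
      D.Tmat hU (FormalSeries.const (EndSec.scalar (ρ.toFun α)))) * D.Tmat hU D.Vinv := fun α => by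
    rw [D.Tmat_chi hU hh₀, star_mul]
    simp only [mul_assoc]
  simp only [h2]
  rw [← Finset.sum_mul, ← Finset.mul_sum, hV, ← mul_assoc, ← star_mul, hVV, star_one, one_mul, hVV]

theorem sum_prime_chi
    (hh₀ : ∀ α x (hx : x ∈ U α) (v w : E x),
      h₀.inner x v w = star ((e α).coord hx v) ⬝ᵥ (e α).coord hx w)
    (hU : ∀ x, ∃ α, x ∈ U α) :
    ∑ α, D.prime ((D.chi α).map D.adjoint) (D.chi α) = FormalSeries.const 1 := by
  refine D.Tmat_injective hU hh₀ ?_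
  rw [D.Tmat_sum, D.Tmat_one hU hh₀, ← D.sum_star_Tmat_chi_mul hU hh₀]
  refine Finset.sum_congr rfl fun α _ => ?_
  rw [D.Tmat_prime hU hh₀, D.Tmat_adjoint hU hh₀]

theorem map_germ_T_chi
    (hh₀ : ∀ α x (hx : x ∈ U α) (v w : E x),
      h₀.inner x v w = star ((e α).coord hx v) ⬝ᵥ (e α).coord hx w)
    (hU : ∀ x, ∃ α, x ∈ U α) {α : Fin m} {x : M} (hx : x ∉ tsupport (ρ.toFun α)) (β : Fin m) :
    (D.T (D.chi α) β).map (germ (U β) x) = 0 := by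
  rw [← D.Tmat_apply hU, D.Tmat_chi hU hh₀]
  change ((D.T _ β) * (D.T _ β)).map _ = 0
  rw [Matrix.map_mul, T, Matrix.map_mul, Matrix.map_mul,
    Φ.map_germ_Ttilde_eq_zero ρ (A := FormalSeries.const (EndSec.scalar (ρ.toFun α)))]
  · simp
  · intro n
    filter_upwards [notMem_tsupport_iff_eventuallyEq.1 hx] with y hy
    by_cases hn : n = 0
    · subst hn
      change ρ.toFun α y • (1 : Module.End ℂ (E y)) = 0
      rw [hy]
      exact zero_smul _ _
    · simp [FormalSeries.const, hn]

theorem closure_support_chi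
    (hh₀ : ∀ α x (hx : x ∈ U α) (v w : E x),
      h₀.inner x v w = star ((e α).coord hx v) ⬝ᵥ (e α).coord hx w)
    (hU : ∀ x, ∃ α, x ∈ U α) (α : Fin m) :
    closure {x | ∃ r, ((D.chi α).coeff r).1 x ≠ 0} ⊆ U α := by
  refine (closure_minimal ?_ (isClosed_tsupport (ρ.toFun α))).trans (ρ.subordinate α)
  rintro x ⟨r, hr⟩
  by_contra hx
  refine hr (Φ.eq_zero_of_map_germ_Ttilde_eq_zero ρ hU
    (isClosed_tsupport (ρ.toFun α)).isOpen_compl (D.chi α) (fun y hy β => ?_) r x hx)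
  rw [← Φ.tau_apply ρ hU, D.tau_eq hU hh₀]
  change ((_ * D.T (D.chi α) β) * _).map _ = 0
  rw [Matrix.map_mul, Matrix.map_mul, D.map_germ_T_chi hh₀ hU hy, mul_zero, zero_mul]

end EndDeformation

end DeformedTransition

end QuantumSerreSwan

end

noncomputable section

namespace QuantumSerreSwan

/-- Right linear maps between free modules are given by matrices. -/
theorem exists_matrix_mulVec_eq {R ι : Type*} [Ring R] [Fintype ι] [DecidableEq ι]
    (f : (ι → R) →ₗ[Rᵐᵒᵖ] (ι → R)) : ∃ Q : Matrix ι ι R, ∀ t, f t = Q *ᵥ t := by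
  refine ⟨Matrix.of fun i j => f (Pi.single j 1) i, fun t => ?_⟩
  have h : t = ∑ j, MulOpposite.op (t j) • Pi.single j (1 : R) := by
    funext i
    simp [Finset.sum_apply, Pi.single_apply]
  conv_lhs => rw [h, map_sum]
  funext i
  simp [Finset.sum_apply, Matrix.mulVec, dotProduct]

theorem mulVec_mul_right {R ι κ : Type*} [Ring R] [Fintype κ] (A : Matrix ι κ R) (v : κ → R)
    (c : R) (i : ι) : (A *ᵥ fun j => v j * c) i = (A *ᵥ v) i * c := by
  simp [Matrix.mulVec, dotProduct, Finset.sum_mul, mul_assoc]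

theorem finite_projective_of_split {R ι W : Type*} [Ring R] [Fintype ι] [AddCommGroup W]
    [Module Rᵐᵒᵖ W] (ε : W →ₗ[Rᵐᵒᵖ] (ι → R)) (ϖ : (ι → R) →ₗ[Rᵐᵒᵖ] W) (h : ∀ s, ϖ (ε s) = s) :
    Module.Finite Rᵐᵒᵖ W ∧ Module.Projective Rᵐᵒᵖ W := by
  classical
  let l : Rᵐᵒᵖ ≃ₗ[Rᵐᵒᵖ] R :=
    { toFun := MulOpposite.unop
      invFun := MulOpposite.op
      left_inv := fun _ => rfl
      right_inv := fun _ => rfl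
      map_add' := fun _ _ => rfl
      map_smul' := fun _ _ => rfl }
  have : Module.Finite Rᵐᵒᵖ R := Module.Finite.equiv l
  have : Module.Free Rᵐᵒᵖ R := Module.Free.of_equiv l
  exact ⟨Module.Finite.of_surjective ϖ fun s => ⟨ε s, h s⟩,
    Module.Projective.of_split ε ϖ (LinearMap.ext h)⟩

variable {d : ℕ} {M : Type*} [TopologicalSpace M] [ChartedSpace (EuclideanSpace ℝ (Fin d)) M]

open StarProduct

section

variable [IsManifold (𝓡 d) ∞ M] [T2Space M] {P : PoissonStructure d M} {S : StarProduct P}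

theorem StarProduct.toLoc_mul (V : Opens M) (f g : S.Alg) :
    toLoc V (f * g) = toLoc V f * toLoc V g :=
  loc_ext fun x hx => by simp only [map_mul, germ_toLoc hx]

theorem StarProduct.toLoc_add (V : Opens M) (f g : S.Alg) :
    toLoc V (f + g) = toLoc V f + toLoc V g := rfl

theorem StarProduct.toLoc_zero (V : Opens M) : toLoc V (0 : S.Alg) = 0 := rfl

theorem StarProduct.toLoc_smul (V : Opens M) (a : ℂ⟦X⟧) (f : S.Alg) :
    toLoc V (a • f) = a • toLoc V f :=
  loc_ext fun x hx => by rw [germ_smul, germ_toLoc hx, germ_toLoc hx, toStalk_smul]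

theorem StarProduct.toLoc_one (V : Opens M) : toLoc V (1 : S.Alg) = 1 :=
  loc_ext fun x hx => by rw [germ_toLoc hx, germ_one hx, map_one]

theorem StarProduct.toLoc_star (V : Opens M) (f : S.Alg) :
    toLoc V (star f) = star (toLoc V f) := rfl

/-- Every finite partition of unity can be replaced by a quadratic one. -/
theorem exists_quadraticPartition {m : ℕ} {U : Fin m → Opens M}
    (χ : SmoothPartitionOfUnity (Fin m) (𝓡 d) M) (hχ : χ.IsSubordinate fun α => (U α : Set M)) :
    Nonempty (QuadraticPartition d U) := by
  have hpos : ∀ x, 0 < ∑ β, χ β x * χ β x := by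
    intro x
    have h := χ.sum_eq_one (Set.mem_univ x)
    rw [finsum_eq_sum_of_fintype] at h
    obtain ⟨β, -, hβ⟩ := Finset.exists_ne_zero_of_sum_ne_zero (h.trans_ne one_ne_zero)
    exact Finset.sum_pos' (fun γ _ => mul_self_nonneg _)
      ⟨β, Finset.mem_univ β, mul_self_pos.2 hβ⟩
  let N : M → ℝ := fun x => ∑ β, χ β x * χ β x
  have hN : ContMDiff (𝓡 d) 𝓘(ℝ) ∞ N :=
    ContMDiff.sum fun β _ => (χ β).contMDiff.mul (χ β).contMDiff
  have hsq : ContMDiff (𝓡 d) 𝓘(ℝ) ∞ fun x => (Real.sqrt (N x))⁻¹ := by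
    intro x
    have h : ContMDiffAt 𝓘(ℝ) 𝓘(ℝ) ∞ (fun r => (Real.sqrt r)⁻¹) (N x) :=
      ((Real.contDiffAt_sqrt (hpos x).ne').inv (Real.sqrt_pos.2 (hpos x)).ne').contMDiffAt
    exact h.comp x hN.contMDiffAt
  let c : Fin m → C^∞⟮𝓡 d, M; 𝓘(ℝ), ℝ⟯ := fun β =>
    ⟨fun x => χ β x * (Real.sqrt (N x))⁻¹, (χ β).contMDiff.mul hsq⟩
  refine ⟨⟨fun β => complexify (c β), fun β => ?_, ?_⟩⟩
  · rw [tsupport_complexify]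
    exact (tsupport_mul_subset_left (f := χ β) (g := fun x => (Real.sqrt (N x))⁻¹)).trans (hχ β)
  · ext x
    rw [StarProduct.sum_apply]
    have h1 : ∀ β, (star (complexify (c β)) * complexify (c β)) x =
        ((χ β x * χ β x * (N x)⁻¹ : ℝ) : ℂ) := by
      intro β
      change star ((χ β x * (Real.sqrt (N x))⁻¹ : ℝ) : ℂ) * ((χ β x * (Real.sqrt (N x))⁻¹ : ℝ) : ℂ)
        = _
      rw [Complex.star_def, Complex.conj_ofReal, ← Complex.ofReal_mul, mul_mul_mul_comm, ← mul_inv,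
        Real.mul_self_sqrt (hpos x).le]
    simp only [h1]
    rw [← Complex.ofReal_sum, ← Finset.sum_mul]
    change (((N x) * (N x)⁻¹ : ℝ) : ℂ) = 1
    rw [mul_inv_cancel₀ (hpos x).ne', Complex.ofReal_one]

end

variable {k : ℕ} {E : M → Type*} [∀ x, AddCommGroup (E x)] [∀ x, Module ℂ (E x)]
  [∀ x, TopologicalSpace (E x)] [TopologicalSpace (TotalSpace (Fin k → ℂ) E)]
  [FiberBundle (Fin k → ℂ) E] [VectorBundle ℂ (Fin k → ℂ) E] [VectorBundle ℝ (Fin k → ℂ) E]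
  [IsManifold (𝓡 d) ∞ M] [T2Space M] {P : PoissonStructure d M} {S : StarProduct P}
  {m : ℕ} {U : Fin m → Opens M}

namespace DeformedTransition

variable {e : ∀ α, LocalFrame d k E (U α)} (Φ : DeformedTransition S e)

section Module

variable {χ : SmoothPartitionOfUnity (Fin m) (𝓡 d) M}

theorem IsCompatible.mul_right {v : ∀ α, Fin k → S.Loc (U α)} (hv : Φ.IsCompatible v) (f : S.Alg) :
    Φ.IsCompatible fun α i => v α i * toLoc (U α) f := by
  rw [isCompatible_iff] at hv ⊢
  intro x α β hα hβ
  funext i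
  simp only [map_mul, germ_toLoc hα, germ_toLoc hβ]
  rw [mulVec_mul_right, hv x α β hα hβ]

variable (hU : ∀ x, ∃ α, x ∈ U α) (hχ : χ.IsSubordinate fun α => (U α : Set M))

theorem lift_injective (hU : ∀ x, ∃ α, x ∈ U α) (hχ : χ.IsSubordinate fun α => (U α : Set M)) :
    Function.Injective (Φ.lift χ) := fun s t h =>
  (Φ.liftEquiv hU hχ).injective (Subtype.ext h)

theorem exists_lift_eq (hU : ∀ x, ∃ α, x ∈ U α) (hχ : χ.IsSubordinate fun α => (U α : Set M))
    {v : ∀ α, Fin k → S.Loc (U α)} (hv : Φ.IsCompatible v) : ∃ s, Φ.lift χ s = v := by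
  obtain ⟨s, hs⟩ := (Φ.liftEquiv hU hχ).surjective ⟨v, hv⟩
  exact ⟨s, congrArg Subtype.val hs⟩

/-- The deformed right multiplication of sections by functions. -/
def rsmul (hU : ∀ x, ∃ α, x ∈ U α) (hχ : χ.IsSubordinate fun α => (U α : Set M))
    (s : FormalSeries (Sec d k E)) (f : S.Alg) : FormalSeries (Sec d k E) :=
  (Φ.exists_lift_eq hU hχ
    (IsCompatible.mul_right Φ (Φ.isCompatible_lift hχ s) f)).choose

theorem lift_rsmul (hU : ∀ x, ∃ α, x ∈ U α) (hχ : χ.IsSubordinate fun α => (U α : Set M))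
    (s : FormalSeries (Sec d k E)) (f : S.Alg) :
    Φ.lift χ (Φ.rsmul hU hχ s f) = fun α i => Φ.lift χ s α i * toLoc (U α) f :=
  (Φ.exists_lift_eq hU hχ
    (IsCompatible.mul_right Φ (Φ.isCompatible_lift hχ s) f)).choose_spec

theorem lift_zero (hχ : χ.IsSubordinate fun α => (U α : Set M)) :
    Φ.lift χ (0 : FormalSeries (Sec d k E)) = 0 :=
  congrArg Subtype.val (map_zero (Φ.liftLinear hχ))

/-- The deformed right module structure on formal sections. -/
abbrev rightModule (hU : ∀ x, ∃ α, x ∈ U α) (hχ : χ.IsSubordinate fun α => (U α : Set M)) :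
    Module S.Algᵐᵒᵖ (FormalSeries (Sec d k E)) where
  smul f s := Φ.rsmul hU hχ s f.unop
  one_smul s := Φ.lift_injective hU hχ <| (Φ.lift_rsmul hU hχ s 1).trans <|
    funext fun α => funext fun i => by rw [toLoc_one, mul_one]
  mul_smul f g s := Φ.lift_injective hU hχ <| by
    change Φ.lift χ (Φ.rsmul hU hχ s (g.unop * f.unop)) =
      Φ.lift χ (Φ.rsmul hU hχ (Φ.rsmul hU hχ s g.unop) f.unop)
    rw [lift_rsmul, lift_rsmul, lift_rsmul]
    funext α i
    rw [toLoc_mul, mul_assoc]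
  smul_zero f := Φ.lift_injective hU hχ <| by
    change Φ.lift χ (Φ.rsmul hU hχ 0 f.unop) = _
    rw [lift_rsmul]
    rw [Φ.lift_zero hχ]
    funext α i
    exact zero_mul _
  smul_add f s t := Φ.lift_injective hU hχ <| by
    change Φ.lift χ (Φ.rsmul hU hχ (s + t) f.unop) =
      Φ.lift χ (Φ.rsmul hU hχ s f.unop + Φ.rsmul hU hχ t f.unop)
    rw [Φ.lift_add hχ, lift_rsmul, lift_rsmul, lift_rsmul, Φ.lift_add hχ]
    funext α i
    exact add_mul _ _ _
  add_smul f g s := Φ.lift_injective hU hχ <| by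
    change Φ.lift χ (Φ.rsmul hU hχ s (f.unop + g.unop)) =
      Φ.lift χ (Φ.rsmul hU hχ s f.unop + Φ.rsmul hU hχ s g.unop)
    rw [Φ.lift_add hχ, lift_rsmul, lift_rsmul, lift_rsmul]
    funext α i
    rw [toLoc_add, mul_add]
    rfl
  zero_smul s := Φ.lift_injective hU hχ <| by
    change Φ.lift χ (Φ.rsmul hU hχ s 0) = _
    rw [lift_rsmul]
    rw [Φ.lift_zero hχ]
    funext α i
    rw [toLoc_zero, mul_zero]
    rfl

/-- The germs of the local expressions of a formal section. -/
def sgerm (χ : SmoothPartitionOfUnity (Fin m) (𝓡 d) M) (s : FormalSeries (Sec d k E)) (x : M)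
    (α : Fin m) : Fin k → S.Stalk x := fun i => germ (U α) x (Φ.lift χ s α i)

theorem phi_mulVec_sgerm (hχ : χ.IsSubordinate fun α => (U α : Set M))
    (s : FormalSeries (Sec d k E)) {x : M} {α β : Fin m} (hα : x ∈ U α) (hβ : x ∈ U β) :
    Φ.phi x α β *ᵥ Φ.sgerm χ s x β = Φ.sgerm χ s x α :=
  (Φ.isCompatible_iff _).1 (Φ.isCompatible_lift hχ s) x α β hα hβ

/-- The local formulas for the deformed Hermitian inner product fit together. -/
theorem exists_innerProduct (hU : ∀ x, ∃ α, x ∈ U α)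
    (hχ : χ.IsSubordinate fun α => (U α : Set M)) (s t : FormalSeries (Sec d k E)) :
    ∃ f : S.Alg, ∀ α, toLoc (U α) f = ∑ l, star (Φ.lift χ s α l) * Φ.lift χ t α l := by
  refine exists_toLoc_eq hU _ fun α β x hα hβ => ?_
  have h : ∀ γ, germ (U γ) x (∑ l, star (Φ.lift χ s γ l) * Φ.lift χ t γ l) =
      star (Φ.sgerm χ s x γ) ⬝ᵥ Φ.sgerm χ t x γ := fun γ => by
    simp only [map_sum, map_mul, germ_star]
    rfl
  rw [h, h, ← Φ.phi_mulVec_sgerm hχ s hα hβ, ← Φ.phi_mulVec_sgerm hχ t hα hβ, Matrix.star_mulVec,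
    ← Matrix.dotProduct_mulVec, Matrix.mulVec_mulVec, Φ.phi_conjTranspose,
    Φ.phi_mul_phi_symm hβ hα, Matrix.one_mulVec]

end Module

namespace EndDeformation

variable {Φ} {h₀ : HermitianMetric d k E} {ρ : QuadraticPartition d U}
  (D : Φ.EndDeformation h₀ ρ.toFun) {χ : SmoothPartitionOfUnity (Fin m) (𝓡 d) M}

/-- The germs of the local matrices of the deformed cut-off functions. -/
def chiGerm (x : M) (γ α : Fin m) : Matrix (Fin k) (Fin k) (S.Stalk x) :=
  (D.T (D.chi γ) α).map (germ (U α) x)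

theorem phi_mul_chiGerm (hU : ∀ x, ∃ α, x ∈ U α) {x : M} (γ : Fin m) {α β : Fin m}
    (hα : x ∈ U α) (hβ : x ∈ U β) :
    Φ.phi x α β * D.chiGerm x γ β = D.chiGerm x γ α * Φ.phi x α β := by
  have h := (Φ.isCompatibleMatrix_iff _).1 (D.Tmat hU (D.chi γ)).2 x α β hα hβ
  change Φ.phi x α β * D.chiGerm x γ β * Φ.phi x β α = D.chiGerm x γ α at h
  rw [← h, mul_assoc _ (Φ.phi x β α), Φ.phi_mul_phi_symm hβ hα, mul_one]

theorem sum_chiGerm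
    (hh₀ : ∀ α x (hx : x ∈ U α) (v w : E x),
      h₀.inner x v w = star ((e α).coord hx v) ⬝ᵥ (e α).coord hx w)
    (hU : ∀ x, ∃ α, x ∈ U α) {x : M} {α : Fin m} (hα : x ∈ U α) :
    ∑ γ, (D.chiGerm x γ α)ᴴ * D.chiGerm x γ α = 1 := by
  have h := congrArg (fun B : Φ.compatibleMatrix => (B.1 α).map (germ (U α) x))
    (D.sum_star_Tmat_chi_mul hU hh₀)
  have h1 : (∑ γ, star (D.Tmat hU (D.chi γ)) * D.Tmat hU (D.chi γ)).1 α =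
      ∑ γ, (D.T (D.chi γ) α)ᴴ * D.T (D.chi γ) α := by
    rw [AddSubmonoidClass.coe_finsetSum, Finset.sum_apply]
    rfl
  simp only [h1, map_germ_sum, Matrix.map_mul, map_germ_star] at h
  exact h.trans (map_germ_one hα)

theorem exists_epsilon
    (hh₀ : ∀ α x (hx : x ∈ U α) (v w : E x),
      h₀.inner x v w = star ((e α).coord hx v) ⬝ᵥ (e α).coord hx w)
    (hU : ∀ x, ∃ α, x ∈ U α) (hχ : χ.IsSubordinate fun α => (U α : Set M))
    [Module S.Algᵐᵒᵖ (FormalSeries (Sec d k E))]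
    (hmod : ∀ (s : FormalSeries (Sec d k E)) (f : S.Alg) α i,
      Φ.lift χ (MulOpposite.op f • s) α i = Φ.lift χ s α i * toLoc (U α) f) :
    ∃ ε : FormalSeries (Sec d k E) →ₗ[S.Algᵐᵒᵖ] (Fin m × Fin k → S.Alg), ∀ s x α i,
      S.toStalk x (ε s (α, i)) = (D.chiGerm x α α *ᵥ Φ.sgerm χ s x α) i := by
  have hex : ∀ s (p : Fin m × Fin k), ∃ F : S.Alg, ∀ x,
      S.toStalk x F = (D.chiGerm x p.1 p.1 *ᵥ Φ.sgerm χ s x p.1) p.2 := by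
    intro s p
    have h : ∀ x, germ (U p.1) x ((D.T (D.chi p.1) p.1 *ᵥ Φ.lift χ s p.1) p.2) =
        (D.chiGerm x p.1 p.1 *ᵥ Φ.sgerm χ s x p.1) p.2 := fun x => germ_mulVec _ _ _ _ _
    obtain ⟨F, hF⟩ := exists_extension_by_zero
      ((D.T (D.chi p.1) p.1 *ᵥ Φ.lift χ s p.1) p.2) (isClosed_tsupport (ρ.toFun p.1))
      (ρ.subordinate p.1) fun x hx => by
        rw [h, chiGerm, D.map_germ_T_chi hh₀ hU hx, Matrix.zero_mulVec]
        rfl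
    exact ⟨F, fun x => by rw [hF, h]⟩
  choose F hF using hex
  refine ⟨{ toFun := F, map_add' := fun s t => ?_, map_smul' := fun f s => ?_ },
    fun s x α i => hF s (α, i) x⟩
  · funext p
    refine alg_ext_of_toStalk fun x => ?_
    have h : Φ.sgerm χ (s + t) x p.1 = Φ.sgerm χ s x p.1 + Φ.sgerm χ t x p.1 := by
      funext i
      rw [sgerm, Φ.lift_add hχ]
      exact map_add _ _ _
    rw [Pi.add_apply, map_add, hF, hF, hF, h, Matrix.mulVec_add]
    rfl
  · funext p
    refine alg_ext_of_toStalk fun x => ?_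
    obtain ⟨α, i⟩ := p
    induction f using MulOpposite.rec' with | _ f => ?_
    change _ = S.toStalk x (F s (α, i) * f)
    rw [map_mul, hF, hF]
    by_cases hx : x ∈ U α
    · have h : Φ.sgerm χ (MulOpposite.op f • s) x α =
          fun i => Φ.sgerm χ s x α i * S.toStalk x f := by
        funext i
        rw [sgerm, hmod, map_mul, germ_toLoc hx]
        rfl
      rw [h, mulVec_mul_right]
    · rw [chiGerm, map_germ_of_notMem hx, Matrix.zero_mulVec, Matrix.zero_mulVec]
      simp

theorem germ_pi_summand
    (hh₀ : ∀ α x (hx : x ∈ U α) (v w : E x),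
      h₀.inner x v w = star ((e α).coord hx v) ⬝ᵥ (e α).coord hx w)
    (hU : ∀ x, ∃ α, x ∈ U α) (t : Fin m × Fin k → S.Alg) (α γ : Fin m) (i : Fin k) (x : M) :
    germ (U α) x (extZero (U α)
      ((Φ.Φ α γ * (D.T ((D.chi γ).map D.adjoint) γ).map (res inf_le_right)).mulVec
        (fun j => toLoc (U α ⊓ U γ) (t (γ, j))) i)) =
      (Φ.phi x α γ *ᵥ (D.chiGerm x γ γ)ᴴ *ᵥ fun j => S.toStalk x (t (γ, j))) i := by
  have hadj : D.T ((D.chi γ).map D.adjoint) γ = (D.T (D.chi γ) γ)ᴴ :=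
    congrFun (congrArg Subtype.val (D.Tmat_adjoint hU hh₀ (D.chi γ))) γ
  have h : ∀ x, germ (U α ⊓ U γ) x
      ((Φ.Φ α γ * (D.T ((D.chi γ).map D.adjoint) γ).map (res inf_le_right)).mulVec
        (fun j => toLoc (U α ⊓ U γ) (t (γ, j))) i) =
      (Φ.phi x α γ *ᵥ (D.chiGerm x γ γ)ᴴ *ᵥ fun j => S.toStalk x (t (γ, j))) i := by
    intro x
    by_cases hx : x ∈ U α ⊓ U γ
    · rw [germ_mulVec, Matrix.map_mul, map_germ_res _ hx, hadj, map_germ_star,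
        Matrix.mulVec_mulVec]
      simp only [germ_toLoc hx]
      rfl
    · rw [germ_of_notMem hx, phi, map_germ_of_notMem hx, Matrix.zero_mulVec]
      rfl
  rw [germ_extZero inf_le_left (isClosed_tsupport (ρ.toFun γ)) _ _ x, h]
  · exact fun y hy => ⟨hy.2, ρ.subordinate γ hy.1⟩
  · intro y hy
    rw [h, chiGerm, D.map_germ_T_chi hh₀ hU hy, Matrix.conjTranspose_zero, Matrix.zero_mulVec,
      Matrix.mulVec_zero]
    rfl

theorem exists_pi
    (hh₀ : ∀ α x (hx : x ∈ U α) (v w : E x),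
      h₀.inner x v w = star ((e α).coord hx v) ⬝ᵥ (e α).coord hx w)
    (hU : ∀ x, ∃ α, x ∈ U α) (hχ : χ.IsSubordinate fun α => (U α : Set M))
    [Module S.Algᵐᵒᵖ (FormalSeries (Sec d k E))]
    (hmod : ∀ (s : FormalSeries (Sec d k E)) (f : S.Alg) α i,
      Φ.lift χ (MulOpposite.op f • s) α i = Φ.lift χ s α i * toLoc (U α) f) :
    ∃ ϖ : (Fin m × Fin k → S.Alg) →ₗ[S.Algᵐᵒᵖ] FormalSeries (Sec d k E), ∀ t α i,
      Φ.lift χ (ϖ t) α i = ∑ γ, extZero (U α)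
        ((Φ.Φ α γ * (D.T ((D.chi γ).map D.adjoint) γ).map (res inf_le_right)).mulVec
          (fun j => toLoc (U α ⊓ U γ) (t (γ, j))) i) := by
  let v : (Fin m × Fin k → S.Alg) → ∀ α, Fin k → S.Loc (U α) := fun t α i =>
    ∑ γ, extZero (U α)
        ((Φ.Φ α γ * (D.T ((D.chi γ).map D.adjoint) γ).map (res inf_le_right)).mulVec
          (fun j => toLoc (U α ⊓ U γ) (t (γ, j))) i)
  have hv : ∀ t x α, (fun i => germ (U α) x (v t α i)) = ∑ γ, Φ.phi x α γ *ᵥ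
      (D.chiGerm x γ γ)ᴴ *ᵥ fun j => S.toStalk x (t (γ, j)) := by
    intro t x α
    funext i
    rw [Finset.sum_apply, map_sum]
    exact Finset.sum_congr rfl fun γ _ => D.germ_pi_summand hh₀ hU t α γ i x
  have hvc : ∀ t, Φ.IsCompatible (v t) := by
    intro t
    rw [isCompatible_iff]
    intro x α β hα hβ
    rw [hv, hv, Matrix.mulVec_sum]
    refine Finset.sum_congr rfl fun γ _ => ?_
    rw [Matrix.mulVec_mulVec, Φ.phi_mul_phi α γ hβ]
  choose F hF using fun t => Φ.exists_lift_eq hU hχ (hvc t)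
  refine ⟨{ toFun := F, map_add' := fun s t => ?_, map_smul' := fun f t => ?_ },
    fun t α i => congrFun (congrFun (hF t) α) i⟩
  · refine Φ.lift_injective hU hχ ?_
    rw [Φ.lift_add hχ, hF, hF, hF]
    refine lift_ext fun α x => ?_
    have h1 : (fun i => germ (U α) x ((v s + v t) α i)) =
        (fun i => germ (U α) x (v s α i)) + fun i => germ (U α) x (v t α i) :=
      funext fun i => map_add _ _ _
    rw [h1, hv, hv, hv, ← Finset.sum_add_distrib]
    refine Finset.sum_congr rfl fun γ _ => ?_
    rw [← Matrix.mulVec_add, ← Matrix.mulVec_add]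
    congr 2
  · refine Φ.lift_injective hU hχ ?_
    induction f using MulOpposite.rec' with | _ f => ?_
    refine lift_ext fun α x => funext fun i => ?_
    rw [RingHom.id_apply, hmod]
    by_cases hx : x ∈ U α
    · rw [map_mul, germ_toLoc hx, hF, hF]
      have h1 := congrFun (hv (MulOpposite.op f • t) x α) i
      have h2 := congrFun (hv t x α) i
      rw [h1, h2, Finset.sum_apply, Finset.sum_apply, Finset.sum_mul]
      refine Finset.sum_congr rfl fun γ _ => ?_
      have h3 : (fun j => S.toStalk x ((MulOpposite.op f • t) (γ, j))) =
          fun j => S.toStalk x (t (γ, j)) * S.toStalk x f :=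
        funext fun j => map_mul _ _ _
      rw [h3, Matrix.mulVec_mulVec, Matrix.mulVec_mulVec, mulVec_mul_right]
    · rw [germ_of_notMem hx, germ_of_notMem hx]

theorem chiGerm_mulVec_sgerm (hU : ∀ x, ∃ α, x ∈ U α)
    (hχ : χ.IsSubordinate fun α => (U α : Set M)) (s : FormalSeries (Sec d k E)) {x : M}
    (γ : Fin m) {α β : Fin m} (hα : x ∈ U α) (hβ : x ∈ U β) :
    Φ.phi x β α *ᵥ D.chiGerm x γ α *ᵥ Φ.sgerm χ s x α = D.chiGerm x γ β *ᵥ Φ.sgerm χ s x β := by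
  rw [Matrix.mulVec_mulVec, D.phi_mul_chiGerm hU γ hβ hα, ← Matrix.mulVec_mulVec,
    Φ.phi_mulVec_sgerm hχ s hβ hα]

theorem pi_epsilon
    (hh₀ : ∀ α x (hx : x ∈ U α) (v w : E x),
      h₀.inner x v w = star ((e α).coord hx v) ⬝ᵥ (e α).coord hx w)
    (hU : ∀ x, ∃ α, x ∈ U α) (hχ : χ.IsSubordinate fun α => (U α : Set M))
    (ε : FormalSeries (Sec d k E) → (Fin m × Fin k → S.Alg))
    (hε : ∀ s x α i, S.toStalk x (ε s (α, i)) = (D.chiGerm x α α *ᵥ Φ.sgerm χ s x α) i)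
    (ϖ : (Fin m × Fin k → S.Alg) → FormalSeries (Sec d k E))
    (hϖ : ∀ t α i, Φ.lift χ (ϖ t) α i = ∑ γ, extZero (U α)
        ((Φ.Φ α γ * (D.T ((D.chi γ).map D.adjoint) γ).map (res inf_le_right)).mulVec
          (fun j => toLoc (U α ⊓ U γ) (t (γ, j))) i))
    (s : FormalSeries (Sec d k E)) : ϖ (ε s) = s := by
  refine Φ.lift_injective hU hχ (funext fun α => funext fun i => loc_ext fun x hα => ?_)
  rw [hϖ, map_sum]
  have h1 : ∀ γ, (Φ.phi x α γ *ᵥ (D.chiGerm x γ γ)ᴴ *ᵥ fun j => S.toStalk x (ε s (γ, j))) =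
      ((D.chiGerm x γ α)ᴴ * D.chiGerm x γ α) *ᵥ Φ.sgerm χ s x α := by
    intro γ
    have h2 : (fun j => S.toStalk x (ε s (γ, j))) = D.chiGerm x γ γ *ᵥ Φ.sgerm χ s x γ :=
      funext fun j => hε s x γ j
    rw [h2]
    by_cases hγ : x ∈ U γ
    · have h3 : Φ.phi x α γ * (D.chiGerm x γ γ)ᴴ = (D.chiGerm x γ α)ᴴ * Φ.phi x α γ := by
        have := congrArg Matrix.conjTranspose (D.phi_mul_chiGerm hU γ hγ hα)
        rw [Matrix.conjTranspose_mul, Matrix.conjTranspose_mul, Φ.phi_conjTranspose] at this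
        exact this.symm
      rw [Matrix.mulVec_mulVec (M := Φ.phi x α γ), h3, ← Matrix.mulVec_mulVec,
        D.chiGerm_mulVec_sgerm hU hχ s γ hγ hα, Matrix.mulVec_mulVec]
    · have h4 : D.chiGerm x γ α = 0 :=
        D.map_germ_T_chi hh₀ hU (fun h => hγ (ρ.subordinate γ h)) α
      rw [h4, Φ.phi_of_notMem_right α hγ, mul_zero, Matrix.zero_mulVec, Matrix.zero_mulVec]
  simp only [D.germ_pi_summand hh₀ hU, h1]
  rw [← Finset.sum_apply, ← Matrix.sum_mulVec, D.sum_chiGerm hh₀ hU hα, Matrix.one_mulVec]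
  rfl

/-- The deformed inner product is a sum of squares. -/
theorem innerProduct_self_eq
    (hh₀ : ∀ α x (hx : x ∈ U α) (v w : E x),
      h₀.inner x v w = star ((e α).coord hx v) ⬝ᵥ (e α).coord hx w)
    (hU : ∀ x, ∃ α, x ∈ U α) (hχ : χ.IsSubordinate fun α => (U α : Set M))
    (ε : FormalSeries (Sec d k E) → (Fin m × Fin k → S.Alg))
    (hε : ∀ s x α i, S.toStalk x (ε s (α, i)) = (D.chiGerm x α α *ᵥ Φ.sgerm χ s x α) i)
    (s : FormalSeries (Sec d k E)) (f : S.Alg)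
    (hf : ∀ α, toLoc (U α) f = ∑ l, star (Φ.lift χ s α l) * Φ.lift χ s α l) :
    f = ∑ p, star (ε s p) * ε s p := by
  refine alg_ext_of_toStalk fun x => ?_
  obtain ⟨α, hα⟩ := hU x
  rw [← germ_toLoc hα, hf, Fintype.sum_prod_type]
  have h1 : ∀ γ, S.toStalk x (∑ l, star (ε s (γ, l)) * ε s (γ, l)) =
      star (Φ.sgerm χ s x α) ⬝ᵥ ((D.chiGerm x γ α)ᴴ * D.chiGerm x γ α) *ᵥ Φ.sgerm χ s x α := by
    intro γ
    have h2 : S.toStalk x (∑ l, star (ε s (γ, l)) * ε s (γ, l)) =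
        star (D.chiGerm x γ γ *ᵥ Φ.sgerm χ s x γ) ⬝ᵥ (D.chiGerm x γ γ *ᵥ Φ.sgerm χ s x γ) := by
      simp only [map_sum, map_mul, toStalk_star, hε]
      rfl
    rw [h2, ← Matrix.mulVec_mulVec, Matrix.dotProduct_mulVec (star (Φ.sgerm χ s x α)),
      ← Matrix.star_mulVec]
    by_cases hγ : x ∈ U γ
    · rw [← D.chiGerm_mulVec_sgerm hU hχ s γ hγ hα, Matrix.star_mulVec (Φ.phi x α γ),
        ← Matrix.dotProduct_mulVec, Matrix.mulVec_mulVec (M := (Φ.phi x α γ)ᴴ),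
        Φ.phi_conjTranspose, Φ.phi_mul_phi_symm hγ hα, Matrix.one_mulVec]
    · have h3 : ∀ β, D.chiGerm x γ β = 0 :=
        D.map_germ_T_chi hh₀ hU (fun h => hγ (ρ.subordinate γ h))
      rw [h3, h3]
      simp
  have h4 : germ (U α) x (∑ l, star (Φ.lift χ s α l) * Φ.lift χ s α l) =
      star (Φ.sgerm χ s x α) ⬝ᵥ Φ.sgerm χ s x α := by
    simp only [map_sum, map_mul, germ_star]
    rfl
  rw [h4, map_sum]
  simp only [h1]
  rw [← dotProduct_sum, ← Matrix.sum_mulVec, D.sum_chiGerm hh₀ hU hα, Matrix.one_mulVec]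

/-- The local matrices of the deformed cut-off functions split off the quantum module from a free
module. -/
theorem exists_splitting
    (hh₀ : ∀ α x (hx : x ∈ U α) (v w : E x),
      h₀.inner x v w = star ((e α).coord hx v) ⬝ᵥ (e α).coord hx w)
    (hU : ∀ x, ∃ α, x ∈ U α) (hχ : χ.IsSubordinate fun α => (U α : Set M))
    [Module S.Algᵐᵒᵖ (FormalSeries (Sec d k E))]
    (hmod : ∀ (s : FormalSeries (Sec d k E)) (f : S.Alg) α i,
      Φ.lift χ (MulOpposite.op f • s) α i = Φ.lift χ s α i * toLoc (U α) f) :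
    ∃ (ε : FormalSeries (Sec d k E) →ₗ[S.Algᵐᵒᵖ] (Fin m × Fin k → S.Alg))
      (ϖ : (Fin m × Fin k → S.Alg) →ₗ[S.Algᵐᵒᵖ] FormalSeries (Sec d k E))
      (Q : Matrix (Fin m × Fin k) (Fin m × Fin k) S.Alg),
      (∀ s α i, toLoc (U α) (ε s (α, i)) = (D.T (D.chi α) α).mulVec (Φ.lift χ s α) i ∧
        ∀ x ∉ U α, ∀ r, (ε s (α, i)).coeff r x = 0) ∧
      (∀ t α i, Φ.lift χ (ϖ t) α i =
        ∑ γ, extZero (U α)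
          ((Φ.Φ α γ * (D.T ((D.chi γ).map D.adjoint) γ).map (res inf_le_right)).mulVec
            (fun j => toLoc (U α ⊓ U γ) (t (γ, j))) i)) ∧
      (∀ s, ϖ (ε s) = s) ∧ (∀ t, ε (ϖ t) = Q.mulVec t) ∧ Q * Q = Q ∧
      Function.Injective ε ∧ Set.range ε = Set.range Q.mulVec := by
  obtain ⟨ε, hε⟩ := D.exists_epsilon hh₀ hU hχ hmod
  obtain ⟨ϖ, hϖ⟩ := D.exists_pi hh₀ hU hχ hmod
  have hsplit := D.pi_epsilon hh₀ hU hχ ε hε ϖ hϖ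
  obtain ⟨Q, hQ⟩ := exists_matrix_mulVec_eq (ε ∘ₗ ϖ)
  replace hQ : ∀ t, ε (ϖ t) = Q.mulVec t := hQ
  refine ⟨ε, ϖ, Q, fun s α i => ⟨loc_ext fun x hx => ?_, fun x hx r => ?_⟩, hϖ, hsplit, hQ, ?_,
    Function.LeftInverse.injective hsplit, ?_⟩
  · rw [germ_toLoc hx, hε, germ_mulVec]
    rfl
  · rw [← Stalk.coeff_toStalk, hε, chiGerm, map_germ_of_notMem hx, Matrix.zero_mulVec]
    exact Stalk.coeff_zero r
  · refine Matrix.ext_of_mulVec_single fun j => ?_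
    rw [← Matrix.mulVec_mulVec, ← hQ, ← hQ, hsplit]
  · ext t
    constructor
    · rintro ⟨s, rfl⟩
      exact ⟨ε s, by rw [← hQ, hsplit]⟩
    · rintro ⟨t, rfl⟩
      exact ⟨ϖ t, hQ t⟩

end EndDeformation

/-- The deformed Hermitian inner product. -/
theorem exists_isHermitianInnerProduct (h₀ : HermitianMetric d k E)
    (hh₀ : ∀ α x (hx : x ∈ U α) (v w : E x),
      h₀.inner x v w = star ((e α).coord hx v) ⬝ᵥ (e α).coord hx w)
    (hU : ∀ x, ∃ α, x ∈ U α) {χ : SmoothPartitionOfUnity (Fin m) (𝓡 d) M}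
    (hχ : χ.IsSubordinate fun α => (U α : Set M))
    [Module S.Algᵐᵒᵖ (FormalSeries (Sec d k E))]
    (hmod : ∀ (s : FormalSeries (Sec d k E)) (f : S.Alg) α i,
      Φ.lift χ (MulOpposite.op f • s) α i = Φ.lift χ s α i * toLoc (U α) f)
    (hpos : ∀ s (f : S.Alg),
      (∀ α, toLoc (U α) f = ∑ l, star (Φ.lift χ s α l) * Φ.lift χ s α l) →
        HermitianDeformation.IsPositive f) :
    ∃ h : FormalSeries (Sec d k E) → FormalSeries (Sec d k E) → S.Alg,
      (∀ s t α, toLoc (U α) (h s t) = ∑ l, star (Φ.lift χ s α l) * Φ.lift χ t α l) ∧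
      HermitianDeformation.IsHermitianInnerProduct h ∧
      (∀ s t x, (h s t).coeff 0 x = h₀.inner x (s.coeff 0 x) (t.coeff 0 x)) := by
  choose h hh using Φ.exists_innerProduct hU hχ
  refine ⟨h, hh, ⟨fun s t u => toLoc_ext hU fun α => ?_, fun a s t => toLoc_ext hU fun α => ?_,
    fun s t => toLoc_ext hU fun α => ?_, fun s t f => toLoc_ext hU fun α => ?_,
    fun s => hpos s _ (hh s s)⟩, fun s t x => ?_⟩
  · rw [toLoc_add, hh, hh, hh, Φ.lift_add hχ, ← Finset.sum_add_distrib]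
    refine Finset.sum_congr rfl fun l _ => ?_
    rw [Pi.add_apply, Pi.add_apply, mul_add]
  · rw [toLoc_smul, hh, hh, Φ.lift_smul hχ, Finset.smul_sum]
    refine Finset.sum_congr rfl fun l _ => ?_
    rw [Pi.smul_apply, Pi.smul_apply, mul_smul_comm]
  · rw [toLoc_star, hh, hh, star_sum]
    refine Finset.sum_congr rfl fun l _ => ?_
    rw [star_mul, star_star]
  · rw [toLoc_mul, hh, hh, Finset.sum_mul]
    refine Finset.sum_congr rfl fun l _ => ?_
    rw [hmod, mul_assoc]
  · obtain ⟨α, hα⟩ := hU x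
    rw [hh₀ α x hα, ← eval_toStalk, ← germ_toLoc hα, hh, map_sum, map_sum]
    refine Finset.sum_congr rfl fun l _ => ?_
    rw [map_mul, map_mul, germ_star, Stalk.eval_star, eval_germ hα, eval_germ hα,
      Φ.lift_coeff_zero hχ, Φ.lift_coeff_zero hχ]
    rfl

end DeformedTransition

end QuantumSerreSwan

end

theorem mainTheorem11 {d k m : ℕ}
    {M : Type*} [TopologicalSpace M] [ChartedSpace (EuclideanSpace ℝ (Fin d)) M]
    [IsManifold (𝓡 d) ∞ M] [T2Space M] [SecondCountableTopology M]
    {E : M → Type*} [∀ x, AddCommGroup (E x)] [∀ x, Module ℂ (E x)]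
    [∀ x, TopologicalSpace (E x)] [TopologicalSpace (TotalSpace (Fin k → ℂ) E)]
    [FiberBundle (Fin k → ℂ) E] [VectorBundle ℂ (Fin k → ℂ) E] [VectorBundle ℝ (Fin k → ℂ) E]
    [ContMDiffVectorBundle ∞ (Fin k → ℂ) E (𝓡 d)]
    (P : PoissonStructure d M) (S : StarProduct P)
    (U : Fin m → Opens M) (hU : ∀ x, ∃ α, x ∈ U α)
    (e : ∀ α, LocalFrame d k E (U α)) (Φ : DeformedTransition S e)
    (χ : SmoothPartitionOfUnity (Fin m) (𝓡 d) M)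
    (hχ : χ.IsSubordinate fun α => (U α : Set M)) :
    -- the classical fiber metric for which the frames are orthonormal
    ∃ h₀ : HermitianMetric d k E,
      (∀ α, ∀ x ∈ U α, ∀ i j,
        h₀.inner x ((e α).vec i x) ((e α).vec j x) = if i = j then 1 else 0) ∧
      -- `s ↦ (𝐬_α)` is a `ℂ[[λ]]`-linear bijection onto the compatible collections
      (∀ s, Φ.IsCompatible (Φ.lift χ s)) ∧
      (∀ s α i, (Φ.lift χ s α i).coeff 0 =
        ((e α).coeffs s i : S.Loc (U α)).coeff 0) ∧
      (∀ s t, Φ.lift χ (s + t) = Φ.lift χ s + Φ.lift χ t) ∧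
      (∀ (a : ℂ⟦X⟧) s, Φ.lift χ (a • s) = a • Φ.lift χ s) ∧
      (∀ v, Φ.IsCompatible v → ∃! s, Φ.lift χ s = v) ∧
      -- the deformed right module structure `•`
      ∃ _ : Module S.Algᵐᵒᵖ (FormalSeries (Sec d k E)),
        (∀ (s : FormalSeries (Sec d k E)) (f : S.Alg) α i,
          Φ.lift χ (MulOpposite.op f • s) α i = Φ.lift χ s α i * toLoc (U α) f) ∧
        (∀ (s : FormalSeries (Sec d k E)) (f : S.Alg) x,
          (MulOpposite.op f • s).coeff 0 x = f.coeff 0 x • s.coeff 0 x) ∧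
        (∀ (a : ℂ⟦X⟧) (s : FormalSeries (Sec d k E)) (f : S.Alg),
          MulOpposite.op (a • f) • s = a • (MulOpposite.op f • s) ∧
          MulOpposite.op f • (a • s) = a • (MulOpposite.op f • s)) ∧
        -- the deformed Hermitian inner product
        (∃ h : FormalSeries (Sec d k E) → FormalSeries (Sec d k E) → S.Alg,
          (∀ s t α, toLoc (U α) (h s t) =
            ∑ l, star (Φ.lift χ s α l) * Φ.lift χ t α l) ∧
          HermitianDeformation.IsHermitianInnerProduct h ∧
          (∀ s t x, (h s t).coeff 0 x = h₀.inner x (s.coeff 0 x) (t.coeff 0 x))) ∧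
        -- the module is finitely generated and projective
        Module.Finite S.Algᵐᵒᵖ (FormalSeries (Sec d k E)) ∧
        Module.Projective S.Algᵐᵒᵖ (FormalSeries (Sec d k E)) ∧
        -- explicitly, for every quadratic partition of unity
        ∀ ρ : QuadraticPartition d U,
          (∀ A, Φ.IsCompatibleMatrix (Φ.Ttilde ρ.toFun A)) ∧
          (∀ A α i j, (Φ.Ttilde ρ.toFun A α i j).coeff 0 =
            ((e α).matrix A i j : S.Loc (U α)).coeff 0) ∧
          (∀ B, Φ.IsCompatibleMatrix B → ∃! A, Φ.Ttilde ρ.toFun A = B) ∧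
          Nonempty (Φ.EndDeformation h₀ ρ.toFun) ∧
          ∀ D : Φ.EndDeformation h₀ ρ.toFun,
            (∀ A B α, D.T (D.prime A B) α = D.T A α * D.T B α) ∧
            (∀ A α, D.T (A.map D.adjoint) α = (D.T A α)ᴴ) ∧
            (∀ α, D.T (FormalSeries.const 1) α = 1) ∧
            ∑ α, D.prime ((D.chi α).map D.adjoint) (D.chi α) = FormalSeries.const 1 ∧
            (∀ α, closure {x | ∃ r, ((D.chi α).coeff r).1 x ≠ 0} ⊆ U α) ∧
            ∃ (ε : FormalSeries (Sec d k E) →ₗ[S.Algᵐᵒᵖ] (Fin m × Fin k → S.Alg))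
              (ϖ : (Fin m × Fin k → S.Alg) →ₗ[S.Algᵐᵒᵖ] FormalSeries (Sec d k E))
              (Q : Matrix (Fin m × Fin k) (Fin m × Fin k) S.Alg),
              (∀ s α i,
                toLoc (U α) (ε s (α, i)) =
                  (D.T (D.chi α) α).mulVec (Φ.lift χ s α) i ∧
                ∀ x ∉ U α, ∀ r, (ε s (α, i)).coeff r x = 0) ∧
              (∀ t α i, Φ.lift χ (ϖ t) α i =
                ∑ γ, extZero (U α)
                  ((Φ.Φ α γ * (D.T ((D.chi γ).map D.adjoint) γ).map (res inf_le_right)).mulVec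
                    (fun j => toLoc (U α ⊓ U γ) (t (γ, j))) i)) ∧
              (∀ s, ϖ (ε s) = s) ∧
              (∀ t, ε (ϖ t) = Q.mulVec t) ∧
              Q * Q = Q ∧
              Function.Injective ε ∧
              Set.range ε = Set.range Q.mulVec := by
  obtain ⟨h₀, hh₀⟩ := Φ.exists_metric hU
  let modE : Module S.Algᵐᵒᵖ (FormalSeries (Sec d k E)) := Φ.rightModule hU hχ
  have hmod : ∀ (s : FormalSeries (Sec d k E)) (f : S.Alg) α i,
      Φ.lift χ (MulOpposite.op f • s) α i = Φ.lift χ s α i * toLoc (U α) f :=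
    fun s f α i => congrFun (congrFun (Φ.lift_rsmul hU hχ s f) α) i
  have hinj := Φ.lift_injective hU hχ
  obtain ⟨ρ₀⟩ := exists_quadraticPartition χ hχ
  obtain ⟨D₀⟩ := Φ.exists_endDeformation ρ₀ hU h₀ hh₀
  obtain ⟨ε₀, hε₀⟩ := D₀.exists_epsilon hh₀ hU hχ hmod
  obtain ⟨ϖ₀, hϖ₀⟩ := D₀.exists_pi hh₀ hU hχ hmod
  obtain ⟨hfin, hproj⟩ := finite_projective_of_split ε₀ ϖ₀
    (D₀.pi_epsilon hh₀ hU hχ ε₀ hε₀ ϖ₀ hϖ₀)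
  refine ⟨h₀, fun α x hx i j => ?_, Φ.isCompatible_lift hχ, Φ.lift_coeff_zero hχ, Φ.lift_add hχ,
    Φ.lift_smul hχ, fun v hv => ?_, modE, hmod, fun s f x => ?_, fun a s f => ⟨?_, ?_⟩, ?_, hfin,
    hproj, fun ρ => ⟨Φ.isCompatibleMatrix_Ttilde ρ, Φ.Ttilde_coeff_zero ρ, fun B hB => ?_,
      Φ.exists_endDeformation ρ hU h₀ hh₀, fun D => ⟨fun A B α => ?_, fun A α => ?_, fun α => ?_,
        D.sum_prime_chi hh₀ hU, D.closure_support_chi hh₀ hU, ?_⟩⟩⟩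
  · rw [hh₀ α x hx, LocalFrame.coord_vec, LocalFrame.coord_vec, ← Pi.single_star, star_one,
      single_one_dotProduct, Pi.single_apply]
  · obtain ⟨s, hs⟩ := Φ.exists_lift_eq hU hχ hv
    exact ⟨s, hs, fun t ht => hinj (ht.trans hs.symm)⟩
  · obtain ⟨α, hα⟩ := hU x
    refine ((e α).coord hα).injective ?_
    rw [map_smul]
    funext i
    rw [← LocalFrame.coeffs_coeff (S := S), ← Φ.lift_coeff_zero hχ, hmod,
      HermitianDeformation.Alg.coeff_mul_zero, Φ.lift_coeff_zero hχ, mul_comm]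
    rfl
  · refine hinj (funext fun α => funext fun i => ?_)
    rw [hmod, Φ.lift_smul hχ, toLoc_smul, mul_smul_comm]
    exact congrArg (a • ·) (hmod s f α i).symm
  · refine hinj (funext fun α => funext fun i => ?_)
    rw [hmod, Φ.lift_smul hχ, Φ.lift_smul hχ]
    refine (smul_mul_assoc a (Φ.lift χ s α i) (toLoc (U α) f)).trans ?_
    exact congrArg (a • ·) (hmod s f α i).symm
  · refine Φ.exists_isHermitianInnerProduct h₀ hh₀ hU hχ hmod fun s f hf => ?_
    rw [D₀.innerProduct_self_eq hh₀ hU hχ ε₀ hε₀ s f hf]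
    exact HermitianDeformation.isPositive_sum_star_mul _
  · obtain ⟨A, hA⟩ := (Φ.tau ρ hU).surjective ⟨B, hB⟩
    exact ⟨A, congrArg Subtype.val hA,
      fun A' hA' => (Φ.tau ρ hU).injective (Subtype.ext (hA'.trans (congrArg Subtype.val hA).symm))⟩
  · exact congrFun (congrArg Subtype.val (D.Tmat_prime hU hh₀ A B)) α
  · exact congrFun (congrArg Subtype.val (D.Tmat_adjoint hU hh₀ A)) α
  · exact congrFun (congrArg Subtype.val (D.Tmat_one hU hh₀)) α
  · exact D.exists_splitting hh₀ hU hχ hmod
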